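/- Let $n\ge 2$ and let $(M^n,g)$ be an Einstein manifold, i.e. a smooth pseudo-Riemannian manifold (of signature $(p,q)$) with $\mathrm{Ric}(g)=2(n-1)\lambda g$ for a constant $\lambda\in\mathbb R$. Let $k\ge 1$ be an integer, put $$\mathcal I_k=\{-\tfrac{n-2k}{2}-\ell : 0\le \ell\le k-1\},\qquad \mathcal O_k=\{-\tfrac{n-2k}{2}+\ell : 0\le \ell\le k-1\},$$ and let $w_1,w_2\in\mathbb R$ be such that one of the following holds: (1) at most one of $w_1\in\mathcal I_k$, $w_2\in\mathcal I_k$, $w_1+w_2\in\mathcal O_k$ holds; (2) $w_1,w_2\in\mathcal I_k$, $w_1+w_2+n\le k$ and $w_1+w_2\notin\mathcal O_k$; (3) $w_1\in\mathcal I_k$, $w_1+w_2\in\mathcal O_k$, $w_2\ge k$ and $w_2\notin\mathcal I_k$; (4) $w_2\in\mathcal I_k$, $w_1+w_2\in\mathcal O_k$, $w_1\ge k$ and $w_1\notin\mathcal I_k$. Set $$a_{s,t}=\frac{\Gamma(-w_1-w_2-\frac{n-2k}{2}+s+t)\,\Gamma(w_1+\frac n2-s)\,\Gamma(w_2+\frac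 n2-t)}{\Gamma(-w_1-w_2-\frac{n-2k}{2})\,\Gamma(w_1+\frac{n-2k}{2})\,\Gamma(w_2+\frac{n-2k}{2})},$$ the ratio being understood via analytic continuation. An ambient space in straight and normal form for $(M,g)$ is an open set $\widetilde{\mathcal G}\subset\mathbb R_+\times M\times\mathbb R$ with coordinates $(t,x,\rho)$, invariant under $t\mapsto st$ for $s>0$ and containing $\{\rho=0\}$, with a smooth metric $\widetilde g=2\rho\,dt^2+2t\,dt\,d\rho+t^2g_\rho$ of signature $(p+1,q+1)$ such that $g_0=g$, and such that $\mathrm{Ric}(\widetilde g)=O(\rho^\infty)$ if $n$ is odd and $\mathrm{Ric}(\widetilde g)=O^+(\rho^{(n-2)/2})$ if $n$ is even. Here $S=O^+(\rho^m)$ means that $S=O(\rho^m)$ and that along $\rho=0$ the restriction of $\rho^{-m}S$ to $\{\rho=0\}$ is the pullback of a $g$-trace-free symmetric tensor at the corresponding point of $M$. Let $\widetilde\Delta$ be the Laplacian of $\widetilde g$ and $$\widetilde D_{2k;w_1,w_2}(\widetilde u\otimes\widetilde v)=\sum_{s=0}^k\sum_{t=0}^{k-s}\frac{k!}{(k-s-t)!\,s!\,t!}\,a_{s,t}\,\widetilde\Delta^{k-s-t}\bigl((\widetilde\Delta^s\widetilde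 u)(\widetilde\Delta^t\widetilde v)\bigr).$$ A bidifferential operator $D_{2k;w_1,w_2}$ on $C^\infty(M)$ is determined by $\widetilde D_{2k;w_1,w_2}$ if for all $u,v\in C^\infty(M)$ and all smooth extensions $\widetilde u,\widetilde v$ of $t^{w_1}u$, $t^{w_2}v$ from $\{\rho=0\}$ to $\widetilde{\mathcal G}$ that are homogeneous in $t$ of degrees $w_1,w_2$, the function $\widetilde D_{2k;w_1,w_2}(\widetilde u\otimes\widetilde v)$ restricts to $t^{w_1+w_2-2k}D_{2k;w_1,w_2}(u\otimes v)$ on $\{\rho=0\}$. Then $\widetilde D_{2k;w_1,w_2}$ determines the operator $$D_{2k;w_1,w_2}(u\otimes v)=\sum_{s=0}^k\sum_{t=0}^{k-s}\frac{k!}{(k-s-t)!\,s!\,t!}\,a_{s,t}\,L_{k-s-t;\,w_1+w_2-2s-2t}\bigl(L_{s;w_1}(u)\,L_{t;w_2}(v)\bigr),$$ $$L_{r;w}=\prod_{j=0}^{r-1}\bigl(\Delta+2(w-2j)(n+w-2j-1)\lambda\bigr),$$ where $\Delta=g^{ij}\nabla_i\nabla_j$, in each of the following situations: (a) for every $k\ge1$,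 on $\mathbb R_+\times M\times(-\varepsilon,\varepsilon)$ with $\widetilde g=2\rho\,dt^2+2t\,dt\,d\rho+t^2(1+\lambda\rho)^2g$, for every $\varepsilon>0$ with $|\lambda|\varepsilon\le1$; moreover this is an ambient space for $(M,g)$, and it is Ricci flat; (b) on every ambient space in straight and normal form for $(M,g)$, if $n$ is odd or $2k\le n$. -/

import Mathlib

open scoped Manifold ContDiff Topology

noncomputable section

/-! ### Pseudo-Riemannian geometry in a coordinate domain

`V` is the coordinate space and `G : V → V →L[ℝ] V →L[ℝ] ℝ` the matrix of metric coefficients,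
written without choosing a basis. -/

namespace CoordGeom

variable {V : Type*} [NormedAddCommGroup V] [NormedSpace ℝ V]

/-- The trace `B^{ij} S_{ij}` of a bilinear form `S` with respect to a nondegenerate form `B`. -/
def metricTrace (B S : V →L[ℝ] V →L[ℝ] ℝ) : ℝ :=
  LinearMap.trace ℝ V ((B.inverse.comp S : V →L[ℝ] V) : V →ₗ[ℝ] V)

set_option maxSynthPendingDepth 3 in
/-- The Christoffel symbols of the first kind, as the trilinear form
`(u, v, w) ↦ (∂_u G(v, w) + ∂_v G(u, w) - ∂_w G(u, v)) / 2`. -/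
def christoffelFirst (G : V → V →L[ℝ] V →L[ℝ] ℝ) (y : V) : V →L[ℝ] V →L[ℝ] V →L[ℝ] ℝ :=
  let D : V →L[ℝ] V →L[ℝ] V →L[ℝ] ℝ := fderiv ℝ G y
  let flip : (V →L[ℝ] V →L[ℝ] ℝ) →L[ℝ] V →L[ℝ] V →L[ℝ] ℝ :=
    (ContinuousLinearMap.flipₗᵢ ℝ V V ℝ).toContinuousLinearEquiv
  (2⁻¹ : ℝ) • (D + D.flip - flip.comp D.flip)

/-- The Christoffel symbols `Γ(u, v) = u^i v^j Γ_{ij}^k ∂_k`. -/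
def christoffel (G : V → V →L[ℝ] V →L[ℝ] ℝ) (y : V) : V →L[ℝ] V →L[ℝ] V :=
  (ContinuousLinearMap.compL ℝ V (V →L[ℝ] ℝ) V (G y).inverse).comp (christoffelFirst G y)

/-- The Hessian `∂_u ∂_v f - ∂_{Γ(u, v)} f`. -/
def hessian (G : V → V →L[ℝ] V →L[ℝ] ℝ) (f : V → ℝ) (y : V) : V →L[ℝ] V →L[ℝ] ℝ :=
  fderiv ℝ (fderiv ℝ f) y -
    (ContinuousLinearMap.compL ℝ V V ℝ (fderiv ℝ f y)).comp (christoffel G y)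

/-- The Laplacian `G^{ij} ∇_i ∇_j f`. -/
def laplacian (G : V → V →L[ℝ] V →L[ℝ] ℝ) (f : V → ℝ) (y : V) : ℝ :=
  metricTrace (G y) (hessian G f y)

/-- The curvature endomorphism `w ↦ R(w, u) v`, where
`R(w, u) v = (∂_w Γ)(u, v) - (∂_u Γ)(w, v) + Γ(w, Γ(u, v)) - Γ(u, Γ(w, v))`. -/
def curvature (G : V → V →L[ℝ] V →L[ℝ] ℝ) (y u v : V) : V →L[ℝ] V :=
  ((fderiv ℝ (christoffel G) y).flip u).flip v - (fderiv ℝ (christoffel G) y u).flip v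
    + (christoffel G y).flip (christoffel G y u v)
    - (christoffel G y u).comp ((christoffel G y).flip v)

/-- The Ricci curvature: the trace of `w ↦ R(w, u) v`. -/
def ricci (G : V → V →L[ℝ] V →L[ℝ] ℝ) (y u v : V) : ℝ :=
  LinearMap.trace ℝ V (curvature G y u v : V →ₗ[ℝ] V)

end CoordGeom

/-! ### Pseudo-Riemannian geometry on manifolds -/

section Manifolds

variable {V : Type*} [NormedAddCommGroup V] [NormedSpace ℝ V]
  {H : Type*} [TopologicalSpace H] (I : ModelWithCorners ℝ V H)
  {N : Type*} [TopologicalSpace N] [ChartedSpace H N]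

/-- Sections (with no regularity imposed) of `T^*N ⊗ T^*N`. -/
abbrev TwoTensor (N : Type*) [TopologicalSpace N] [ChartedSpace H N] : Type _ :=
  ∀ p : N, TangentSpace I p →L[ℝ] TangentSpace I p →L[ℝ] ℝ

/-- The coefficients of `h` in the preferred chart at `p`, as a function on the coordinate space:
`y ↦ ((u, v) ↦ h(u^i ∂_i, v^j ∂_j))`. -/
def TwoTensor.coord (h : TwoTensor I N) (p : N) (y : V) : V →L[ℝ] V →L[ℝ] ℝ :=
  let A : V →L[ℝ] V := mfderiv 𝓘(ℝ, V) I (extChartAt I p).symm y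
  let B : V →L[ℝ] V →L[ℝ] ℝ := h ((extChartAt I p).symm y)
  B.bilinearComp A A

/-- `h` is smooth on `U`: its coefficients in each of the preferred charts (which cover `N`)
are smooth. -/
def TwoTensor.SmoothOn (h : TwoTensor I N) (U : Set N) : Prop :=
  ∀ p : N, ContDiffOn ℝ ∞ (h.coord I p)
    ((extChartAt I p).target ∩ (extChartAt I p).symm ⁻¹' U)

/-- The Laplacian `Δ_h f = tr_h ∇² f`. -/
def laplacian (h : TwoTensor I N) (f : N → ℝ) (p : N) : ℝ :=
  CoordGeom.laplacian (h.coord I p) (f ∘ (extChartAt I p).symm) (extChartAt I p p)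

/-- The Ricci curvature of `h`. -/
def ricci (h : TwoTensor I N) (p : N) (u v : TangentSpace I p) : ℝ :=
  CoordGeom.ricci (h.coord I p) (extChartAt I p p)
    (mfderiv I 𝓘(ℝ, V) (extChartAt I p) p u) (mfderiv I 𝓘(ℝ, V) (extChartAt I p) p v)

/-- The symmetric bilinear form `B` is nondegenerate of signature `(p, q)`: the space splits into
a `p`-dimensional positive and a `q`-dimensional negative definite subspace. -/
def HasSignature (B : V →L[ℝ] V →L[ℝ] ℝ) (p q : ℕ) : Prop :=
  ∃ P Q : Submodule ℝ V, IsCompl P Q ∧ Module.finrank ℝ P = p ∧ Module.finrank ℝ Q = q ∧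
    (∀ v ∈ P, v ≠ 0 → 0 < B v v) ∧ (∀ v ∈ Q, v ≠ 0 → B v v < 0)

/-- `h` is a smooth pseudo-Riemannian metric of signature `(p, q)` on `U`. -/
structure IsPseudoRiemannianOn (h : TwoTensor I N) (U : Set N) (p q : ℕ) : Prop where
  smooth : h.SmoothOn I U
  symm : ∀ z ∈ U, ∀ u v : TangentSpace I z, h z u v = h z v u
  signature : ∀ z ∈ U, HasSignature (V := V) (h z) p q

end Manifolds

/-! ### Ambient spaces -/

section Ambient

variable {n : ℕ} {M : Type*} [TopologicalSpace M] [ChartedSpace (EuclideanSpace ℝ (Fin n)) M]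

/-- The model with corners of `ℝ × M × ℝ`. The choice of a representative `g` of the conformal
class identifies the bundle `𝒢` of metrics with `ℝ₊ × M` through `(t, x) ↦ (x, t² g_x)`, and so
`𝒢 × ℝ` with the points `(t, x, ρ)` of `ℝ × M × ℝ` that have `t > 0`. -/
abbrev ambientModel (n : ℕ) :=
  (𝓘(ℝ, ℝ)).prod ((𝓡 n).prod 𝓘(ℝ, ℝ))

/-- The dilation `δ_s (t, x, ρ) = (s t, x, ρ)`; this is `(x, g_x, ρ) ↦ (x, s² g_x, ρ)` on
`𝒢 × ℝ`. -/
def dilation (M : Type*) (s : ℝ) (z : ℝ × M × ℝ) : ℝ × M × ℝ := (s * z.1, z.2.1, z.2.2)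

/-- The tangent vector `a ∂_t + v + b ∂_ρ`. -/
def ambientVec (z : ℝ × M × ℝ) (a : ℝ) (v : TangentSpace (𝓡 n) z.2.1) (b : ℝ) :
    TangentSpace (ambientModel n) z :=
  ((a, v, b) : ℝ × EuclideanSpace ℝ (Fin n) × ℝ)

/-- `(U, h)` is a pre-ambient space for the conformal class of `g`, where `g` has signature
`(p, q)`. -/
structure IsPreAmbient (g : TwoTensor (𝓡 n) M) (p q : ℕ) (U : Set (ℝ × M × ℝ))
    (h : TwoTensor (ambientModel n) (ℝ × M × ℝ)) : Prop where
  isOpen : IsOpen U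
  pos : ∀ z ∈ U, 0 < z.1
  cone_mem : ∀ (t : ℝ) (x : M), 0 < t → (t, x, (0 : ℝ)) ∈ U
  dilation_mem : ∀ s : ℝ, 0 < s → ∀ z ∈ U, dilation M s z ∈ U
  metric : IsPseudoRiemannianOn (ambientModel n) h U (p + 1) (q + 1)
  -- `δ_s^* h = s² h`
  homogeneous : ∀ s : ℝ, 0 < s → ∀ z ∈ U, ∀ u v : TangentSpace (ambientModel n) z,
    h (dilation M s z)
      (mfderiv (ambientModel n) (ambientModel n) (dilation M s) z u)
      (mfderiv (ambientModel n) (ambientModel n) (dilation M s) z v) = s ^ 2 * h z u v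
  -- the pullback of `h` to `𝒢` is the canonical metric `t² g`
  restrict : ∀ (t : ℝ) (x : M), 0 < t →
    ∀ (a b : ℝ) (u v : TangentSpace (𝓡 n) x),
      h (t, x, 0) (ambientVec (t, x, 0) a u 0) (ambientVec (t, x, 0) b v 0) = t ^ 2 * g x u v

/-- `S = O(ρ^m)` on `U`: `S = ρ^m T` with `T` smooth on `U`. -/
def IsBigORho (U : Set (ℝ × M × ℝ)) (m : ℕ)
    (S : ∀ z : ℝ × M × ℝ, TangentSpace (ambientModel n) z → TangentSpace (ambientModel n) z → ℝ) :
    Prop :=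
  ∃ T : TwoTensor (ambientModel n) (ℝ × M × ℝ), T.SmoothOn (ambientModel n) U ∧
    ∀ z ∈ U, ∀ u v, S z u v = z.2.2 ^ m * T z u v

/-- `S = O⁺(ρ^m)` on `U`: `S = ρ^m T` with `T` smooth on `U`, and at each point of `𝒢` the
restriction of `T` to `𝒢` is the pullback of a symmetric form `σ` on `T_x M` that is trace free
with respect to `g`. -/
def IsBigORhoPlus (g : TwoTensor (𝓡 n) M) (U : Set (ℝ × M × ℝ)) (m : ℕ)
    (S : ∀ z : ℝ × M × ℝ, TangentSpace (ambientModel n) z → TangentSpace (ambientModel n) z → ℝ) :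
    Prop :=
  ∃ T : TwoTensor (ambientModel n) (ℝ × M × ℝ), T.SmoothOn (ambientModel n) U ∧
    (∀ z ∈ U, ∀ u v, S z u v = z.2.2 ^ m * T z u v) ∧
    ∀ (t : ℝ) (x : M), 0 < t →
      ∃ σ : TangentSpace (𝓡 n) x →L[ℝ] TangentSpace (𝓡 n) x →L[ℝ] ℝ,
        (∀ u v, σ u v = σ v u) ∧
        CoordGeom.metricTrace (V := EuclideanSpace ℝ (Fin n)) (g x) σ = 0 ∧
        ∀ (a b : ℝ) (u v : TangentSpace (𝓡 n) x),
          T (t, x, 0) (ambientVec (t, x, 0) a u 0) (ambientVec (t, x, 0) b v 0) = σ u v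

/-- `(U, h)` is an ambient space for the conformal class of `g`: a pre-ambient space with
`Ric(h) = O(ρ^∞)` if `n` is odd and `Ric(h) = O⁺(ρ^{(n-2)/2})` if `n` is even. -/
structure IsAmbient (g : TwoTensor (𝓡 n) M) (p q : ℕ) (U : Set (ℝ × M × ℝ))
    (h : TwoTensor (ambientModel n) (ℝ × M × ℝ)) : Prop extends IsPreAmbient g p q U h where
  ricci_odd : Odd n → ∀ m : ℕ, IsBigORho U m (ricci (ambientModel n) h)
  ricci_even : Even n → IsBigORhoPlus g U ((n - 2) / 2) (ricci (ambientModel n) h)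

/-- The straight and normal form `2ρ dt² + 2t dt dρ + t² g_ρ` defined by a one-parameter family
`γ ρ = g_ρ` of tensors on `M`. -/
def straightNormal (γ : ℝ → TwoTensor (𝓡 n) M) :
    TwoTensor (ambientModel n) (ℝ × M × ℝ) := fun z =>
  let dt : ℝ × EuclideanSpace ℝ (Fin n) × ℝ →L[ℝ] ℝ :=
    ContinuousLinearMap.fst ℝ ℝ (EuclideanSpace ℝ (Fin n) × ℝ)
  let dx : ℝ × EuclideanSpace ℝ (Fin n) × ℝ →L[ℝ] EuclideanSpace ℝ (Fin n) :=
    (ContinuousLinearMap.fst ℝ (EuclideanSpace ℝ (Fin n)) ℝ).comp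
      (ContinuousLinearMap.snd ℝ ℝ (EuclideanSpace ℝ (Fin n) × ℝ))
  let dρ : ℝ × EuclideanSpace ℝ (Fin n) × ℝ →L[ℝ] ℝ :=
    (ContinuousLinearMap.snd ℝ (EuclideanSpace ℝ (Fin n)) ℝ).comp
      (ContinuousLinearMap.snd ℝ ℝ (EuclideanSpace ℝ (Fin n) × ℝ))
  let mul : ℝ →L[ℝ] ℝ →L[ℝ] ℝ := ContinuousLinearMap.mul ℝ ℝ
  let gρ : EuclideanSpace ℝ (Fin n) →L[ℝ] EuclideanSpace ℝ (Fin n) →L[ℝ] ℝ := γ z.2.2 z.2.1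
  ((2 * z.2.2) • mul.bilinearComp dt dt
    + z.1 • (mul.bilinearComp dt dρ + mul.bilinearComp dρ dt)
    + z.1 ^ 2 • gρ.bilinearComp dx dx :
      (ℝ × EuclideanSpace ℝ (Fin n) × ℝ) →L[ℝ] (ℝ × EuclideanSpace ℝ (Fin n) × ℝ) →L[ℝ] ℝ)

/-- The family `g_ρ = (1 + λρ)² g`. -/
def einsteinFamily (g : TwoTensor (𝓡 n) M) (lam : ℝ) : ℝ → TwoTensor (𝓡 n) M :=
  fun ρ x => (1 + lam * ρ) ^ 2 • g x

/-- The space `ℝ₊ × M × (-ε, ε)`. -/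
def ambientStrip (M : Type*) (ε : ℝ) : Set (ℝ × M × ℝ) := {z | 0 < z.1 ∧ |z.2.2| < ε}

/-- `f ∈ 𝓔̃[w]`: `f` is smooth on `U` and `t ∂_t f = w f` there. -/
structure IsAmbientDensity (U : Set (ℝ × M × ℝ)) (w : ℝ) (f : ℝ × M × ℝ → ℝ) : Prop where
  smooth : ContMDiffOn (ambientModel n) 𝓘(ℝ, ℝ) ∞ f U
  homogeneous : ∀ z ∈ U, z.1 * deriv (fun s => f (s, z.2.1, z.2.2)) z.1 = w * f z

end Ambient

/-! ### Ovsienko–Redou operators -/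

section OvsienkoRedou

/-- The set `𝓘_k` of the numbers `-(n-2k)/2 - ℓ`, `0 ≤ ℓ ≤ k - 1`. -/
def setI (n k : ℕ) : Set ℝ := {w | ∃ l : ℕ, l < k ∧ w = -((n : ℝ) - 2 * k) / 2 - l}

/-- The set `𝓞_k` of the numbers `-(n-2k)/2 + ℓ`, `0 ≤ ℓ ≤ k - 1`. -/
def setO (n k : ℕ) : Set ℝ := {w | ∃ l : ℕ, l < k ∧ w = -((n : ℝ) - 2 * k) / 2 + l}

/-- The weights for which the space of Ovsienko–Redou operators is one-dimensional. The first
alternative says that at most one of `w₁ ∈ 𝓘_k`, `w₂ ∈ 𝓘_k`, `w₁ + w₂ ∈ 𝓞_k` holds. -/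
def AdmissibleWeights (n k : ℕ) (w₁ w₂ : ℝ) : Prop :=
  (¬ (w₁ ∈ setI n k ∧ w₂ ∈ setI n k) ∧ ¬ (w₁ ∈ setI n k ∧ w₁ + w₂ ∈ setO n k) ∧
    ¬ (w₂ ∈ setI n k ∧ w₁ + w₂ ∈ setO n k)) ∨
  (w₁ ∈ setI n k ∧ w₂ ∈ setI n k ∧ w₁ + w₂ + n ≤ k ∧ w₁ + w₂ ∉ setO n k) ∨
  (w₁ ∈ setI n k ∧ w₁ + w₂ ∈ setO n k ∧ (k : ℝ) ≤ w₂ ∧ w₂ ∉ setI n k) ∨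
  (w₂ ∈ setI n k ∧ w₁ + w₂ ∈ setO n k ∧ (k : ℝ) ≤ w₁ ∧ w₁ ∉ setI n k)

/-- The analytic continuation in `z` of `Γ(z + m) / Γ(z)`, i.e. the polynomial
`z (z + 1) ⋯ (z + m - 1)`. -/
def gammaRatio (z : ℝ) (m : ℕ) : ℝ := (ascPochhammer ℝ m).eval z

/-- Away from the poles, `gammaRatio` is the ratio of Gamma functions. -/
theorem gammaRatio_eq (z : ℝ) (m : ℕ) (hz : ∀ j : ℕ, z ≠ -j) :
    gammaRatio z m = Real.Gamma (z + m) / Real.Gamma z := by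
  have h0 : Real.Gamma z ≠ 0 := Real.Gamma_ne_zero hz
  rw [eq_div_iff h0]
  induction m with
  | zero => simp [gammaRatio]
  | succ m ih =>
    have h1 : z + m ≠ 0 := fun h => hz m (by linarith)
    have h2 : z + ((m + 1 : ℕ) : ℝ) = (z + m) + 1 := by push_cast; ring
    rw [h2, Real.Gamma_add_one h1, ← ih]
    simp only [gammaRatio, ascPochhammer_succ_eval]
    ring

/-- The coefficient `a_{s,t}` (for `s, t ≤ k`)
`Γ(-w₁-w₂-(n-2k)/2+s+t) Γ(w₁+n/2-s) Γ(w₂+n/2-t) /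
  (Γ(-w₁-w₂-(n-2k)/2) Γ(w₁+(n-2k)/2) Γ(w₂+(n-2k)/2))`, the ratio being understood via analytic
continuation. -/
def orCoeff (n k : ℕ) (w₁ w₂ : ℝ) (s t : ℕ) : ℝ :=
  gammaRatio (-w₁ - w₂ - ((n : ℝ) - 2 * k) / 2) (s + t) *
    gammaRatio (w₁ + ((n : ℝ) - 2 * k) / 2) (k - s) *
    gammaRatio (w₂ + ((n : ℝ) - 2 * k) / 2) (k - t)

/-- Away from the poles, `orCoeff` is the ratio of Gamma functions by which it is described. -/
theorem orCoeff_eq (n k : ℕ) (w₁ w₂ : ℝ) (s t : ℕ) (hs : s ≤ k) (ht : t ≤ k)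
    (h₀ : ∀ j : ℕ, -w₁ - w₂ - ((n : ℝ) - 2 * k) / 2 ≠ -j)
    (h₁ : ∀ j : ℕ, w₁ + ((n : ℝ) - 2 * k) / 2 ≠ -j)
    (h₂ : ∀ j : ℕ, w₂ + ((n : ℝ) - 2 * k) / 2 ≠ -j) :
    orCoeff n k w₁ w₂ s t =
      Real.Gamma (-w₁ - w₂ - ((n : ℝ) - 2 * k) / 2 + s + t) * Real.Gamma (w₁ + (n : ℝ) / 2 - s) *
          Real.Gamma (w₂ + (n : ℝ) / 2 - t) /
        (Real.Gamma (-w₁ - w₂ - ((n : ℝ) - 2 * k) / 2) * Real.Gamma (w₁ + ((n : ℝ) - 2 * k) / 2) *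
          Real.Gamma (w₂ + ((n : ℝ) - 2 * k) / 2)) := by
  unfold orCoeff
  rw [gammaRatio_eq _ _ h₀, gammaRatio_eq _ _ h₁, gammaRatio_eq _ _ h₂]
  have e₀ : -w₁ - w₂ - ((n : ℝ) - 2 * k) / 2 + ((s + t : ℕ) : ℝ) =
      -w₁ - w₂ - ((n : ℝ) - 2 * k) / 2 + s + t := by push_cast; ring
  have e₁ : w₁ + ((n : ℝ) - 2 * k) / 2 + ((k - s : ℕ) : ℝ) = w₁ + (n : ℝ) / 2 - s := by
    push_cast [hs]; ring
  have e₂ : w₂ + ((n : ℝ) - 2 * k) / 2 + ((k - t : ℕ) : ℝ) = w₂ + (n : ℝ) / 2 - t := by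
    push_cast [ht]; ring
  rw [e₀, e₁, e₂, div_mul_div_comm, div_mul_div_comm]

/-- The trinomial coefficient `k! / ((k-s-t)! s! t!)` (for `s + t ≤ k`). -/
def trinomial (k s t : ℕ) : ℝ :=
  (k.factorial : ℝ) / ((k - s - t).factorial * s.factorial * t.factorial)

variable {n : ℕ} {M : Type*} [TopologicalSpace M] [ChartedSpace (EuclideanSpace ℝ (Fin n)) M]

/-- The ambient operator
`∑_{s=0}^k ∑_{t=0}^{k-s} k!/((k-s-t)! s! t!) a_{s,t} Δ̃^{k-s-t} ((Δ̃^s ũ) (Δ̃^t ṽ))`,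
where `Δ̃` is the Laplacian of `h`. -/
def ambientOR (h : TwoTensor (ambientModel n) (ℝ × M × ℝ)) (k : ℕ) (w₁ w₂ : ℝ)
    (U V : ℝ × M × ℝ → ℝ) (z : ℝ × M × ℝ) : ℝ :=
  ∑ s ∈ Finset.range (k + 1), ∑ t ∈ Finset.range (k - s + 1),
    trinomial k s t * orCoeff n k w₁ w₂ s t *
      (laplacian (ambientModel n) h)^[k - s - t]
        ((laplacian (ambientModel n) h)^[s] U * (laplacian (ambientModel n) h)^[t] V) z

/-- `D` is the bidifferential operator that the ambient operator of `(W, h)` determines on `M`: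
for all smooth `u`, `v` and *all* extensions `ũ ∈ 𝓔̃[w₁]`, `ṽ ∈ 𝓔̃[w₂]` of the corresponding
densities `t^{w₁} u`, `t^{w₂} v` on `𝒢`, the restriction of the ambient operator at `ũ ⊗ ṽ` to `𝒢`
is the density of weight `w₁ + w₂ - 2k` that corresponds to `D(u ⊗ v)`. -/
def IsORoperator (W : Set (ℝ × M × ℝ)) (h : TwoTensor (ambientModel n) (ℝ × M × ℝ))
    (k : ℕ) (w₁ w₂ : ℝ) (D : (M → ℝ) → (M → ℝ) → M → ℝ) : Prop :=
  ∀ u v : M → ℝ, ContMDiff (𝓡 n) 𝓘(ℝ, ℝ) ∞ u → ContMDiff (𝓡 n) 𝓘(ℝ, ℝ) ∞ v →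
    ∀ U V : ℝ × M × ℝ → ℝ, IsAmbientDensity (n := n) W w₁ U → IsAmbientDensity (n := n) W w₂ V →
      (∀ (t : ℝ) (x : M), 0 < t → U (t, x, 0) = t ^ w₁ * u x) →
      (∀ (t : ℝ) (x : M), 0 < t → V (t, x, 0) = t ^ w₂ * v x) →
      ∀ (t : ℝ) (x : M), 0 < t →
        ambientOR h k w₁ w₂ U V (t, x, 0) = t ^ (w₁ + w₂ - 2 * k) * D u v x

/-- `L_{r;w} = ∏_{j=0}^{r-1} (Δ + 2(w-2j)(n+w-2j-1)λ)`. -/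
def einsteinL (g : TwoTensor (𝓡 n) M) (lam : ℝ) : ℕ → ℝ → (M → ℝ) → M → ℝ
  | 0, _, f => f
  | r + 1, w, f => fun x => laplacian (𝓡 n) g (einsteinL g lam r w f) x +
      2 * (w - 2 * r) * (n + w - 2 * r - 1) * lam * einsteinL g lam r w f x

/-- `∑_{s=0}^k ∑_{t=0}^{k-s} k!/((k-s-t)! s! t!) a_{s,t}
  L_{k-s-t; w₁+w₂-2s-2t} (L_{s;w₁}(u) L_{t;w₂}(v))`. -/
def einsteinOR (g : TwoTensor (𝓡 n) M) (lam : ℝ) (k : ℕ) (w₁ w₂ : ℝ)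
    (u v : M → ℝ) (x : M) : ℝ :=
  ∑ s ∈ Finset.range (k + 1), ∑ t ∈ Finset.range (k - s + 1),
    trinomial k s t * orCoeff n k w₁ w₂ s t *
      einsteinL g lam (k - s - t) (w₁ + w₂ - 2 * s - 2 * t)
        (einsteinL g lam s w₁ u * einsteinL g lam t w₂ v) x

end OvsienkoRedou

end

/-! Put Q = 2ρt² and let Δ̃ be the ambient Laplacian. Three facts carry the proof: the operator
ignores the choice of extensions, it can be computed exactly on the model g_ρ = (1 + λρ)²g, and it
sees only those derivatives of g_ρ that the Einstein condition determines.

Independence of the extensions. On functions of weight w, Δ̃(QF) = QΔ̃F + (4w + 2n + 4)F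
(`laplacian_rhoMul`). By iteration, along ρ = 0 only a multiple of Δ̃^{s-1}F survives in Δ̃^s(QF).
When QF is inserted in one slot of the ambient operator, the contributions of the inner and the
outer powers of Δ̃ cancel in pairs; this is the recursion of a_{s,t} in s (`orCoeff_succ`,
`sum_trinomial_orCoeff_eq_zero`). The operator also kills, along ρ = 0, everything that vanishes to
order k + 1: each term has k Laplacians, and each of them lowers the order of vanishing by one only,
because ∂_ρ² comes with a factor ρ. By Taylor's formula in ρ, two extensions of the same density
differ by functions of these two kinds (`exists_decomposition`).

The model. For g_ρ = (1 + λρ)²g take the extension t^w (1 + λρ)^w u. Its Laplacian is of the same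
kind, with weight w - 2 and with u replaced by (Δ + 2w(n + w - 1)λ)u (`laplacian_einsteinDensity`),
and products of such functions are again of this kind. So every term of the ambient operator becomes
the corresponding term in the operators L_{r;w} (`ambientOR_einsteinDensity`). Ricci flatness of the
model follows from the general formula `ricci_ambientCoord`.

A general straight and normal ambient space. Let γ = g_ρ and τ = tr(γ⁻¹∂_ργ). If γ agrees with the
model modulo ρ^{m+1}, the tangential Ricci curvatures differ modulo ρ^{m+1} by (m + 1 - n/2) times
the difference of the ∂_ργ, minus half the difference of the τ times γ
(`vanishesOn_ricciTangential_sub`); the normal component controls ∂_ρτ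
(`vanishesOn_ricciNormal_sub`). Using the two alternately, one determines γ and τ to higher and
higher order, as long as m + 1 ≠ n/2 and the Ricci curvature vanishes to sufficient order. The
induction starts from the trace of the tangential part at ρ = 0, for which the trace condition in O⁺
is what is needed if n = 2. The outcome is that γ and τ both agree with the model to order k
(`IsAmbient.agree`).

This suffices for the operator. In Δ̃, ρ-derivatives of γ occur only through τ, so the two
Laplacians differ by O(ρ^k) without loss, and their s-th powers by O(ρ^{k+1-s}). As each term has k
Laplacians in all, the values at ρ = 0 agree (`iterate_mul_iterate_eq`). -/

noncomputable section

set_option linter.unusedSectionVars false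

/-! ### Christoffel symbols, Hessians and metric traces in coordinates. -/

namespace CoordGeom

section Basic

variable {V : Type*} [NormedAddCommGroup V] [NormedSpace ℝ V]

theorem christoffelFirst_apply (G : V → V →L[ℝ] V →L[ℝ] ℝ) (y u v w : V) :
    christoffelFirst G y u v w =
      2⁻¹ * (fderiv ℝ G y u v w + fderiv ℝ G y v u w - fderiv ℝ G y w u v) := by
  simp only [christoffelFirst, _root_.smul_apply, smul_eq_mul]
  rfl

theorem christoffel_apply (G : V → V →L[ℝ] V →L[ℝ] ℝ) (y u v : V) :
    christoffel G y u v = (G y).inverse (christoffelFirst G y u v) := rfl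

theorem hessian_apply (G : V → V →L[ℝ] V →L[ℝ] ℝ) (f : V → ℝ) (y u v : V) :
    hessian G f y u v = fderiv ℝ (fderiv ℝ f) y u v - fderiv ℝ f y (christoffel G y u v) := rfl

theorem apply_christoffel {G : V → V →L[ℝ] V →L[ℝ] ℝ} {y : V} (h : (G y).IsInvertible)
    (u v : V) : G y (christoffel G y u v) = christoffelFirst G y u v := by
  rw [christoffel_apply, h.self_apply_inverse]

/-- Nondegeneracy makes the lowered symbols decisive, so a candidate for Γ can be verified by
contracting with the metric; the inverse metric is never needed. -/
theorem christoffel_eq {G : V → V →L[ℝ] V →L[ℝ] ℝ} {y : V} (h : (G y).IsInvertible)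
    {u v X : V} (hX : ∀ w, G y X w = christoffelFirst G y u v w) : christoffel G y u v = X := by
  apply h.injective
  rw [apply_christoffel h]
  ext w
  exact (hX w).symm

theorem fderiv_apply_symm {G : V → V →L[ℝ] V →L[ℝ] ℝ} {y : V} (hd : DifferentiableAt ℝ G y)
    (hs : ∀ᶠ z in 𝓝 y, ∀ u v, G z u v = G z v u) (w u v : V) :
    fderiv ℝ G y w u v = fderiv ℝ G y w v u := by
  have key : ∀ a b : V, fderiv ℝ (fun z => G z a b) y w = fderiv ℝ G y w a b := by
    intro a b
    have := ((hd.hasFDerivAt.clm_apply (hasFDerivAt_const a y)).clm_apply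
      (hasFDerivAt_const b y)).fderiv
    rw [this]; simp
  rw [← key, ← key]
  have : (fun z => G z u v) =ᶠ[𝓝 y] fun z => G z v u := by
    filter_upwards [hs] with z hz using hz u v
  rw [this.fderiv_eq]

theorem christoffel_symm {G : V → V →L[ℝ] V →L[ℝ] ℝ} {y : V} (hd : DifferentiableAt ℝ G y)
    (hs : ∀ᶠ z in 𝓝 y, ∀ u v, G z u v = G z v u) (u v : V) :
    christoffel G y u v = christoffel G y v u := by
  rw [christoffel_apply, christoffel_apply]
  congr 1
  ext w
  rw [christoffelFirst_apply, christoffelFirst_apply, fderiv_apply_symm hd hs w u v]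
  ring

theorem fderiv_fderiv_apply_const {E F : Type*} [NormedAddCommGroup E] [NormedSpace ℝ E]
    [NormedAddCommGroup F] [NormedSpace ℝ F] {f : V → E →L[ℝ] F} {y : V}
    (hd : DifferentiableAt ℝ f y) (w : V) (u : E) :
    fderiv ℝ (fun z => f z u) y w = fderiv ℝ f y w u := by
  have := (hd.hasFDerivAt.clm_apply (hasFDerivAt_const u y)).fderiv
  rw [this]; simp

theorem metricTrace_add (B S T : V →L[ℝ] V →L[ℝ] ℝ) :
    metricTrace B (S + T) = metricTrace B S + metricTrace B T := by
  simp [metricTrace, ContinuousLinearMap.comp_add]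

theorem metricTrace_smul (B : V →L[ℝ] V →L[ℝ] ℝ) (c : ℝ) (S : V →L[ℝ] V →L[ℝ] ℝ) :
    metricTrace B (c • S) = c * metricTrace B S := by
  simp [metricTrace]

theorem inverse_smul {W : Type*} [NormedAddCommGroup W] [NormedSpace ℝ W]
    {c : ℝ} (hc : c ≠ 0) {B : V →L[ℝ] W} (hB : B.IsInvertible) :
    (c • B).inverse = c⁻¹ • B.inverse := by
  apply ContinuousLinearMap.inverse_eq
  · ext x; simp [hB.self_apply_inverse, smul_smul, hc]
  · ext x; simp [hB.inverse_apply_self, smul_smul, hc]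

theorem isInvertible_smul {W : Type*} [NormedAddCommGroup W] [NormedSpace ℝ W]
    {c : ℝ} (hc : c ≠ 0) {B : V →L[ℝ] W} (hB : B.IsInvertible) : (c • B).IsInvertible := by
  apply ContinuousLinearMap.IsInvertible.of_inverse (g := c⁻¹ • B.inverse)
  · ext x; simp [hB.self_apply_inverse, smul_smul, hc]
  · ext x; simp [hB.inverse_apply_self, smul_smul, hc]

theorem metricTrace_smul_left {c : ℝ} (hc : c ≠ 0) {B : V →L[ℝ] V →L[ℝ] ℝ}
    (hB : B.IsInvertible) (S : V →L[ℝ] V →L[ℝ] ℝ) :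
    metricTrace (c • B) S = c⁻¹ * metricTrace B S := by
  simp [metricTrace, inverse_smul hc hB]

theorem metricTrace_self [FiniteDimensional ℝ V] {B : V →L[ℝ] V →L[ℝ] ℝ}
    (hB : B.IsInvertible) : metricTrace B B = Module.finrank ℝ V := by
  rw [metricTrace, hB.inverse_comp_self]
  exact LinearMap.trace_id ℝ V

theorem isInvertible_bilinearComp {W : Type*} [NormedAddCommGroup W] [NormedSpace ℝ W]
    {B : V →L[ℝ] V →L[ℝ] ℝ} (hB : B.IsInvertible) (A : W ≃L[ℝ] V) :
    (B.bilinearComp (A : W →L[ℝ] V) (A : W →L[ℝ] V)).IsInvertible ∧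
    ∀ φ, (B.bilinearComp (A : W →L[ℝ] V) (A : W →L[ℝ] V)).inverse φ =
      A.symm (B.inverse (φ.comp (A.symm : V →L[ℝ] W))) := by
  have hl : ∀ φ, B.bilinearComp (A : W →L[ℝ] V) (A : W →L[ℝ] V)
      (A.symm (B.inverse (φ.comp (A.symm : V →L[ℝ] W)))) = φ := by
    intro φ
    ext w
    simp [hB.self_apply_inverse]
  have hr : ∀ w, A.symm (B.inverse
      ((B.bilinearComp (A : W →L[ℝ] V) (A : W →L[ℝ] V) w).comp (A.symm : V →L[ℝ] W))) = w := by
    intro w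
    have : (B.bilinearComp (A : W →L[ℝ] V) (A : W →L[ℝ] V) w).comp (A.symm : V →L[ℝ] W)
        = B (A w) := by
      ext v; simp
    rw [this, hB.inverse_apply_self]; simp
  let g : (W →L[ℝ] ℝ) →L[ℝ] W := (A.symm : V →L[ℝ] W).comp (B.inverse.comp
    (A.symm.arrowCongr (ContinuousLinearEquiv.refl ℝ ℝ)).symm.toContinuousLinearMap)
  have hg : ∀ φ, g φ = A.symm (B.inverse (φ.comp (A.symm : V →L[ℝ] W))) := by
    intro φ
    simp only [g, ContinuousLinearMap.comp_apply]
    rfl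
  have h1 : (B.bilinearComp (A : W →L[ℝ] V) (A : W →L[ℝ] V)).comp g = .id ℝ _ := by
    ext φ : 1
    simp only [ContinuousLinearMap.comp_apply, hg, hl, ContinuousLinearMap.id_apply]
  have h2 : g.comp (B.bilinearComp (A : W →L[ℝ] V) (A : W →L[ℝ] V)) = .id ℝ _ := by
    ext w : 1
    simp only [ContinuousLinearMap.comp_apply, hg, hr, ContinuousLinearMap.id_apply]
  refine ⟨.of_inverse h1 h2, fun φ => ?_⟩
  rw [ContinuousLinearMap.inverse_eq h1 h2, hg]

/-- Pulling back both forms by A conjugates the endomorphism B⁻¹S by A, and traces are invariant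
under conjugation. -/
theorem metricTrace_bilinearComp {W : Type*} [NormedAddCommGroup W] [NormedSpace ℝ W]
    {B : V →L[ℝ] V →L[ℝ] ℝ} (hB : B.IsInvertible) (S : V →L[ℝ] V →L[ℝ] ℝ) (A : W ≃L[ℝ] V) :
    metricTrace (B.bilinearComp (A : W →L[ℝ] V) (A : W →L[ℝ] V))
      (S.bilinearComp (A : W →L[ℝ] V) (A : W →L[ℝ] V)) = metricTrace B S := by
  unfold metricTrace
  rw [← LinearMap.trace_conj' ((B.inverse.comp S : V →L[ℝ] V) : V →ₗ[ℝ] V)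
    (A.symm.toLinearEquiv)]
  congr 1
  ext w
  have : (S.bilinearComp (A : W →L[ℝ] V) (A : W →L[ℝ] V) w).comp (A.symm : V →L[ℝ] W)
        = S (A w) := by
      ext v; simp
  simp [(isInvertible_bilinearComp hB A).2, this]

end Basic

/-! ### Behaviour under a change of coordinates. -/

section ChangeOfCoordinates

variable {V : Type*} [NormedAddCommGroup V] [NormedSpace ℝ V]

set_option maxSynthPendingDepth 3 in
theorem fderiv_pullback_apply {G : V → V →L[ℝ] V →L[ℝ] ℝ} {ψ : V → V} {y : V}
    (hG : DifferentiableAt ℝ G (ψ y)) (hψ : ContDiffAt ℝ 2 ψ y) (w u v : V) :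
    fderiv ℝ (fun z => (G (ψ z)).bilinearComp (fderiv ℝ ψ z) (fderiv ℝ ψ z)) y w u v =
      fderiv ℝ G (ψ y) (fderiv ℝ ψ y w) (fderiv ℝ ψ y u) (fderiv ℝ ψ y v)
      + G (ψ y) (fderiv ℝ (fderiv ℝ ψ) y w u) (fderiv ℝ ψ y v)
      + G (ψ y) (fderiv ℝ ψ y u) (fderiv ℝ (fderiv ℝ ψ) y w v) := by
  have h1 : DifferentiableAt ℝ ψ y := hψ.differentiableAt (by norm_num)
  have h2 : DifferentiableAt ℝ (fderiv ℝ ψ) y :=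
    (hψ.fderiv_right (m := 1) (by norm_num)).differentiableAt (by norm_num)
  have hGψ : HasFDerivAt (fun z => G (ψ z)) ((fderiv ℝ G (ψ y)).comp (fderiv ℝ ψ y)) y :=
    HasFDerivAt.comp (g := G) (f := ψ) y hG.hasFDerivAt h1.hasFDerivAt
  have hd : DifferentiableAt ℝ
      (fun z => (G (ψ z)).bilinearComp (fderiv ℝ ψ z) (fderiv ℝ ψ z)) y := by
    -- With two flips the pullback of a form becomes a composition of continuous linear maps, to
    -- which the product rule for compositions applies.
    have : (fun z => (G (ψ z)).bilinearComp (fderiv ℝ ψ z) (fderiv ℝ ψ z)) =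
      fun z => (ContinuousLinearMap.flipₗᵢ ℝ V V ℝ)
        (((ContinuousLinearMap.flipₗᵢ ℝ V V ℝ) ((G (ψ z)).comp (fderiv ℝ ψ z))).comp
          (fderiv ℝ ψ z)) := by
      funext z; ext u v; simp
    rw [this]
    refine (ContinuousLinearMap.flipₗᵢ ℝ V V ℝ).toContinuousLinearEquiv.differentiableAt.comp y ?_
    refine DifferentiableAt.clm_comp ?_ h2
    refine (ContinuousLinearMap.flipₗᵢ ℝ V V ℝ).toContinuousLinearEquiv.differentiableAt.comp y ?_
    exact DifferentiableAt.clm_comp hGψ.differentiableAt h2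
  rw [← fderiv_fderiv_apply_const hd w u,
    ← fderiv_fderiv_apply_const (f := fun z => (G (ψ z)).bilinearComp (fderiv ℝ ψ z) (fderiv ℝ ψ z) u)
      (hd.clm_apply (differentiableAt_const u)) w v]
  simp only [ContinuousLinearMap.bilinearComp_apply]
  have e := ((hGψ.clm_apply (h2.hasFDerivAt.clm_apply (hasFDerivAt_const u y))).clm_apply
    (h2.hasFDerivAt.clm_apply (hasFDerivAt_const v y))).fderiv
  rw [e]
  simp
  ring

/-- The classical inhomogeneous transformation law. It is checked after contraction with the metric,
where the symmetry of G and of the second derivative of ψ cancels all but one second-derivative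
term. -/
theorem christoffel_pullback {G G' : V → V →L[ℝ] V →L[ℝ] ℝ} {ψ : V → V} {y : V}
    (hG : DifferentiableAt ℝ G (ψ y)) (hs : ∀ u v, G (ψ y) u v = G (ψ y) v u)
    (hi : (G (ψ y)).IsInvertible) (hψ : ContDiffAt ℝ 2 ψ y)
    (A : V ≃L[ℝ] V) (hA : (A : V →L[ℝ] V) = fderiv ℝ ψ y)
    (hG' : G' =ᶠ[𝓝 y] fun z => (G (ψ z)).bilinearComp (fderiv ℝ ψ z) (fderiv ℝ ψ z)) (u v : V) :
    A (christoffel G' y u v) = christoffel G (ψ y) (A u) (A v) + fderiv ℝ (fderiv ℝ ψ) y u v := by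
  have hA' : ∀ w, fderiv ℝ ψ y w = A w := fun w => by rw [← hA]; rfl
  have hG'y : G' y = (G (ψ y)).bilinearComp (A : V →L[ℝ] V) (A : V →L[ℝ] V) := by
    rw [hG'.eq_of_nhds, ← hA]
  have hsym : ∀ a b, fderiv ℝ (fderiv ℝ ψ) y a b = fderiv ℝ (fderiv ℝ ψ) y b a :=
    fun a b => (hψ.isSymmSndFDerivAt (by simp)).eq a b
  have : christoffel G' y u v =
      A.symm (christoffel G (ψ y) (A u) (A v) + fderiv ℝ (fderiv ℝ ψ) y u v) := by
    apply christoffel_eq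
    · rw [hG'y]; exact (isInvertible_bilinearComp hi A).1
    · intro w
      rw [hG'y, christoffelFirst_apply, hG'.fderiv_eq]
      simp only [fderiv_pullback_apply hG hψ, hA']
      have := apply_christoffel hi (A u) (A v)
      simp [this, christoffelFirst_apply]
      rw [hs (A v) (fderiv ℝ (fderiv ℝ ψ) y u w), hs (A u) (fderiv ℝ (fderiv ℝ ψ) y v w),
        hsym w u, hsym w v, hsym v u, hs (A u) (fderiv ℝ (fderiv ℝ ψ) y v w)]
      ring
  rw [this]; simp

/-- In the Hessian the second derivative of ψ appears twice, from the chain rule for f ∘ ψ and from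
the transformation law of Γ, with opposite signs. The Hessian is therefore a tensor, and its metric
trace is invariant. -/
theorem laplacian_pullback {G G' : V → V →L[ℝ] V →L[ℝ] ℝ} {ψ : V → V} {y : V} {f f' : V → ℝ}
    (hG : DifferentiableAt ℝ G (ψ y)) (hs : ∀ u v, G (ψ y) u v = G (ψ y) v u)
    (hi : (G (ψ y)).IsInvertible) (hψ : ContDiffAt ℝ 2 ψ y)
    (A : V ≃L[ℝ] V) (hA : (A : V →L[ℝ] V) = fderiv ℝ ψ y)
    (hG' : G' =ᶠ[𝓝 y] fun z => (G (ψ z)).bilinearComp (fderiv ℝ ψ z) (fderiv ℝ ψ z))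
    (hf : ContDiffAt ℝ 2 f (ψ y)) (hf' : f' =ᶠ[𝓝 y] f ∘ ψ) :
    laplacian G' f' y = laplacian G f (ψ y) := by
  have hA' : ∀ w, fderiv ℝ ψ y w = A w := fun w => by rw [← hA]; rfl
  have hG'y : G' y = (G (ψ y)).bilinearComp (A : V →L[ℝ] V) (A : V →L[ℝ] V) := by
    rw [hG'.eq_of_nhds, ← hA]
  have h1 : DifferentiableAt ℝ ψ y := hψ.differentiableAt (by norm_num)
  have h2 : DifferentiableAt ℝ (fderiv ℝ ψ) y :=
    (hψ.fderiv_right (m := 1) (by norm_num)).differentiableAt (by norm_num)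
  have hf1 : DifferentiableAt ℝ f (ψ y) := hf.differentiableAt (by norm_num)
  have hf2 : DifferentiableAt ℝ (fderiv ℝ f) (ψ y) :=
    (hf.fderiv_right (m := 1) (by norm_num)).differentiableAt (by norm_num)
  have hDf : fderiv ℝ f' =ᶠ[𝓝 y] fun z => (fderiv ℝ f (ψ z)).comp (fderiv ℝ ψ z) := by
    have e1 : ∀ᶠ z in 𝓝 y, DifferentiableAt ℝ ψ z :=
      (hψ.of_le (m := 1) (by norm_num)).eventually (by simp) |>.mono
        fun z hz => hz.differentiableAt (by norm_num)
    have e2 : ∀ᶠ z in 𝓝 (ψ y), DifferentiableAt ℝ f z :=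
      (hf.of_le (m := 1) (by norm_num)).eventually (by simp) |>.mono
        fun z hz => hz.differentiableAt (by norm_num)
    have e3 := h1.continuousAt.eventually e2
    filter_upwards [e1, e3, hf'.eventuallyEq_nhds] with z hz1 hz2 hz3
    rw [hz3.fderiv_eq, fderiv_comp z hz2 hz1]
  have hess : hessian G' f' y =
      (hessian G f (ψ y)).bilinearComp (A : V →L[ℝ] V) (A : V →L[ℝ] V) := by
    ext u v
    rw [hessian_apply, ContinuousLinearMap.bilinearComp_apply, hessian_apply, hDf.fderiv_eq,
      hDf.eq_of_nhds]
    have e := ((hf2.hasFDerivAt.comp y h1.hasFDerivAt).clm_comp h2.hasFDerivAt).fderiv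
    have e' : fderiv ℝ (fun z => (fderiv ℝ f (ψ z)).comp (fderiv ℝ ψ z)) y = _ := e
    rw [e']
    have hc := christoffel_pullback hG hs hi hψ A hA hG' u v
    simp only [ContinuousLinearMap.comp_apply, hA', hc]
    simp [hA']
    ring
  rw [laplacian, laplacian, hess, hG'y, metricTrace_bilinearComp hi]

end ChangeOfCoordinates

end CoordGeom

/-! ### Traces in finite dimension, and smoothness of the geometric quantities. -/

namespace CoordGeom

section FiniteDim

variable {V : Type*} [NormedAddCommGroup V] [NormedSpace ℝ V] [FiniteDimensional ℝ V]

/-- A nondegenerate bilinear form on a finite dimensional space is invertible. -/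
theorem isInvertible_of_injective {B : V →L[ℝ] V →L[ℝ] ℝ}
    (h : ∀ v, (∀ w, B v w = 0) → v = 0) : B.IsInvertible := by
  have hinj : Function.Injective (B : V →ₗ[ℝ] V →L[ℝ] ℝ) := by
    rw [← LinearMap.ker_eq_bot, LinearMap.ker_eq_bot']
    intro v hv
    refine h v fun w => ?_
    have : B v = 0 := hv
    rw [this]; rfl
  have hfr : Module.finrank ℝ V = Module.finrank ℝ (V →L[ℝ] ℝ) := by
    rw [(LinearMap.toContinuousLinearMap (𝕜 := ℝ) (E := V) (F' := ℝ)).symm.finrank_eq]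
    exact (Subspace.dual_finrank_eq (K := ℝ) (V := V)).symm
  have : FiniteDimensional ℝ (V →L[ℝ] ℝ) :=
    (LinearMap.toContinuousLinearMap (𝕜 := ℝ) (E := V) (F' := ℝ)).finiteDimensional
  exact ⟨(LinearEquiv.ofInjectiveOfFinrankEq (B : V →ₗ[ℝ] V →L[ℝ] ℝ) hinj
    hfr).toContinuousLinearEquiv, by ext; rfl⟩

/-- The trace as a continuous linear functional. -/
def traceL (V : Type*) [NormedAddCommGroup V] [NormedSpace ℝ V] [FiniteDimensional ℝ V] :
    (V →L[ℝ] V) →L[ℝ] ℝ :=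
  LinearMap.toContinuousLinearMap
    ((LinearMap.trace ℝ V).comp (ContinuousLinearMap.coeLM ℝ))

theorem traceL_apply (A : V →L[ℝ] V) : traceL V A = LinearMap.trace ℝ V (A : V →ₗ[ℝ] V) := rfl

theorem traceL_smulRight (φ : V →L[ℝ] ℝ) (v : V) : traceL V (φ.smulRight v) = φ v := by
  rw [traceL_apply]
  exact LinearMap.trace_smulRight (φ : V →ₗ[ℝ] ℝ) v

theorem traceL_id : traceL V (ContinuousLinearMap.id ℝ V) = Module.finrank ℝ V :=
  LinearMap.trace_id ℝ V

theorem traceL_comp_comm (A B : V →L[ℝ] V) : traceL V (A.comp B) = traceL V (B.comp A) :=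
  LinearMap.trace_comp_comm' (B : V →ₗ[ℝ] V) (A : V →ₗ[ℝ] V)

theorem metricTrace_eq (B S : V →L[ℝ] V →L[ℝ] ℝ) :
    metricTrace B S = traceL V (B.inverse.comp S) := rfl

theorem ricci_eq (G : V → V →L[ℝ] V →L[ℝ] ℝ) (y u v : V) :
    ricci G y u v = traceL V (curvature G y u v) := rfl

/-- The trace is the sum of the traces of the diagonal blocks. The middle block is passed as a
separate map `AE`, so that it can be supplied in a form whose trace is computable. -/
theorem traceL_prod {E : Type*} [NormedAddCommGroup E] [NormedSpace ℝ E] [FiniteDimensional ℝ E]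
    (A : (ℝ × E × ℝ) →L[ℝ] (ℝ × E × ℝ)) (AE : E →L[ℝ] E)
    (hE : ∀ e, AE e = (A (0, e, 0)).2.1) :
    traceL (ℝ × E × ℝ) A = (A (1, 0, 0)).1 + traceL E AE + (A (0, 0, 1)).2.2 := by
  let i0 : ℝ →L[ℝ] ℝ × E × ℝ := .inl ℝ ℝ (E × ℝ)
  let iE : E →L[ℝ] ℝ × E × ℝ := (ContinuousLinearMap.inr ℝ ℝ (E × ℝ)).comp (.inl ℝ E ℝ)
  let i1 : ℝ →L[ℝ] ℝ × E × ℝ := (ContinuousLinearMap.inr ℝ ℝ (E × ℝ)).comp (.inr ℝ E ℝ)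
  let p0 : ℝ × E × ℝ →L[ℝ] ℝ := .fst ℝ ℝ (E × ℝ)
  let pE : ℝ × E × ℝ →L[ℝ] E := (ContinuousLinearMap.fst ℝ E ℝ).comp (.snd ℝ ℝ (E × ℝ))
  let p1 : ℝ × E × ℝ →L[ℝ] ℝ := (ContinuousLinearMap.snd ℝ E ℝ).comp (.snd ℝ ℝ (E × ℝ))
  have hdec : A = (A.comp i0).comp p0 + (A.comp iE).comp pE + (A.comp i1).comp p1 := by
    refine ContinuousLinearMap.ext fun x => ?_
    have : x = i0 x.1 + iE x.2.1 + i1 x.2.2 := by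
      simp [i0, iE, i1]
    conv_lhs => rw [this]
    simp [p0, pE, p1]
  have h0 : traceL (ℝ × E × ℝ) ((A.comp i0).comp p0) = (A (1, 0, 0)).1 := by
    have : (A.comp i0).comp p0 = p0.smulRight (A (1, 0, 0)) := by
      refine ContinuousLinearMap.ext fun x => ?_
      have : (i0 (p0 x)) = p0 x • ((1, 0, 0) : ℝ × E × ℝ) := by simp [i0, p0]; rfl
      simp only [ContinuousLinearMap.comp_apply, ContinuousLinearMap.smulRight_apply]
      rw [this, map_smul]
    rw [this, traceL_smulRight]; rfl
  have h1 : traceL (ℝ × E × ℝ) ((A.comp i1).comp p1) = (A (0, 0, 1)).2.2 := by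
    have : (A.comp i1).comp p1 = p1.smulRight (A (0, 0, 1)) := by
      refine ContinuousLinearMap.ext fun x => ?_
      have : (i1 (p1 x)) = p1 x • ((0, 0, 1) : ℝ × E × ℝ) := by simp [i1, p1]
      simp only [ContinuousLinearMap.comp_apply, ContinuousLinearMap.smulRight_apply]
      rw [this, map_smul]
    rw [this, traceL_smulRight]; rfl
  have h2 : traceL (ℝ × E × ℝ) ((A.comp iE).comp pE) = traceL E AE := by
    have e := LinearMap.trace_comp_comm' (R := ℝ) ((A.comp iE : E →L[ℝ] _) : E →ₗ[ℝ] _)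
      (pE : ℝ × E × ℝ →ₗ[ℝ] E)
    rw [traceL_apply, ContinuousLinearMap.toLinearMap_comp, ← e, traceL_apply]
    congr 1
    ext x
    simp [hE, pE, iE]
  conv_lhs => rw [hdec]
  rw [map_add, map_add, h0, h1, h2]

end FiniteDim

section Smooth

variable {V : Type*} [NormedAddCommGroup V] [NormedSpace ℝ V]

set_option maxSynthPendingDepth 3 in
/-- The Christoffel symbols of the first kind as a linear function of the derivative of the
metric. -/
def christoffelFirstL (V : Type*) [NormedAddCommGroup V] [NormedSpace ℝ V] :
    (V →L[ℝ] V →L[ℝ] V →L[ℝ] ℝ) →L[ℝ] (V →L[ℝ] V →L[ℝ] V →L[ℝ] ℝ) :=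
  (2⁻¹ : ℝ) • (ContinuousLinearMap.id ℝ _
    + ((ContinuousLinearMap.flipₗᵢ ℝ V V (V →L[ℝ] ℝ)).toContinuousLinearEquiv : _ →L[ℝ] _)
    - (ContinuousLinearMap.compL ℝ V (V →L[ℝ] V →L[ℝ] ℝ) (V →L[ℝ] V →L[ℝ] ℝ)
        ((ContinuousLinearMap.flipₗᵢ ℝ V V ℝ).toContinuousLinearEquiv : _ →L[ℝ] _)).comp
      ((ContinuousLinearMap.flipₗᵢ ℝ V V (V →L[ℝ] ℝ)).toContinuousLinearEquiv : _ →L[ℝ] _))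

theorem christoffel_eq_comp (G : V → V →L[ℝ] V →L[ℝ] ℝ) (y : V) :
    christoffel G y = (ContinuousLinearMap.compL ℝ V (V →L[ℝ] ℝ) V (G y).inverse).comp
      (christoffelFirstL V (fderiv ℝ G y)) := rfl

variable {W : Type*} [NormedAddCommGroup W] [NormedSpace ℝ W]

theorem contDiffOn_inverse [CompleteSpace V] {g : W → V →L[ℝ] V →L[ℝ] ℝ} {Ω : Set W}
    (hg : ContDiffOn ℝ ∞ g Ω) (hi : ∀ p ∈ Ω, (g p).IsInvertible) :
    ContDiffOn ℝ ∞ (fun p => (g p).inverse) Ω := fun p hp =>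
  (hi p hp).contDiffAt_map_inverse.comp_contDiffWithinAt p (hg p hp)

theorem contDiffOn_fderiv {F : Type*} [NormedAddCommGroup F] [NormedSpace ℝ F] {f : W → F}
    {Ω : Set W} (hΩ : IsOpen Ω) (hf : ContDiffOn ℝ ∞ f Ω) : ContDiffOn ℝ ∞ (fderiv ℝ f) Ω :=
  hf.fderiv_of_isOpen hΩ (by simp)

set_option maxSynthPendingDepth 3 in
-- The metric and its derivative are independent arguments depending on a parameter in W. This makes
-- the lemma applicable to the Christoffel symbols of the slices as functions of (y, ρ) jointly,
-- where only the y-part of the derivative enters.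
theorem contDiffOn_christoffelAux [CompleteSpace V] {g : W → V →L[ℝ] V →L[ℝ] ℝ}
    {D : W → V →L[ℝ] V →L[ℝ] V →L[ℝ] ℝ} {Ω : Set W}
    (hg : ContDiffOn ℝ ∞ g Ω) (hi : ∀ p ∈ Ω, (g p).IsInvertible) (hD : ContDiffOn ℝ ∞ D Ω) :
    ContDiffOn ℝ ∞ (fun p => (ContinuousLinearMap.compL ℝ V (V →L[ℝ] ℝ) V (g p).inverse).comp
      (christoffelFirstL V (D p))) Ω := by
  refine ContDiffOn.clm_comp ?_ ?_
  · exact (ContinuousLinearMap.compL ℝ V (V →L[ℝ] ℝ) V).contDiff.comp_contDiffOn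
      (contDiffOn_inverse hg hi)
  · exact (christoffelFirstL V).contDiff.comp_contDiffOn hD

theorem contDiffOn_christoffel [CompleteSpace V] {G : V → V →L[ℝ] V →L[ℝ] ℝ} {Ω : Set V}
    (hΩ : IsOpen Ω) (hG : ContDiffOn ℝ ∞ G Ω) (hi : ∀ p ∈ Ω, (G p).IsInvertible) :
    ContDiffOn ℝ ∞ (christoffel G) Ω :=
  contDiffOn_christoffelAux hG hi (contDiffOn_fderiv hΩ hG)

set_option maxSynthPendingDepth 3 in
theorem contDiffOn_hessian [CompleteSpace V] {G : V → V →L[ℝ] V →L[ℝ] ℝ} {f : V → ℝ} {Ω : Set V}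
    (hΩ : IsOpen Ω) (hG : ContDiffOn ℝ ∞ G Ω) (hi : ∀ p ∈ Ω, (G p).IsInvertible)
    (hf : ContDiffOn ℝ ∞ f Ω) : ContDiffOn ℝ ∞ (hessian G f) Ω := by
  refine (contDiffOn_fderiv hΩ (contDiffOn_fderiv hΩ hf)).sub ?_
  exact ContDiffOn.clm_comp ((ContinuousLinearMap.compL ℝ V V ℝ).contDiff.comp_contDiffOn
    (contDiffOn_fderiv hΩ hf)) (contDiffOn_christoffel hΩ hG hi)

theorem contDiffOn_laplacian [FiniteDimensional ℝ V] {G : V → V →L[ℝ] V →L[ℝ] ℝ} {f : V → ℝ}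
    {Ω : Set V} (hΩ : IsOpen Ω) (hG : ContDiffOn ℝ ∞ G Ω) (hi : ∀ p ∈ Ω, (G p).IsInvertible)
    (hf : ContDiffOn ℝ ∞ f Ω) : ContDiffOn ℝ ∞ (laplacian G f) Ω := by
  have : CompleteSpace V := FiniteDimensional.complete ℝ V
  exact (traceL V).contDiff.comp_contDiffOn
    ((contDiffOn_inverse hG hi).clm_comp (contDiffOn_hessian hΩ hG hi hf))

end Smooth

end CoordGeom

/-! ### The metric 2ρ dt² + 2t dt dρ + t²γ in coordinates. -/

namespace CoordGeom

variable {E : Type*} [NormedAddCommGroup E] [NormedSpace ℝ E]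

/-- The coefficients of the metric `2ρ dt² + 2t dt dρ + t² γ(y, ρ)` at `z = (t, y, ρ)`. -/
def ambientCoord (γ : E × ℝ → E →L[ℝ] E →L[ℝ] ℝ) (z : ℝ × E × ℝ) :
    (ℝ × E × ℝ) →L[ℝ] (ℝ × E × ℝ) →L[ℝ] ℝ :=
  let dt : ℝ × E × ℝ →L[ℝ] ℝ := ContinuousLinearMap.fst ℝ ℝ (E × ℝ)
  let dx : ℝ × E × ℝ →L[ℝ] E :=
    (ContinuousLinearMap.fst ℝ E ℝ).comp (ContinuousLinearMap.snd ℝ ℝ (E × ℝ))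
  let dρ : ℝ × E × ℝ →L[ℝ] ℝ :=
    (ContinuousLinearMap.snd ℝ E ℝ).comp (ContinuousLinearMap.snd ℝ ℝ (E × ℝ))
  let mul : ℝ →L[ℝ] ℝ →L[ℝ] ℝ := ContinuousLinearMap.mul ℝ ℝ
  (2 * z.2.2) • mul.bilinearComp dt dt
    + z.1 • (mul.bilinearComp dt dρ + mul.bilinearComp dρ dt)
    + z.1 ^ 2 • (γ z.2).bilinearComp dx dx

theorem ambientCoord_apply (γ : E × ℝ → E →L[ℝ] E →L[ℝ] ℝ) (z u v : ℝ × E × ℝ) :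
    ambientCoord γ z u v = 2 * z.2.2 * (u.1 * v.1) + z.1 * (u.1 * v.2.2 + u.2.2 * v.1)
      + z.1 ^ 2 * γ z.2 u.2.1 v.2.1 := by
  simp [ambientCoord]
  ring

/-- The derivative `∂_ρ` of a function of `(y, ρ)`. -/
def dRho {F : Type*} [NormedAddCommGroup F] [NormedSpace ℝ F] (f : E × ℝ → F) (p : E × ℝ) : F :=
  fderiv ℝ f p (0, 1)

/-- The endomorphism `γ⁻¹ ∂_ρ γ`. -/
def shape (γ : E × ℝ → E →L[ℝ] E →L[ℝ] ℝ) (p : E × ℝ) : E →L[ℝ] E :=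
  (γ p).inverse.comp (dRho γ p)

/-- The Christoffel symbols of the metrics `γ(·, ρ)`. -/
def sliceChristoffel (γ : E × ℝ → E →L[ℝ] E →L[ℝ] ℝ) (p : E × ℝ) : E →L[ℝ] E →L[ℝ] E :=
  christoffel (fun y => γ (y, p.2)) p.1

/-- `γ(·, ρ)` is a smooth family of nondegenerate symmetric forms on `Ω`. -/
structure IsMetricFamily (γ : E × ℝ → E →L[ℝ] E →L[ℝ] ℝ) (Ω : Set (E × ℝ)) : Prop where
  isOpen : IsOpen Ω
  smooth : ContDiffOn ℝ ∞ γ Ω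
  symm : ∀ p ∈ Ω, ∀ u v, γ p u v = γ p v u
  inv : ∀ p ∈ Ω, (γ p).IsInvertible

theorem contDiffOn_dRho {F : Type*} [NormedAddCommGroup F] [NormedSpace ℝ F] {f : E × ℝ → F}
    {Ω : Set (E × ℝ)} (hΩ : IsOpen Ω) (hf : ContDiffOn ℝ ∞ f Ω) : ContDiffOn ℝ ∞ (dRho f) Ω :=
  (contDiffOn_fderiv hΩ hf).clm_apply contDiffOn_const

theorem fderiv_slice {F : Type*} [NormedAddCommGroup F] [NormedSpace ℝ F] {f : E × ℝ → F}
    {p : E × ℝ} (hf : DifferentiableAt ℝ f p) :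
    fderiv ℝ (fun y => f (y, p.2)) p.1 = (fderiv ℝ f p).comp (.inl ℝ E ℝ) := by
  have h : HasFDerivAt (fun y : E => (y, p.2)) (ContinuousLinearMap.inl ℝ E ℝ) p.1 :=
    (hasFDerivAt_id p.1).prodMk (hasFDerivAt_const p.2 p.1)
  exact (HasFDerivAt.comp (g := f) (f := fun y : E => (y, p.2)) p.1 hf.hasFDerivAt h).fderiv

theorem isOpen_slice {Ω : Set (E × ℝ)} (hΩ : IsOpen Ω) (r : ℝ) :
    IsOpen {y | (y, r) ∈ Ω} := hΩ.preimage (by fun_prop)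

namespace IsMetricFamily

variable {γ : E × ℝ → E →L[ℝ] E →L[ℝ] ℝ} {Ω : Set (E × ℝ)} (h : IsMetricFamily γ Ω)
include h

theorem contDiffAt {p : E × ℝ} (hp : p ∈ Ω) : ContDiffAt ℝ ∞ γ p :=
  h.smooth.contDiffAt (h.isOpen.mem_nhds hp)

theorem differentiableAt {p : E × ℝ} (hp : p ∈ Ω) : DifferentiableAt ℝ γ p :=
  (h.contDiffAt hp).differentiableAt (by simp)

theorem slice_eventually {p : E × ℝ} (hp : p ∈ Ω) : ∀ᶠ y in 𝓝 p.1, (y, p.2) ∈ Ω :=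
  (isOpen_slice h.isOpen p.2).mem_nhds hp

theorem slice_contDiffOn (r : ℝ) : ContDiffOn ℝ ∞ (fun y => γ (y, r)) {y | (y, r) ∈ Ω} :=
  h.smooth.comp (by fun_prop) (fun _ hy => hy)

theorem slice_differentiableAt {p : E × ℝ} (hp : p ∈ Ω) :
    DifferentiableAt ℝ (fun y => γ (y, p.2)) p.1 :=
  ((h.slice_contDiffOn p.2).contDiffAt ((isOpen_slice h.isOpen _).mem_nhds hp)).differentiableAt
    (by simp)

theorem sliceChristoffel_symm {p : E × ℝ} (hp : p ∈ Ω) (u v : E) :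
    sliceChristoffel γ p u v = sliceChristoffel γ p v u :=
  christoffel_symm (h.slice_differentiableAt hp)
    ((h.slice_eventually hp).mono fun _ hy u v => h.symm _ hy u v) u v

theorem apply_shape {p : E × ℝ} (hp : p ∈ Ω) (u : E) : γ p (shape γ p u) = dRho γ p u :=
  (h.inv p hp).self_apply_inverse _

theorem eventually_mem {p : E × ℝ} (hp : p ∈ Ω) : ∀ᶠ q in 𝓝 p, q ∈ Ω := h.isOpen.mem_nhds hp

theorem fderiv_symm {p : E × ℝ} (hp : p ∈ Ω) (w : E × ℝ) (u v : E) :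
    fderiv ℝ γ p w u v = fderiv ℝ γ p w v u := by
  have key : ∀ a b : E, fderiv ℝ (fun z => γ z a b) p w = fderiv ℝ γ p w a b := by
    intro a b
    have := (((h.differentiableAt hp).hasFDerivAt.clm_apply (hasFDerivAt_const a p)).clm_apply
      (hasFDerivAt_const b p)).fderiv
    rw [this]; simp
  rw [← key, ← key]
  have : (fun z => γ z u v) =ᶠ[𝓝 p] fun z => γ z v u := by
    filter_upwards [h.eventually_mem hp] with z hz using h.symm z hz u v
  rw [this.fderiv_eq]

theorem dRho_symm {p : E × ℝ} (hp : p ∈ Ω) (u v : E) : dRho γ p u v = dRho γ p v u :=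
  h.fderiv_symm hp _ u v

theorem apply_shape_right {p : E × ℝ} (hp : p ∈ Ω) (u v : E) :
    γ p u (shape γ p v) = dRho γ p u v := by
  rw [h.symm p hp, h.apply_shape hp, h.dRho_symm hp]

theorem contDiffOn_shape [FiniteDimensional ℝ E] : ContDiffOn ℝ ∞ (shape γ) Ω := by
  have : CompleteSpace E := FiniteDimensional.complete ℝ E
  exact (contDiffOn_inverse h.smooth h.inv).clm_comp (contDiffOn_dRho h.isOpen h.smooth)

theorem contDiffOn_sliceChristoffel [FiniteDimensional ℝ E] :
    ContDiffOn ℝ ∞ (sliceChristoffel γ) Ω := by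
  have : CompleteSpace E := FiniteDimensional.complete ℝ E
  refine (contDiffOn_christoffelAux h.smooth h.inv
    (D := fun p => (fderiv ℝ γ p).comp (.inl ℝ E ℝ))
    ((contDiffOn_fderiv h.isOpen h.smooth).clm_comp contDiffOn_const)).congr fun p hp => ?_
  rw [sliceChristoffel, christoffel_eq_comp, fderiv_slice (f := γ) (h.differentiableAt hp)]

theorem apply_sliceChristoffel {p : E × ℝ} (hp : p ∈ Ω) (u v w : E) :
    γ p (sliceChristoffel γ p u v) w = 2⁻¹ * (fderiv ℝ γ p (u, 0) v w + fderiv ℝ γ p (v, 0) u w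
      - fderiv ℝ γ p (w, 0) u v) := by
  have := apply_christoffel (G := fun y => γ (y, p.2)) (y := p.1) (h.inv p hp) u v
  have h2 := congrArg (fun φ => φ w) this
  refine h2.trans ?_
  rw [christoffelFirst_apply, fderiv_slice (f := γ) (h.differentiableAt hp)]
  simp

end IsMetricFamily

/-- The set of the `(t, y, ρ)` with `t > 0` and `(y, ρ) ∈ Ω`. -/
def ambientDomain (Ω : Set (E × ℝ)) : Set (ℝ × E × ℝ) := {z | 0 < z.1 ∧ z.2 ∈ Ω}

theorem isOpen_ambientDomain {Ω : Set (E × ℝ)} (hΩ : IsOpen Ω) : IsOpen (ambientDomain Ω) :=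
  (isOpen_lt continuous_const continuous_fst).inter (hΩ.preimage continuous_snd)

set_option maxSynthPendingDepth 3 in
theorem contDiff_bilinearComp {W : Type*} [NormedAddCommGroup W] [NormedSpace ℝ W]
    (A : W →L[ℝ] E) :
    ContDiff ℝ ∞ fun B : E →L[ℝ] E →L[ℝ] ℝ => B.bilinearComp A A := by
  have : (fun B : E →L[ℝ] E →L[ℝ] ℝ => B.bilinearComp A A) =
      fun B => (ContinuousLinearMap.flipₗᵢ ℝ W W ℝ)
        (((ContinuousLinearMap.flipₗᵢ ℝ W E ℝ) (B.comp A)).comp A) := by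
    funext z; ext u v; simp
  rw [this]
  refine (ContinuousLinearMap.flipₗᵢ ℝ W W ℝ).toContinuousLinearEquiv.contDiff.comp ?_
  refine ContDiff.clm_comp ?_ contDiff_const
  refine (ContinuousLinearMap.flipₗᵢ ℝ W E ℝ).toContinuousLinearEquiv.contDiff.comp ?_
  exact contDiff_id.clm_comp contDiff_const

set_option maxSynthPendingDepth 3 in
theorem contDiffOn_ambientCoord {γ : E × ℝ → E →L[ℝ] E →L[ℝ] ℝ} {Ω : Set (E × ℝ)}
    (h : ContDiffOn ℝ ∞ γ Ω) : ContDiffOn ℝ ∞ (ambientCoord γ) {z | z.2 ∈ Ω} := by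
  unfold ambientCoord
  refine ContDiffOn.add (ContDiffOn.add ?_ ?_) ?_
  · exact (by fun_prop : ContDiffOn ℝ ∞ (fun z : ℝ × E × ℝ => 2 * z.2.2) _).smul contDiffOn_const
  · exact (by fun_prop : ContDiffOn ℝ ∞ (fun z : ℝ × E × ℝ => z.1) _).smul contDiffOn_const
  · refine (by fun_prop : ContDiffOn ℝ ∞ (fun z : ℝ × E × ℝ => z.1 ^ 2) _).smul ?_
    exact (contDiff_bilinearComp _).comp_contDiffOn (h.comp contDiffOn_snd fun z hz => hz)

/-- The (t, ρ) block with rows (2ρ, t) and (t, 0) has inverse with rows (0, 1/t) and (1/t, -2ρ/t²);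
the E block is inverted by t⁻²γ⁻¹. -/
theorem ambientCoord_solve {γ : E × ℝ → E →L[ℝ] E →L[ℝ] ℝ} {z : ℝ × E × ℝ} (ht : z.1 ≠ 0)
    (hi : (γ z.2).IsInvertible) (φ : (ℝ × E × ℝ) →L[ℝ] ℝ) :
    ambientCoord γ z (φ (0, 0, 1) / z.1,
      (z.1 ^ 2)⁻¹ • (γ z.2).inverse
        (φ.comp ((ContinuousLinearMap.inr ℝ ℝ (E × ℝ)).comp (.inl ℝ E ℝ))),
      (φ (1, 0, 0) - 2 * z.2.2 * φ (0, 0, 1) / z.1) / z.1) = φ := by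
  refine ContinuousLinearMap.ext fun w => ?_
  obtain ⟨a, u, b⟩ := w
  have hφ : φ (a, u, b) = a * φ (1, 0, 0) + φ (0, u, 0) + b * φ (0, 0, 1) := by
    rw [← smul_eq_mul, ← smul_eq_mul, ← map_smul, ← map_smul, ← map_add, ← map_add]
    simp
  rw [hφ, ambientCoord_apply]
  simp [hi.self_apply_inverse]
  field_simp
  ring

variable [FiniteDimensional ℝ E]

theorem isInvertible_ambientCoord {γ : E × ℝ → E →L[ℝ] E →L[ℝ] ℝ} {z : ℝ × E × ℝ} (ht : z.1 ≠ 0)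
    (hi : (γ z.2).IsInvertible) : (ambientCoord γ z).IsInvertible := by
  apply isInvertible_of_injective
  rintro ⟨a, u, b⟩ hv
  have ha : a = 0 := by
    have := hv (0, 0, 1)
    rw [ambientCoord_apply] at this
    simpa [ht] using this
  have hb : b = 0 := by
    have := hv (1, 0, 0)
    rw [ambientCoord_apply] at this
    simpa [ht, ha] using this
  have hu : u = 0 := by
    apply hi.injective
    ext w
    have := hv (0, w, 0)
    rw [ambientCoord_apply] at this
    simpa [ht] using this
  simp [ha, hb, hu]

theorem ambientCoord_inverse {γ : E × ℝ → E →L[ℝ] E →L[ℝ] ℝ} {z : ℝ × E × ℝ} (ht : z.1 ≠ 0)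
    (hi : (γ z.2).IsInvertible) (φ : (ℝ × E × ℝ) →L[ℝ] ℝ) :
    (ambientCoord γ z).inverse φ = (φ (0, 0, 1) / z.1,
      (z.1 ^ 2)⁻¹ • (γ z.2).inverse
        (φ.comp ((ContinuousLinearMap.inr ℝ ℝ (E × ℝ)).comp (.inl ℝ E ℝ))),
      (φ (1, 0, 0) - 2 * z.2.2 * φ (0, 0, 1) / z.1) / z.1) := by
  rw [(isInvertible_ambientCoord ht hi).inverse_apply_eq]
  exact (ambientCoord_solve ht hi φ).symm

theorem metricTrace_ambientCoord {γ : E × ℝ → E →L[ℝ] E →L[ℝ] ℝ} {z : ℝ × E × ℝ} (ht : z.1 ≠ 0)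
    (hi : (γ z.2).IsInvertible) (S : (ℝ × E × ℝ) →L[ℝ] (ℝ × E × ℝ) →L[ℝ] ℝ)
    (SE : E →L[ℝ] E →L[ℝ] ℝ) (hSE : ∀ u v, SE u v = S (0, u, 0) (0, v, 0)) :
    metricTrace (ambientCoord γ z) S = (S (1, 0, 0) (0, 0, 1) + S (0, 0, 1) (1, 0, 0)) / z.1
      - 2 * z.2.2 / z.1 ^ 2 * S (0, 0, 1) (0, 0, 1) + (z.1 ^ 2)⁻¹ * metricTrace (γ z.2) SE := by
  rw [metricTrace_eq, traceL_prod _ ((z.1 ^ 2)⁻¹ • (γ z.2).inverse.comp SE)]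
  · simp only [ContinuousLinearMap.comp_apply, ambientCoord_inverse ht hi, map_smul,
      metricTrace_eq, smul_eq_mul]
    field_simp
    ring
  · intro e
    simp only [ContinuousLinearMap.comp_apply, ambientCoord_inverse ht hi, _root_.smul_apply]
    congr 2
    ext w
    simp [hSE]


variable {γ : E × ℝ → E →L[ℝ] E →L[ℝ] ℝ} {Ω : Set (E × ℝ)}

theorem fderiv_ambientCoord_apply (h : IsMetricFamily γ Ω) {z : ℝ × E × ℝ} (hz : z.2 ∈ Ω)
    (w u v : ℝ × E × ℝ) :
    fderiv ℝ (ambientCoord γ) z w u v = 2 * w.2.2 * (u.1 * v.1)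
      + w.1 * (u.1 * v.2.2 + u.2.2 * v.1) + 2 * z.1 * w.1 * γ z.2 u.2.1 v.2.1
      + z.1 ^ 2 * fderiv ℝ γ z.2 w.2 u.2.1 v.2.1 := by
  have hd : DifferentiableAt ℝ (ambientCoord γ) z :=
    ((contDiffOn_ambientCoord h.smooth).contDiffAt
      ((h.isOpen.preimage continuous_snd).mem_nhds hz)).differentiableAt (by simp)
  rw [← fderiv_fderiv_apply_const hd w u,
    ← fderiv_fderiv_apply_const (f := fun z => ambientCoord γ z u)
      (hd.clm_apply (differentiableAt_const u)) w v]
  simp only [ambientCoord_apply]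
  have h1 : HasFDerivAt (fun z : ℝ × E × ℝ => z.1) (ContinuousLinearMap.fst ℝ ℝ (E × ℝ)) z :=
    hasFDerivAt_fst
  have h2 : HasFDerivAt (fun z : ℝ × E × ℝ => z.2) (ContinuousLinearMap.snd ℝ ℝ (E × ℝ)) z :=
    hasFDerivAt_snd
  have h3 : HasFDerivAt (fun z : ℝ × E × ℝ => z.2.2)
      ((ContinuousLinearMap.snd ℝ E ℝ).comp (ContinuousLinearMap.snd ℝ ℝ (E × ℝ))) z :=
    h2.snd
  have h4 := HasFDerivAt.comp (g := γ) (f := fun z : ℝ × E × ℝ => z.2) z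
    (h.differentiableAt hz).hasFDerivAt h2
  have h5 := (h4.clm_apply (hasFDerivAt_const u.2.1 z)).clm_apply (hasFDerivAt_const v.2.1 z)
  have := (((h3.const_mul 2).mul_const (u.1 * v.1)).add
    (h1.mul_const (u.1 * v.2.2 + u.2.2 * v.1))).add ((h1.pow 2).mul h5)
  have e := congrArg (fun L => L w) this.fderiv
  refine e.trans ?_
  simp
  ring

/-- The Christoffel symbols of `2ρ dt² + 2t dt dρ + t² γ`. -/
def ambientChristoffel (γ : E × ℝ → E →L[ℝ] E →L[ℝ] ℝ) (z u v : ℝ × E × ℝ) : ℝ × E × ℝ :=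
  (-(2⁻¹ * z.1 * dRho γ z.2 u.2.1 v.2.1),
    z.1⁻¹ • (u.1 • v.2.1 + v.1 • u.2.1) + sliceChristoffel γ z.2 u.2.1 v.2.1
      + (2⁻¹ : ℝ) • (u.2.2 • shape γ z.2 v.2.1 + v.2.2 • shape γ z.2 u.2.1),
    z.1⁻¹ * (u.1 * v.2.2 + v.1 * u.2.2) - γ z.2 u.2.1 v.2.1
      + z.2.2 * dRho γ z.2 u.2.1 v.2.1)

/-- Both sides are lowered with the metric, and the derivative of γ is split into its y-part and its
ρ-part: the former gives the symbols of the slice, the latter the terms in `shape` and `dRho`. -/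
theorem christoffel_ambientCoord (h : IsMetricFamily γ Ω) {z : ℝ × E × ℝ} (ht : z.1 ≠ 0)
    (hz : z.2 ∈ Ω) (u v : ℝ × E × ℝ) :
    christoffel (ambientCoord γ) z u v = ambientChristoffel γ z u v := by
  apply christoffel_eq (isInvertible_ambientCoord ht (h.inv _ hz))
  intro w
  rw [christoffelFirst_apply]
  simp only [fderiv_ambientCoord_apply h hz, ambientCoord_apply, ambientChristoffel]
  have e : ∀ x : E × ℝ, fderiv ℝ γ z.2 x = fderiv ℝ γ z.2 (x.1, 0) + x.2 • dRho γ z.2 := by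
    intro x
    rw [dRho, ← map_smul, ← map_add]
    simp
  rw [e u.2, e v.2, e w.2]
  simp [h.apply_sliceChristoffel hz, h.apply_shape hz]
  field_simp
  ring


end CoordGeom

/-! ### The ambient Laplacian on homogeneous functions. -/

namespace CoordGeom

variable {E : Type*} [NormedAddCommGroup E] [NormedSpace ℝ E] [FiniteDimensional ℝ E]
  {γ : E × ℝ → E →L[ℝ] E →L[ℝ] ℝ} {Ω : Set (E × ℝ)}

theorem metricTrace_dRho (p : E × ℝ) : metricTrace (γ p) (dRho γ p) = traceL E (shape γ p) := rfl

theorem fderiv_homogeneous {f : E × ℝ → ℝ} {z : ℝ × E × ℝ} (w : ℝ) (ht : 0 < z.1)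
    (hf : DifferentiableAt ℝ f z.2) (x : ℝ × E × ℝ) :
    fderiv ℝ (fun z : ℝ × E × ℝ => z.1 ^ w * f z.2) z x =
      z.1 ^ (w - 1) * (w * x.1 * f z.2) + z.1 ^ w * fderiv ℝ f z.2 x.2 := by
  have h1 : HasFDerivAt (fun z : ℝ × E × ℝ => z.1) (ContinuousLinearMap.fst ℝ ℝ (E × ℝ)) z :=
    hasFDerivAt_fst
  have h2 := h1.rpow_const (p := w) (Or.inl ht.ne')
  have h3 := HasFDerivAt.comp (g := f) (f := fun z : ℝ × E × ℝ => z.2) z hf.hasFDerivAt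
    hasFDerivAt_snd
  have := (h2.mul h3).fderiv
  refine (congrArg (fun L => L x) this).trans ?_
  simp
  ring

theorem eventually_mem_ambientDomain (hΩ : IsOpen Ω) {z : ℝ × E × ℝ} (ht : 0 < z.1)
    (hz : z.2 ∈ Ω) : ∀ᶠ x in 𝓝 z, x ∈ ambientDomain Ω :=
  (isOpen_ambientDomain hΩ).mem_nhds ⟨ht, hz⟩

theorem differentiableAt_of_contDiffOn {F W : Type*} [NormedAddCommGroup F] [NormedSpace ℝ F]
    [NormedAddCommGroup W] [NormedSpace ℝ W] {f : W → F} {U : Set W} (hU : IsOpen U)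
    (hf : ContDiffOn ℝ ∞ f U) {p : W} (hp : p ∈ U) : DifferentiableAt ℝ f p :=
  (hf.contDiffAt (hU.mem_nhds hp)).differentiableAt (by simp)

theorem fderiv_fderiv_homogeneous {f : E × ℝ → ℝ} (hΩ : IsOpen Ω) (hf : ContDiffOn ℝ ∞ f Ω)
    {z : ℝ × E × ℝ} (w : ℝ) (ht : 0 < z.1) (hz : z.2 ∈ Ω) (x x' : ℝ × E × ℝ) :
    fderiv ℝ (fderiv ℝ (fun z : ℝ × E × ℝ => z.1 ^ w * f z.2)) z x x' =
      z.1 ^ (w - 2) * ((w - 1) * w * x.1 * x'.1 * f z.2)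
      + z.1 ^ (w - 1) * (w * x'.1 * fderiv ℝ f z.2 x.2)
      + z.1 ^ (w - 1) * (w * x.1 * fderiv ℝ f z.2 x'.2)
      + z.1 ^ w * fderiv ℝ (fderiv ℝ f) z.2 x.2 x'.2 := by
  have hsm : ContDiffOn ℝ ∞ (fun z : ℝ × E × ℝ => z.1 ^ w * f z.2) (ambientDomain Ω) := by
    refine ContDiffOn.mul ?_ (hf.comp contDiffOn_snd fun z hz => hz.2)
    exact contDiffOn_fst.rpow_const_of_ne fun z hz => hz.1.ne'
  have hd := differentiableAt_of_contDiffOn (isOpen_ambientDomain hΩ)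
    (contDiffOn_fderiv (isOpen_ambientDomain hΩ) hsm) ⟨ht, hz⟩
  rw [← fderiv_fderiv_apply_const hd]
  have hev : (fun z' => fderiv ℝ (fun z : ℝ × E × ℝ => z.1 ^ w * f z.2) z' x') =ᶠ[𝓝 z]
      fun z => z.1 ^ (w - 1) * ((w * x'.1) * f z.2) + z.1 ^ w * fderiv ℝ f z.2 x'.2 := by
    filter_upwards [eventually_mem_ambientDomain hΩ ht hz] with z' hz'
    rw [fderiv_homogeneous w hz'.1 (differentiableAt_of_contDiffOn hΩ hf hz'.2)]
  have hf1 := differentiableAt_of_contDiffOn hΩ hf hz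
  have hf2 := differentiableAt_of_contDiffOn hΩ (contDiffOn_fderiv hΩ hf) hz
  have a1 : DifferentiableAt ℝ (fun z : ℝ × E × ℝ => z.1 ^ (w - 1) * ((w * x'.1) * f z.2)) z := by
    have := hf1.comp z (differentiableAt_snd (𝕜 := ℝ) (E := ℝ) (F := E × ℝ))
    exact (differentiableAt_fst.rpow_const (Or.inl ht.ne')).mul (this.const_mul _)
  have hf3 : DifferentiableAt ℝ (fun p => fderiv ℝ f p x'.2) z.2 :=
    hf2.clm_apply (differentiableAt_const _)
  have a2 : DifferentiableAt ℝ (fun z : ℝ × E × ℝ => z.1 ^ w * fderiv ℝ f z.2 x'.2) z := by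
    have := hf3.comp z (differentiableAt_snd (𝕜 := ℝ) (E := ℝ) (F := E × ℝ))
    exact (differentiableAt_fst.rpow_const (Or.inl ht.ne')).mul this
  rw [hev.fderiv_eq, fderiv_fun_add a1 a2, _root_.add_apply,
    fderiv_homogeneous (f := fun p => (w * x'.1) * f p) (w - 1) ht (hf1.const_mul _),
    fderiv_homogeneous (f := fun p => fderiv ℝ f p x'.2) w ht hf3,
    fderiv_fderiv_apply_const hf2, fderiv_const_mul hf1]
  simp
  rw [show w - 1 - 1 = w - 2 by ring]
  ring

theorem hessian_slice {f : E × ℝ → ℝ} (hΩ : IsOpen Ω) (hf : ContDiffOn ℝ ∞ f Ω) {p : E × ℝ}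
    (hp : p ∈ Ω) (u v : E) :
    hessian (fun y => γ (y, p.2)) (fun y => f (y, p.2)) p.1 u v =
      fderiv ℝ (fderiv ℝ f) p (u, 0) (v, 0) - fderiv ℝ f p (sliceChristoffel γ p u v, 0) := by
  rw [hessian_apply, fderiv_slice (differentiableAt_of_contDiffOn hΩ hf hp)]
  have hev : fderiv ℝ (fun y => f (y, p.2)) =ᶠ[𝓝 p.1]
      fun y => (fderiv ℝ f (y, p.2)).comp (.inl ℝ E ℝ) := by
    filter_upwards [(isOpen_slice hΩ p.2).mem_nhds hp] with y hy
    exact fderiv_slice (p := (y, p.2)) (differentiableAt_of_contDiffOn hΩ hf hy)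
  have hd : DifferentiableAt ℝ (fun q => (fderiv ℝ f q).comp (.inl ℝ E ℝ)) p :=
    (differentiableAt_of_contDiffOn hΩ (contDiffOn_fderiv hΩ hf) hp).clm_comp
      (differentiableAt_const _)
  rw [hev.fderiv_eq, fderiv_slice (f := fun q => (fderiv ℝ f q).comp (.inl ℝ E ℝ)) hd]
  have := fderiv_fderiv_apply_const hd (u, 0) v
  simp only [ContinuousLinearMap.comp_apply, ContinuousLinearMap.inl_apply] at this ⊢
  rw [← this, fderiv_fderiv_apply_const
    (differentiableAt_of_contDiffOn hΩ (contDiffOn_fderiv hΩ hf) hp)]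
  rfl

/-- The operator `f ↦ t^{2-w} Δ̃(t^w f)` of the metric `2ρ dt² + 2t dt dρ + t² γ`. -/
def weightedLaplacian (γ : E × ℝ → E →L[ℝ] E →L[ℝ] ℝ) (w : ℝ) (f : E × ℝ → ℝ) (p : E × ℝ) : ℝ :=
  -2 * p.2 * dRho (dRho f) p
    + (2 * w + Module.finrank ℝ E - 2 - p.2 * traceL E (shape γ p)) * dRho f p
    + laplacian (fun y => γ (y, p.2)) (fun y => f (y, p.2)) p.1
    + w / 2 * traceL E (shape γ p) * f p

theorem laplacian_ambientCoord (h : IsMetricFamily γ Ω) {f : E × ℝ → ℝ} (hf : ContDiffOn ℝ ∞ f Ω)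
    {F : ℝ × E × ℝ → ℝ} {z : ℝ × E × ℝ} (w : ℝ) (ht : 0 < z.1) (hz : z.2 ∈ Ω)
    (hF : F =ᶠ[𝓝 z] fun z => z.1 ^ w * f z.2) :
    laplacian (ambientCoord γ) F z = z.1 ^ (w - 2) * weightedLaplacian γ w f z.2 := by
  have hess : ∀ x x', hessian (ambientCoord γ) F z x x' =
      fderiv ℝ (fderiv ℝ (fun z : ℝ × E × ℝ => z.1 ^ w * f z.2)) z x x'
        - fderiv ℝ (fun z : ℝ × E × ℝ => z.1 ^ w * f z.2) z (ambientChristoffel γ z x x') := by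
    intro x x'
    rw [hessian_apply, christoffel_ambientCoord h ht.ne' hz, hF.fderiv_eq, hF.fderiv.fderiv_eq]
  have hf1 := differentiableAt_of_contDiffOn h.isOpen hf hz
  have e1 : z.1 ^ w = z.1 ^ (w - 2) * z.1 ^ 2 := by
    rw [← Real.rpow_natCast, ← Real.rpow_add ht]; norm_num
  have e2 : z.1 ^ (w - 1) = z.1 ^ (w - 2) * z.1 := by
    conv_rhs => rw [← Real.rpow_one (z.1), ← Real.rpow_mul ht.le, one_mul]
    rw [← Real.rpow_add ht]; congr 1; ring
  have hρ : fderiv ℝ (fderiv ℝ f) z.2 (0, 1) (0, 1) = dRho (dRho f) z.2 :=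
    (fderiv_fderiv_apply_const
      (differentiableAt_of_contDiffOn h.isOpen (contDiffOn_fderiv h.isOpen hf) hz) _ _).symm
  have hdec : ∀ x : E × ℝ, fderiv ℝ f z.2 x = fderiv ℝ f z.2 (x.1, 0) + x.2 * dRho f z.2 := by
    intro x
    rw [dRho, ← smul_eq_mul, ← map_smul, ← map_add]
    simp
  have h00 : fderiv ℝ f z.2 (0, 0) = 0 := (fderiv ℝ f z.2).map_zero
  have hr : fderiv ℝ f z.2 (0, 1) = dRho f z.2 := rfl
  -- The form supplied is the E block of the Hessian of t^w f: the Hessian of f on the slice, plus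
  -- what the ∂_t and ∂_ρ components of the Christoffel symbols of two vectors of E contribute.
  rw [laplacian, metricTrace_ambientCoord ht.ne' (h.inv _ hz) _
    (z.1 ^ w • hessian (fun y => γ (y, z.2.2)) (fun y => f (y, z.2.2)) z.2.1
      + (z.1 ^ w * (2⁻¹ * w * f z.2 - z.2.2 * dRho f z.2)) • dRho γ z.2
      + (z.1 ^ w * dRho f z.2) • γ z.2)]
  · rw [metricTrace_add, metricTrace_add, metricTrace_smul, metricTrace_smul, metricTrace_smul,
      metricTrace_self (h.inv _ hz), metricTrace_dRho]
    have hl : metricTrace (γ z.2) (hessian (fun y => γ (y, z.2.2)) (fun y => f (y, z.2.2)) z.2.1)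
      = laplacian (fun y => γ (y, z.2.2)) (fun y => f (y, z.2.2)) z.2.1 := rfl
    rw [hl]
    simp only [hess, fderiv_fderiv_homogeneous h.isOpen hf w ht hz, fderiv_homogeneous w ht hf1,
      ambientChristoffel]
    have h0 : ((0 : E), (0 : ℝ)) = 0 := rfl
    simp only [map_zero, zero_apply, smul_zero, mul_zero, mul_one, zero_mul,
      zero_add, add_zero, neg_zero, sub_zero, hr, h0, hρ, e1, e2]
    rw [hdec]
    simp only [h00, weightedLaplacian]
    field_simp
    ring
  · intro u v
    rw [hess, fderiv_fderiv_homogeneous h.isOpen hf w ht hz, fderiv_homogeneous w ht hf1]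
    simp only [_root_.add_apply, _root_.smul_apply, hessian_slice h.isOpen hf hz,
      ambientChristoffel, smul_eq_mul]
    simp [e1, e2]
    rw [hdec (_, _ + _)]
    ring

end CoordGeom

/-! ### The Ricci curvature of the ambient metric. -/

namespace CoordGeom

variable {E : Type*} [NormedAddCommGroup E] [NormedSpace ℝ E] [FiniteDimensional ℝ E]
  {γ : E × ℝ → E →L[ℝ] E →L[ℝ] ℝ} {Ω : Set (E × ℝ)}

/-- The derivative of `z ↦ ambientChristoffel γ z u v` in the direction `w`. -/
def ambientChristoffelDeriv (γ : E × ℝ → E →L[ℝ] E →L[ℝ] ℝ) (z u v w : ℝ × E × ℝ) : ℝ × E × ℝ :=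
  (-(2⁻¹ * (w.1 * dRho γ z.2 u.2.1 v.2.1 + z.1 * fderiv ℝ (dRho γ) z.2 w.2 u.2.1 v.2.1)),
    -((z.1 ^ 2)⁻¹ * w.1) • (u.1 • v.2.1 + v.1 • u.2.1)
      + fderiv ℝ (sliceChristoffel γ) z.2 w.2 u.2.1 v.2.1
      + (2⁻¹ : ℝ) • (u.2.2 • fderiv ℝ (shape γ) z.2 w.2 v.2.1
        + v.2.2 • fderiv ℝ (shape γ) z.2 w.2 u.2.1),
    -((z.1 ^ 2)⁻¹ * w.1) * (u.1 * v.2.2 + v.1 * u.2.2) - fderiv ℝ γ z.2 w.2 u.2.1 v.2.1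
      + (w.2.2 * dRho γ z.2 u.2.1 v.2.1
        + z.2.2 * fderiv ℝ (dRho γ) z.2 w.2 u.2.1 v.2.1))

theorem fderiv_ambientChristoffel_apply (h : IsMetricFamily γ Ω) {z : ℝ × E × ℝ} (ht : z.1 ≠ 0)
    (hz : z.2 ∈ Ω) (u v w : ℝ × E × ℝ) :
    fderiv ℝ (fun z => ambientChristoffel γ z u v) z w = ambientChristoffelDeriv γ z u v w := by
  have h1 : HasFDerivAt (fun z : ℝ × E × ℝ => z.1) (ContinuousLinearMap.fst ℝ ℝ (E × ℝ)) z :=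
    hasFDerivAt_fst
  have h2 : HasFDerivAt (fun z : ℝ × E × ℝ => z.2) (ContinuousLinearMap.snd ℝ ℝ (E × ℝ)) z :=
    hasFDerivAt_snd
  have h3 : HasFDerivAt (fun z : ℝ × E × ℝ => z.2.2)
      ((ContinuousLinearMap.snd ℝ E ℝ).comp (ContinuousLinearMap.snd ℝ ℝ (E × ℝ))) z :=
    h2.snd
  have hinv : HasFDerivAt (fun z : ℝ × E × ℝ => z.1⁻¹)
      (-(z.1 ^ 2)⁻¹ • ContinuousLinearMap.fst ℝ ℝ (E × ℝ)) z :=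
    (hasDerivAt_inv ht).comp_hasFDerivAt z h1
  have dγ := HasFDerivAt.comp (g := γ) (f := fun z : ℝ × E × ℝ => z.2) z
    (h.differentiableAt hz).hasFDerivAt h2
  have dγ' := HasFDerivAt.comp (g := dRho γ) (f := fun z : ℝ × E × ℝ => z.2) z
    (differentiableAt_of_contDiffOn h.isOpen (contDiffOn_dRho h.isOpen h.smooth) hz).hasFDerivAt h2
  have dΓ := HasFDerivAt.comp (g := sliceChristoffel γ) (f := fun z : ℝ × E × ℝ => z.2) z
    (differentiableAt_of_contDiffOn h.isOpen h.contDiffOn_sliceChristoffel hz).hasFDerivAt h2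
  have dS := HasFDerivAt.comp (g := shape γ) (f := fun z : ℝ × E × ℝ => z.2) z
    (differentiableAt_of_contDiffOn h.isOpen h.contDiffOn_shape hz).hasFDerivAt h2
  have bγ := (dγ.clm_apply (hasFDerivAt_const u.2.1 z)).clm_apply (hasFDerivAt_const v.2.1 z)
  have bγ' := (dγ'.clm_apply (hasFDerivAt_const u.2.1 z)).clm_apply (hasFDerivAt_const v.2.1 z)
  have bΓ := (dΓ.clm_apply (hasFDerivAt_const u.2.1 z)).clm_apply (hasFDerivAt_const v.2.1 z)
  have bSu := dS.clm_apply (hasFDerivAt_const u.2.1 z)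
  have bSv := dS.clm_apply (hasFDerivAt_const v.2.1 z)
  have c0 := (((h1.const_mul (2⁻¹ : ℝ)).mul bγ').neg)
  have cE := ((hinv.smul_const (u.1 • v.2.1 + v.1 • u.2.1)).add bΓ).add
    (((bSv.const_smul u.2.2).add (bSu.const_smul v.2.2)).const_smul (2⁻¹ : ℝ))
  have c1 := ((hinv.mul_const (u.1 * v.2.2 + v.1 * u.2.2)).sub bγ).add (h3.mul bγ')
  refine (congrArg (fun L => L w) (c0.prodMk (cE.prodMk c1)).fderiv).trans ?_
  ext
  · simp [ambientChristoffelDeriv]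
    ring
  · simp [ambientChristoffelDeriv]
  · simp [ambientChristoffelDeriv]
    ring

/-- The explicit Christoffel symbols are valid on a neighbourhood of z, so their explicit derivative
may be used in the definition of the curvature. -/
theorem curvature_ambientCoord_apply (h : IsMetricFamily γ Ω) {z : ℝ × E × ℝ} (ht : 0 < z.1)
    (hz : z.2 ∈ Ω) (u v w : ℝ × E × ℝ) :
    curvature (ambientCoord γ) z u v w =
      ambientChristoffelDeriv γ z u v w - ambientChristoffelDeriv γ z w v u
        + ambientChristoffel γ z w (ambientChristoffel γ z u v)
        - ambientChristoffel γ z u (ambientChristoffel γ z w v) := by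
  have hG := isOpen_ambientDomain h.isOpen
  have hzD : z ∈ ambientDomain Ω := ⟨ht, hz⟩
  have hdΓ : DifferentiableAt ℝ (christoffel (ambientCoord γ)) z :=
    differentiableAt_of_contDiffOn hG (contDiffOn_christoffel hG
      ((contDiffOn_ambientCoord h.smooth).mono fun x hx => hx.2)
      fun x hx => isInvertible_ambientCoord hx.1.ne' (h.inv _ hx.2)) hzD
  have hD : ∀ a b c, fderiv ℝ (christoffel (ambientCoord γ)) z c a b =
      ambientChristoffelDeriv γ z a b c := by
    intro a b c
    rw [← fderiv_fderiv_apply_const hdΓ, ← fderiv_fderiv_apply_const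
      (f := fun z => christoffel (ambientCoord γ) z a) (hdΓ.clm_apply (differentiableAt_const _)),
      ← fderiv_ambientChristoffel_apply h ht.ne' hz]
    have : (fun z => christoffel (ambientCoord γ) z a b) =ᶠ[𝓝 z]
        fun z => ambientChristoffel γ z a b := by
      filter_upwards [hG.mem_nhds hzD] with x hx
      exact christoffel_ambientCoord h hx.1.ne' hx.2 a b
    rw [this.fderiv_eq]
  rw [← hD, ← hD]
  simp only [← christoffel_ambientCoord h ht.ne' hz]
  rfl

/-- Geometrically, the Euler field t∂_t satisfies ∇(t∂_t) = id, so curvature in its direction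
vanishes. Only the diagonal entry is needed for the Ricci trace. -/
theorem curvature_ambientCoord_fst (h : IsMetricFamily γ Ω) {z : ℝ × E × ℝ} (ht : 0 < z.1)
    (hz : z.2 ∈ Ω) (u v : ℝ × E × ℝ) :
    (curvature (ambientCoord γ) z u v (1, 0, 0)).1 = 0 := by
  have h0 : ((0 : E), (0 : ℝ)) = 0 := rfl
  rw [curvature_ambientCoord_apply h ht hz]
  simp [ambientChristoffelDeriv, ambientChristoffel, h0]
  field_simp
  ring

theorem curvature_ambientCoord_snd_snd (h : IsMetricFamily γ Ω) {z : ℝ × E × ℝ} (ht : 0 < z.1)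
    (hz : z.2 ∈ Ω) (u v : ℝ × E × ℝ) :
    (curvature (ambientCoord γ) z u v (0, 0, 1)).2.2 =
      z.2.2 * dRho (dRho γ) z.2 u.2.1 v.2.1
        - 2⁻¹ * z.2.2 * dRho γ z.2 u.2.1 (shape γ z.2 v.2.1) := by
  have e3 : γ z.2 u.2.1 (shape γ z.2 v.2.1) = dRho γ z.2 u.2.1 v.2.1 :=
    h.apply_shape_right hz _ _
  have e5 : fderiv ℝ (dRho γ) z.2 (0, 1) = dRho (dRho γ) z.2 := rfl
  have e6 : fderiv ℝ γ z.2 (0, 1) = dRho γ z.2 := rfl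
  rw [curvature_ambientCoord_apply h ht hz]
  simp [ambientChristoffelDeriv, ambientChristoffel, e3, e5, e6]
  field_simp
  ring

/-- The linear map `w ↦ B(w, v)`. -/
def evalSnd {W F : Type*} [NormedAddCommGroup F] [NormedSpace ℝ F] [NormedAddCommGroup W]
    [NormedSpace ℝ W] (B : E →L[ℝ] W →L[ℝ] F) (v : W) : E →L[ℝ] F :=
  B.flip v

section EvalSnd

variable {W F : Type*} [NormedAddCommGroup F] [NormedSpace ℝ F] [NormedAddCommGroup W]
    [NormedSpace ℝ W] (B C : E →L[ℝ] W →L[ℝ] F)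

theorem evalSnd_apply (v : W) (w : E) : evalSnd B v w = B w v := rfl

theorem evalSnd_add (v w : W) : evalSnd B (v + w) = evalSnd B v + evalSnd B w :=
  map_add B.flip v w

theorem evalSnd_smul (c : ℝ) (v : W) : evalSnd B (c • v) = c • evalSnd B v :=
  map_smul B.flip c v

theorem evalSnd_add_left (v : W) : evalSnd (B + C) v = evalSnd B v + evalSnd C v := rfl

theorem evalSnd_smul_left (c : ℝ) (v : W) : evalSnd (c • B) v = c • evalSnd B v := rfl

end EvalSnd

/-- The block `E → E` of the curvature endomorphism of `2ρ dt² + 2t dt dρ + t² γ`. -/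
def ambientCurvatureBlock (γ : E × ℝ → E →L[ℝ] E →L[ℝ] ℝ) (z u v : ℝ × E × ℝ) : E →L[ℝ] E :=
  let X := ambientChristoffel γ z u v
  -- Y0, Y and Y1 are the components along ∂_t, E and ∂_ρ of the map sending e in E to Γ(e, v).
  let Y0 : E →L[ℝ] ℝ := -((2⁻¹ * z.1) • evalSnd (dRho γ z.2) v.2.1)
  let Y : E →L[ℝ] E := (z.1⁻¹ * v.1) • ContinuousLinearMap.id ℝ E
    + evalSnd (sliceChristoffel γ z.2) v.2.1 + (2⁻¹ * v.2.2) • (shape γ z.2)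
  let Y1 : E →L[ℝ] ℝ := -evalSnd (γ z.2) v.2.1 + z.2.2 • evalSnd (dRho γ z.2) v.2.1
  evalSnd (evalSnd ((fderiv ℝ (sliceChristoffel γ) z.2).comp (.inl ℝ E ℝ)) u.2.1) v.2.1
    + (2⁻¹ : ℝ) • (u.2.2 • evalSnd ((fderiv ℝ (shape γ) z.2).comp (.inl ℝ E ℝ)) v.2.1
      + v.2.2 • evalSnd ((fderiv ℝ (shape γ) z.2).comp (.inl ℝ E ℝ)) u.2.1)
    - (-((z.1 ^ 2)⁻¹ * u.1 * v.1) • ContinuousLinearMap.id ℝ E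
      + evalSnd (fderiv ℝ (sliceChristoffel γ) z.2 u.2) v.2.1
      + (2⁻¹ * v.2.2) • fderiv ℝ (shape γ) z.2 u.2)
    + ((z.1⁻¹ * X.1) • ContinuousLinearMap.id ℝ E + evalSnd (sliceChristoffel γ z.2) X.2.1
      + (2⁻¹ * X.2.2) • shape γ z.2)
    - ((z.1⁻¹ * u.1) • Y + z.1⁻¹ • Y0.smulRight u.2.1 + (sliceChristoffel γ z.2 u.2.1).comp Y
      + (2⁻¹ * u.2.2) • (shape γ z.2).comp Y + (2⁻¹ : ℝ) • Y1.smulRight (shape γ z.2 u.2.1))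

theorem ambientCurvatureBlock_apply (h : IsMetricFamily γ Ω) {z : ℝ × E × ℝ} (ht : 0 < z.1)
    (hz : z.2 ∈ Ω) (u v : ℝ × E × ℝ) (e : E) :
    ambientCurvatureBlock γ z u v e = (curvature (ambientCoord γ) z u v (0, e, 0)).2.1 := by
  rw [curvature_ambientCoord_apply h ht hz]
  simp [ambientCurvatureBlock, evalSnd_apply, ambientChristoffelDeriv, ambientChristoffel]
  module

/-- Each trace separately is expressed through the jointly smooth map `sliceChristoffel`; these are
the traces that reappear in the E block of the ambient curvature. -/
theorem ricci_slice (h : IsMetricFamily γ Ω) {p : E × ℝ} (hp : p ∈ Ω) (u v : E) :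
    ricci (fun y => γ (y, p.2)) p.1 u v =
      traceL E (evalSnd (evalSnd ((fderiv ℝ (sliceChristoffel γ) p).comp (.inl ℝ E ℝ)) u) v)
        - traceL E (evalSnd (fderiv ℝ (sliceChristoffel γ) p (u, 0)) v)
        + traceL E (evalSnd (sliceChristoffel γ p) (sliceChristoffel γ p u v))
        - traceL E ((sliceChristoffel γ p u).comp (evalSnd (sliceChristoffel γ p) v)) := by
  have hfd : fderiv ℝ (christoffel (fun y => γ (y, p.2))) p.1 =
      (fderiv ℝ (sliceChristoffel γ) p).comp (.inl ℝ E ℝ) :=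
    fderiv_slice (f := sliceChristoffel γ)
      (differentiableAt_of_contDiffOn h.isOpen h.contDiffOn_sliceChristoffel hp)
  rw [ricci_eq, curvature, hfd, map_sub, map_add, map_sub]
  rfl

theorem fderiv_eq_add_dRho {X : Type*} [NormedAddCommGroup X] [NormedSpace ℝ X] (f : E × ℝ → X)
    (p x : E × ℝ) : fderiv ℝ f p x = fderiv ℝ f p (x.1, 0) + x.2 • dRho f p := by
  rw [dRho, ← map_smul, ← map_add]
  simp

/-- The Ricci curvature of `2ρ dt² + 2t dt dρ + t² γ`. -/
theorem ricci_ambientCoord (h : IsMetricFamily γ Ω) {z : ℝ × E × ℝ} (ht : 0 < z.1)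
    (hz : z.2 ∈ Ω) (u v : ℝ × E × ℝ) :
    ricci (ambientCoord γ) z u v =
      (ricci (fun y => γ (y, z.2.2)) z.2.1 u.2.1 v.2.1
        + z.2.2 * dRho (dRho γ) z.2 u.2.1 v.2.1
        - z.2.2 * dRho γ z.2 u.2.1 (shape γ z.2 v.2.1)
        + 2⁻¹ * traceL E (shape γ z.2)
          * (z.2.2 * dRho γ z.2 u.2.1 v.2.1 - γ z.2 u.2.1 v.2.1)
        + (1 - Module.finrank ℝ E / 2) * dRho γ z.2 u.2.1 v.2.1)
      + u.2.2 * (2⁻¹ * traceL E (evalSnd ((fderiv ℝ (shape γ) z.2).comp (.inl ℝ E ℝ)) v.2.1)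
        + 2⁻¹ * traceL E (evalSnd (sliceChristoffel γ z.2) (shape γ z.2 v.2.1))
        - traceL E (evalSnd (dRho (sliceChristoffel γ) z.2) v.2.1)
        - 2⁻¹ * traceL E ((shape γ z.2).comp (evalSnd (sliceChristoffel γ z.2) v.2.1)))
      + v.2.2 * (2⁻¹ * traceL E (evalSnd ((fderiv ℝ (shape γ) z.2).comp (.inl ℝ E ℝ)) u.2.1)
        + 2⁻¹ * traceL E (evalSnd (sliceChristoffel γ z.2) (shape γ z.2 u.2.1))
        - 2⁻¹ * traceL E (fderiv ℝ (shape γ) z.2 (u.2.1, 0))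
        - 2⁻¹ * traceL E ((sliceChristoffel γ z.2 u.2.1).comp (shape γ z.2)))
      + u.2.2 * v.2.2 * (-(2⁻¹ * traceL E (dRho (shape γ) z.2))
        - 4⁻¹ * traceL E ((shape γ z.2).comp (shape γ z.2))) := by
  -- The identities that follow make the two orders of composition and the two slots of each form
  -- coincide, so that the slice terms assemble into the Ricci curvature of the slice.
  have hflip : evalSnd (sliceChristoffel γ z.2) u.2.1 = sliceChristoffel γ z.2 u.2.1 :=
    ContinuousLinearMap.ext fun e => h.sliceChristoffel_symm hz e u.2.1
  have e1 : traceL E ((shape γ z.2).comp (evalSnd (sliceChristoffel γ z.2) v.2.1)) =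
      traceL E ((evalSnd (sliceChristoffel γ z.2) v.2.1).comp (shape γ z.2)) :=
    traceL_comp_comm _ _
  have e2 : dRho γ z.2 (shape γ z.2 u.2.1) v.2.1 = dRho γ z.2 u.2.1 (shape γ z.2 v.2.1) := by
    rw [← h.apply_shape_right hz (shape γ z.2 u.2.1) v.2.1, h.apply_shape hz]
  have e4 : γ z.2 (shape γ z.2 u.2.1) v.2.1 = dRho γ z.2 u.2.1 v.2.1 := by
    rw [h.apply_shape hz]
  rw [ricci_eq, traceL_prod _ _ (ambientCurvatureBlock_apply h ht hz u v),
    curvature_ambientCoord_fst h ht hz, curvature_ambientCoord_snd_snd h ht hz,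
    ricci_slice h hz, ambientCurvatureBlock,
    fderiv_eq_add_dRho (sliceChristoffel γ) z.2 u.2, fderiv_eq_add_dRho (shape γ) z.2 u.2]
  simp only [ambientChristoffel, map_add, map_sub, map_smul, traceL_smulRight,
    traceL_id, ContinuousLinearMap.comp_add, ContinuousLinearMap.comp_smul,
    ContinuousLinearMap.comp_id, evalSnd_add_left, evalSnd_smul_left, evalSnd_add, evalSnd_smul,
    hflip, e1, smul_eq_mul, _root_.add_apply, _root_.smul_apply, _root_.neg_apply,
    evalSnd_apply, e2, e4]
  field_simp
  ring

end CoordGeom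

/-! ### Order of vanishing at ρ = 0 for functions of one variable. -/

section VanishingOrder

variable {F G H : Type*} [NormedAddCommGroup F] [NormedSpace ℝ F] [NormedAddCommGroup G]
  [NormedSpace ℝ G] [NormedAddCommGroup H] [NormedSpace ℝ H]

/-- `f` is smooth at `0` and its derivatives of order less than `m` vanish there. -/
def VanishesTo {F : Type*} [NormedAddCommGroup F] [NormedSpace ℝ F] : ℕ → (ℝ → F) → Prop
  | 0, f => ContDiffAt ℝ ∞ f 0
  | m + 1, f => ContDiffAt ℝ ∞ f 0 ∧ f 0 = 0 ∧ VanishesTo m (deriv f)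

theorem contDiffAt_deriv {f : ℝ → F} {x : ℝ} (hf : ContDiffAt ℝ ∞ f x) :
    ContDiffAt ℝ ∞ (deriv f) x := by
  have := (hf.fderiv_right (m := ∞) (by simp)).clm_apply (contDiffAt_const (c := (1 : ℝ)))
  exact this

theorem eventually_differentiableAt {f : ℝ → F} {x : ℝ} (hf : ContDiffAt ℝ ∞ f x) :
    ∀ᶠ y in 𝓝 x, DifferentiableAt ℝ f y :=
  ((hf.of_le (m := 1) (by simp)).eventually (by simp)).mono
    fun _ h => h.differentiableAt (by simp)

namespace VanishesTo

variable {m : ℕ} {f g : ℝ → F}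

theorem contDiffAt (h : VanishesTo m f) : ContDiffAt ℝ ∞ f 0 := by
  cases m with
  | zero => exact h
  | succ m => exact h.1

theorem deriv (h : VanishesTo (m + 1) f) : VanishesTo m (deriv f) := h.2.2

theorem of_succ (h : VanishesTo (m + 1) f) : VanishesTo m f := by
  induction m generalizing f with
  | zero => exact h.1
  | succ m ih => exact ⟨h.1, h.2.1, ih h.2.2⟩

theorem mono {k : ℕ} (hk : k ≤ m) (h : VanishesTo m f) : VanishesTo k f := by
  induction m with
  | zero => rwa [Nat.le_zero.mp hk]
  | succ m ih =>
    rcases Nat.lt_or_ge k (m + 1) with h1 | h1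
    · exact ih (Nat.lt_succ_iff.mp h1) h.of_succ
    · rwa [le_antisymm hk h1]

theorem congr (h : VanishesTo m f) (hfg : f =ᶠ[𝓝 0] g) : VanishesTo m g := by
  induction m generalizing f g with
  | zero => exact ContDiffAt.congr_of_eventuallyEq h hfg.symm
  | succ m ih =>
    exact ⟨h.1.congr_of_eventuallyEq hfg.symm, hfg.eq_of_nhds ▸ h.2.1, ih h.2.2 hfg.deriv⟩

theorem add (hf : VanishesTo m f) (hg : VanishesTo m g) : VanishesTo m (fun x => f x + g x) := by
  induction m generalizing f g with
  | zero => exact ContDiffAt.add hf hg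
  | succ m ih =>
    refine ⟨hf.1.add hg.1, by simp [hf.2.1, hg.2.1], (ih hf.2.2 hg.2.2).congr ?_⟩
    filter_upwards [eventually_differentiableAt hf.1, eventually_differentiableAt hg.1] with x h1 h2
    exact (deriv_fun_add h1 h2).symm

theorem clm (L : F →L[ℝ] G) (hf : VanishesTo m f) : VanishesTo m (fun x => L (f x)) := by
  induction m generalizing f with
  | zero => exact L.contDiff.contDiffAt.comp _ hf
  | succ m ih =>
    refine ⟨L.contDiff.contDiffAt.comp _ hf.1, by simp [hf.2.1], (ih hf.2.2).congr ?_⟩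
    filter_upwards [eventually_differentiableAt hf.1] with x h1
    exact (L.hasFDerivAt.comp_hasDerivAt x h1.hasDerivAt).deriv.symm

theorem neg (hf : VanishesTo m f) : VanishesTo m (fun x => -f x) :=
  hf.clm (-ContinuousLinearMap.id ℝ F)

theorem sub (hf : VanishesTo m f) (hg : VanishesTo m g) : VanishesTo m (fun x => f x - g x) := by
  simpa only [sub_eq_add_neg] using hf.add hg.neg

theorem const_smul (c : ℝ) (hf : VanishesTo m f) : VanishesTo m (fun x => c • f x) :=
  hf.clm (c • ContinuousLinearMap.id ℝ F)

theorem zero : VanishesTo m (fun _ => (0 : F)) := by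
  induction m with
  | zero => exact contDiffAt_const
  | succ m ih =>
    refine ⟨contDiffAt_const, rfl, ih.congr (Filter.Eventually.of_forall fun x => ?_)⟩
    simp

/-- Only one factor has to vanish; the other has to be smooth. This is what allows differences of
products to be estimated by telescoping. -/
theorem bilin (B : F →L[ℝ] G →L[ℝ] H) {g : ℝ → G} (hf : VanishesTo m f)
    (hg : ContDiffAt ℝ ∞ g 0) : VanishesTo m (fun x => B (f x) (g x)) := by
  induction m generalizing f g with
  | zero => exact (B.contDiff.contDiffAt.comp _ (show ContDiffAt ℝ ∞ f 0 from hf)).clm_apply hg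
  | succ m ih =>
    refine ⟨(B.contDiff.contDiffAt.comp _ hf.1).clm_apply hg, by simp [hf.2.1],
      ((ih hf.2.2 hg).add (ih hf.of_succ (contDiffAt_deriv hg))).congr ?_⟩
    filter_upwards [eventually_differentiableAt hf.1, eventually_differentiableAt hg] with x h1 h2
    have := (B.hasFDerivAt.comp_hasDerivAt x h1.hasDerivAt).clm_apply h2.hasDerivAt
    exact this.deriv.symm

theorem mul {f g : ℝ → ℝ} (hf : VanishesTo m f) (hg : ContDiffAt ℝ ∞ g 0) :
    VanishesTo m (fun x => f x * g x) :=
  hf.bilin (ContinuousLinearMap.mul ℝ ℝ) hg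

theorem id_smul (hf : VanishesTo m f) : VanishesTo (m + 1) (fun x => x • f x) := by
  induction m generalizing f with
  | zero =>
    have h1 : ContDiffAt ℝ ∞ (fun x : ℝ => x • f x) 0 := contDiffAt_id.smul hf
    exact ⟨h1, by simp, contDiffAt_deriv h1⟩
  | succ m ih =>
    have h1 : ContDiffAt ℝ ∞ (fun x : ℝ => x • f x) 0 := contDiffAt_id.smul hf.1
    refine ⟨h1, by simp, (VanishesTo.add hf (ih hf.2.2)).congr ?_⟩
    filter_upwards [eventually_differentiableAt hf.1] with x h2
    have := (hasDerivAt_id x).smul h2.hasDerivAt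
    rw [show (fun x : ℝ => x • f x) = (id : ℝ → ℝ) • f from rfl, this.deriv]
    simp [add_comm]

/-- On ρ^m the operator ρ∂_ρ acts as multiplication by m, so subtracting m f removes the leading
term. This is the source of the factor m in the recursion for the Taylor coefficients of g_ρ. -/
theorem euler (hf : VanishesTo m f) :
    VanishesTo (m + 1) (fun x => x • _root_.deriv f x - (m : ℝ) • f x) := by
  induction m generalizing f with
  | zero =>
    have h1 : ContDiffAt ℝ ∞ (fun x : ℝ => x • _root_.deriv f x - ((0 : ℕ) : ℝ) • f x) 0 :=
      (contDiffAt_id.smul (contDiffAt_deriv hf)).sub (contDiffAt_const.smul hf)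
    exact ⟨h1, by simp, contDiffAt_deriv h1⟩
  | succ m ih =>
    have h1 : ContDiffAt ℝ ∞ (fun x : ℝ => x • _root_.deriv f x - ((m + 1 : ℕ) : ℝ) • f x) 0 :=
      (contDiffAt_id.smul (contDiffAt_deriv hf.1)).sub (contDiffAt_const.smul hf.1)
    refine ⟨h1, by simp [hf.2.1], (ih hf.2.2).congr ?_⟩
    filter_upwards [eventually_differentiableAt hf.1,
      eventually_differentiableAt (contDiffAt_deriv hf.1)] with x h2 h3
    have := ((hasDerivAt_id x).smul h3.hasDerivAt).sub (h2.hasDerivAt.const_smul ((m + 1 : ℕ) : ℝ))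
    rw [show (fun x : ℝ => x • _root_.deriv f x - ((m + 1 : ℕ) : ℝ) • f x) =
      (id : ℝ → ℝ) • _root_.deriv f - ((m + 1 : ℕ) : ℝ) • f from rfl, this.deriv]
    push_cast
    simp
    module

theorem of_const_smul {c : ℝ} (hc : c ≠ 0) (hf : VanishesTo m (fun x => c • f x)) :
    VanishesTo m f := by
  refine (hf.const_smul c⁻¹).congr (Filter.Eventually.of_forall fun x => ?_)
  simp [smul_smul, hc]

theorem pow_smul {f : ℝ → F} (hf : ContDiffAt ℝ ∞ f 0) (m : ℕ) :
    VanishesTo m (fun x => x ^ m • f x) := by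
  induction m with
  | zero => simp only [pow_zero, one_smul]; exact hf
  | succ m ih =>
    refine ih.id_smul.congr (Filter.Eventually.of_forall fun x => ?_)
    simp [smul_smul, pow_succ']

theorem of_forall_apply {m : ℕ} {E : Type*} [NormedAddCommGroup E] [NormedSpace ℝ E]
    [FiniteDimensional ℝ E] {f : ℝ → E →L[ℝ] F} (hs : ContDiffAt ℝ ∞ f 0)
    (h : ∀ v, VanishesTo m fun x => f x v) : VanishesTo m f := by
  induction m generalizing f with
  | zero => exact hs
  | succ m ih =>
    refine ⟨hs, ContinuousLinearMap.ext fun v => (h v).2.1, ih (contDiffAt_deriv hs) fun v => ?_⟩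
    refine (h v).2.2.congr ?_
    filter_upwards [eventually_differentiableAt hs] with x hx
    have := (hx.hasDerivAt.clm_apply (hasDerivAt_const x v)).deriv
    simpa using this

end VanishesTo

end VanishingOrder

/-! ### Order of vanishing along ρ = 0 for functions of (y, ρ). -/

namespace CoordGeom

variable {E F G H : Type*} [NormedAddCommGroup E] [NormedSpace ℝ E] [NormedAddCommGroup F]
  [NormedSpace ℝ F] [NormedAddCommGroup G] [NormedSpace ℝ G] [NormedAddCommGroup H]
  [NormedSpace ℝ H]

/-- `f` is smooth on `Ω` and vanishes to order `m` along `ρ = 0`. -/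
structure VanishesOn (Ω : Set (E × ℝ)) (m : ℕ) (f : E × ℝ → F) : Prop where
  smooth : ContDiffOn ℝ ∞ f Ω
  vanishes : ∀ y, (y, (0 : ℝ)) ∈ Ω → VanishesTo m fun r => f (y, r)

variable {Ω : Set (E × ℝ)} {m : ℕ}

theorem line_eventually (hΩ : IsOpen Ω) {y : E} {r : ℝ} (hy : (y, r) ∈ Ω) :
    ∀ᶠ s in 𝓝 r, (y, s) ∈ Ω :=
  (hΩ.preimage (by fun_prop : Continuous fun s : ℝ => (y, s))).mem_nhds hy

theorem hasDerivAt_line {f : E × ℝ → F} {y : E} {r : ℝ} (hf : DifferentiableAt ℝ f (y, r)) :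
    HasDerivAt (fun s => f (y, s)) (dRho f (y, r)) r := by
  have h1 : HasDerivAt (fun s : ℝ => (y, s)) ((0 : E), (1 : ℝ)) r :=
    (hasDerivAt_const r y).prodMk (hasDerivAt_id r)
  exact HasFDerivAt.comp_hasDerivAt (l := f) (f := fun s : ℝ => (y, s)) r hf.hasFDerivAt h1

theorem deriv_line {f : E × ℝ → F} {y : E} {r : ℝ} (hf : DifferentiableAt ℝ f (y, r)) :
    deriv (fun s => f (y, s)) r = dRho f (y, r) := (hasDerivAt_line hf).deriv

theorem contDiffAt_line (hΩ : IsOpen Ω) {f : E × ℝ → F} (hf : ContDiffOn ℝ ∞ f Ω) {y : E} {r : ℝ}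
    (hy : (y, r) ∈ Ω) : ContDiffAt ℝ ∞ (fun s => f (y, s)) r :=
  ContDiffAt.comp (g := f) (f := fun s : ℝ => (y, s)) r (hf.contDiffAt (hΩ.mem_nhds hy))
    (by fun_prop)

theorem deriv_line_eventuallyEq (hΩ : IsOpen Ω) {f : E × ℝ → F} (hf : ContDiffOn ℝ ∞ f Ω) {y : E}
    {r : ℝ} (hy : (y, r) ∈ Ω) :
    deriv (fun s => f (y, s)) =ᶠ[𝓝 r] fun s => dRho f (y, s) := by
  filter_upwards [line_eventually hΩ hy] with s hs
  exact deriv_line (differentiableAt_of_contDiffOn hΩ hf hs)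

/-- The partial derivative in the variable `y`. -/
def dSlice (f : E × ℝ → F) (p : E × ℝ) : E →L[ℝ] F := (fderiv ℝ f p).comp (.inl ℝ E ℝ)

theorem contDiffOn_dSlice (hΩ : IsOpen Ω) {f : E × ℝ → F} (hf : ContDiffOn ℝ ∞ f Ω) :
    ContDiffOn ℝ ∞ (dSlice f) Ω :=
  (contDiffOn_fderiv hΩ hf).clm_comp contDiffOn_const

/-- Symmetry of the second derivative. -/
theorem dRho_dSlice (hΩ : IsOpen Ω) {f : E × ℝ → F} (hf : ContDiffOn ℝ ∞ f Ω) {p : E × ℝ}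
    (hp : p ∈ Ω) : dRho (dSlice f) p = dSlice (dRho f) p := by
  have hd := differentiableAt_of_contDiffOn hΩ (contDiffOn_fderiv hΩ hf) hp
  have hd' := differentiableAt_of_contDiffOn hΩ (contDiffOn_dSlice hΩ hf) hp
  refine ContinuousLinearMap.ext fun v => ?_
  have e1 : dRho (dSlice f) p v = fderiv ℝ (fderiv ℝ f) p (0, 1) (v, 0) := by
    rw [dRho, ← fderiv_fderiv_apply_const hd', ← fderiv_fderiv_apply_const hd]
    rfl
  have e2 : dSlice (dRho f) p v = fderiv ℝ (fderiv ℝ f) p (v, 0) (0, 1) :=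
    fderiv_fderiv_apply_const hd (v, 0) (0, 1)
  rw [e1, e2]
  exact ((hf.contDiffAt (hΩ.mem_nhds hp)).isSymmSndFDerivAt
    (by simpa using WithTop.coe_le_coe.2 (le_top : (2 : ℕ∞) ≤ ⊤))).eq _ _

namespace VanishesOn

variable {f g : E × ℝ → F}

theorem of_succ (h : VanishesOn Ω (m + 1) f) : VanishesOn Ω m f :=
  ⟨h.1, fun y hy => (h.2 y hy).of_succ⟩

theorem mono {k : ℕ} (hk : k ≤ m) (h : VanishesOn Ω m f) : VanishesOn Ω k f :=
  ⟨h.1, fun y hy => (h.2 y hy).mono hk⟩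

theorem congr (hΩ : IsOpen Ω) (h : VanishesOn Ω m f) (hfg : ∀ p ∈ Ω, g p = f p) :
    VanishesOn Ω m g :=
  ⟨h.1.congr hfg, fun y hy => (h.2 y hy).congr
    ((line_eventually hΩ hy).mono fun _ hs => (hfg _ hs).symm)⟩

theorem add (hf : VanishesOn Ω m f) (hg : VanishesOn Ω m g) :
    VanishesOn Ω m (fun p => f p + g p) :=
  ⟨hf.1.add hg.1, fun y hy => (hf.2 y hy).add (hg.2 y hy)⟩

theorem sub (hf : VanishesOn Ω m f) (hg : VanishesOn Ω m g) :
    VanishesOn Ω m (fun p => f p - g p) :=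
  ⟨hf.1.sub hg.1, fun y hy => (hf.2 y hy).sub (hg.2 y hy)⟩

theorem clm (L : F →L[ℝ] G) (hf : VanishesOn Ω m f) : VanishesOn Ω m (fun p => L (f p)) :=
  ⟨L.contDiff.comp_contDiffOn hf.1, fun y hy => (hf.2 y hy).clm L⟩

theorem bilin (B : F →L[ℝ] G →L[ℝ] H) {g : E × ℝ → G} (hΩ : IsOpen Ω) (hf : VanishesOn Ω m f)
    (hg : ContDiffOn ℝ ∞ g Ω) : VanishesOn Ω m (fun p => B (f p) (g p)) :=
  ⟨(B.contDiff.comp_contDiffOn hf.1).clm_apply hg,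
    fun y hy => (hf.2 y hy).bilin B (contDiffAt_line hΩ hg hy)⟩

theorem bilin_right (B : F →L[ℝ] G →L[ℝ] H) {g : E × ℝ → G} (hΩ : IsOpen Ω)
    (hf : ContDiffOn ℝ ∞ f Ω) (hg : VanishesOn Ω m g) : VanishesOn Ω m (fun p => B (f p) (g p)) :=
  hg.bilin B.flip hΩ hf

theorem dRho (hΩ : IsOpen Ω) (hf : VanishesOn Ω (m + 1) f) : VanishesOn Ω m (dRho f) :=
  ⟨contDiffOn_dRho hΩ hf.1, fun y hy => (hf.2 y hy).deriv.congr
    (deriv_line_eventuallyEq hΩ hf.1 hy)⟩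

theorem of_dRho (hΩ : IsOpen Ω) (hf : ContDiffOn ℝ ∞ f Ω) (h0 : ∀ y, (y, (0 : ℝ)) ∈ Ω → f (y, 0) = 0)
    (h : VanishesOn Ω m (CoordGeom.dRho f)) : VanishesOn Ω (m + 1) f :=
  ⟨hf, fun y hy => ⟨contDiffAt_line hΩ hf hy, h0 y hy, (h.2 y hy).congr
    (deriv_line_eventuallyEq hΩ hf hy).symm⟩⟩

theorem rho_smul (hf : VanishesOn Ω m f) : VanishesOn Ω (m + 1) (fun p => p.2 • f p) :=
  ⟨contDiffOn_snd.smul hf.1, fun y hy => (hf.2 y hy).id_smul⟩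

/-- Derivatives along the slice cost no order: a function that is zero on ρ = 0 has zero
y-derivative there, and ∂_ρ commutes with the y-derivative, which drives the induction. -/
theorem dSlice (hΩ : IsOpen Ω) (hf : VanishesOn Ω m f) :
    VanishesOn Ω m (dSlice f) := by
  induction m generalizing f with
  | zero => exact ⟨contDiffOn_dSlice hΩ hf.1, fun y hy =>
      contDiffAt_line hΩ (contDiffOn_dSlice hΩ hf.1) hy⟩
  | succ m ih =>
    refine of_dRho hΩ (contDiffOn_dSlice hΩ hf.1) (fun y hy => ?_)
      ((ih (hf.dRho hΩ)).congr hΩ fun p hp => dRho_dSlice hΩ hf.1 hp)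
    have h1 := fderiv_slice (p := (y, (0 : ℝ))) (differentiableAt_of_contDiffOn hΩ hf.1 hy)
    have h2 : (fun x => f (x, (0 : ℝ))) =ᶠ[𝓝 y] fun _ => 0 := by
      filter_upwards [(isOpen_slice hΩ 0).mem_nhds hy] with x hx
      exact (hf.2 x hx).2.1
    exact h1.symm.trans (by rw [h2.fderiv_eq]; simp)

end VanishesOn

end CoordGeom

/-! ### How Christoffel symbols and Ricci curvature depend on the family of metrics. -/

namespace CoordGeom

variable {E : Type*} [NormedAddCommGroup E] [NormedSpace ℝ E] [FiniteDimensional ℝ E]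
  {γ γ₀ : E × ℝ → E →L[ℝ] E →L[ℝ] ℝ} {Ω : Set (E × ℝ)} {m : ℕ}

/-- The restriction of the Ricci curvature of `2ρ dt² + 2t dt dρ + t² γ` to `E`. -/
def ricciTangential (γ : E × ℝ → E →L[ℝ] E →L[ℝ] ℝ) (u v : E) (p : E × ℝ) : ℝ :=
  ricci (fun y => γ (y, p.2)) p.1 u v + p.2 * dRho (dRho γ) p u v
    - p.2 * dRho γ p u (shape γ p v)
    + 2⁻¹ * traceL E (shape γ p) * (p.2 * dRho γ p u v - γ p u v)
    + (1 - Module.finrank ℝ E / 2) * dRho γ p u v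

/-- The component in the direction of `∂_ρ` of the Ricci curvature of
`2ρ dt² + 2t dt dρ + t² γ`. -/
def ricciNormal (γ : E × ℝ → E →L[ℝ] E →L[ℝ] ℝ) (p : E × ℝ) : ℝ :=
  -(2⁻¹ * traceL E (dRho (shape γ) p)) - 4⁻¹ * traceL E ((shape γ p).comp (shape γ p))

theorem ricci_ambientCoord_tangential (h : IsMetricFamily γ Ω) {z : ℝ × E × ℝ} (ht : 0 < z.1)
    (hz : z.2 ∈ Ω) (u v : E) :
    ricci (ambientCoord γ) z (0, u, 0) (0, v, 0) = ricciTangential γ u v z.2 := by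
  rw [ricci_ambientCoord h ht hz, ricciTangential]
  simp

theorem ricci_ambientCoord_normal (h : IsMetricFamily γ Ω) {z : ℝ × E × ℝ} (ht : 0 < z.1)
    (hz : z.2 ∈ Ω) :
    ricci (ambientCoord γ) z (0, 0, 1) (0, 0, 1) = ricciNormal γ z.2 := by
  have h1 : ricci (fun y => γ (y, z.2.2)) z.2.1 0 0 = 0 := by
    rw [ricci_slice h hz]
    simp [evalSnd]
  rw [ricci_ambientCoord h ht hz, ricciNormal]
  have h0 : ((0 : E), (0 : ℝ)) = 0 := rfl
  simp [h1, h0, evalSnd]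

theorem dRho_sub {F : Type*} [NormedAddCommGroup F] [NormedSpace ℝ F] {f g : E × ℝ → F}
    {p : E × ℝ} (hf : DifferentiableAt ℝ f p) (hg : DifferentiableAt ℝ g p) :
    dRho (fun q => f q - g q) p = dRho f p - dRho g p := by
  rw [dRho, fderiv_fun_sub hf hg]; rfl

theorem dSlice_sub {F : Type*} [NormedAddCommGroup F] [NormedSpace ℝ F] {f g : E × ℝ → F}
    {p : E × ℝ} (hf : DifferentiableAt ℝ f p) (hg : DifferentiableAt ℝ g p) :
    dSlice (fun q => f q - g q) p = dSlice f p - dSlice g p := by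
  rw [dSlice, fderiv_fun_sub hf hg]; rfl

set_option maxSynthPendingDepth 3 in
/-- `evalSnd B v` as a linear function of `B`. -/
def evalSndL {W F : Type*} [NormedAddCommGroup F] [NormedSpace ℝ F] [NormedAddCommGroup W]
    [NormedSpace ℝ W] (v : W) : (E →L[ℝ] W →L[ℝ] F) →L[ℝ] E →L[ℝ] F :=
  (ContinuousLinearMap.apply ℝ (E →L[ℝ] F) v).comp
    ((ContinuousLinearMap.flipₗᵢ ℝ E W F).toContinuousLinearEquiv : _ →L[ℝ] _)

theorem evalSndL_apply {W F : Type*} [NormedAddCommGroup F] [NormedSpace ℝ F]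
    [NormedAddCommGroup W] [NormedSpace ℝ W] (v : W) (B : E →L[ℝ] W →L[ℝ] F) :
    evalSndL v B = evalSnd B v := rfl

set_option maxSynthPendingDepth 3 in
/-- The pairing `(B, v) ↦ evalSnd B v`. -/
def evalSndBilin (E W F : Type*) [NormedAddCommGroup E] [NormedSpace ℝ E]
    [NormedAddCommGroup F] [NormedSpace ℝ F] [NormedAddCommGroup W]
    [NormedSpace ℝ W] : (E →L[ℝ] W →L[ℝ] F) →L[ℝ] W →L[ℝ] E →L[ℝ] F :=
  ((ContinuousLinearMap.flipₗᵢ ℝ E W F).toContinuousLinearEquiv : _ →L[ℝ] _)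

theorem evalSndBilin_apply {W F : Type*} [NormedAddCommGroup F] [NormedSpace ℝ F]
    [NormedAddCommGroup W] [NormedSpace ℝ W] (v : W) (B : E →L[ℝ] W →L[ℝ] F) :
    evalSndBilin E W F B v = evalSnd B v := rfl

section Perturbation

set_option maxSynthPendingDepth 3

variable (h : IsMetricFamily γ Ω) (h₀ : IsMetricFamily γ₀ Ω)
  (hd : VanishesOn Ω m fun p => γ p - γ₀ p)
include h h₀ hd

/-- The resolvent identity γ⁻¹ - γ₀⁻¹ = -γ⁻¹(γ - γ₀)γ₀⁻¹. -/
theorem vanishesOn_inverse_sub : VanishesOn Ω m fun p => (γ p).inverse - (γ₀ p).inverse := by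
  have : CompleteSpace E := FiniteDimensional.complete ℝ E
  have hK := contDiffOn_inverse h.smooth h.inv
  have hK₀ := contDiffOn_inverse h₀.smooth h₀.inv
  have e1 := hd.bilin ((ContinuousLinearMap.compL ℝ (E →L[ℝ] ℝ) E (E →L[ℝ] ℝ))) h.isOpen hK₀
  have e2 := e1.bilin_right (ContinuousLinearMap.compL ℝ (E →L[ℝ] ℝ) (E →L[ℝ] ℝ) E) h.isOpen hK
  refine (e2.clm (-ContinuousLinearMap.id ℝ _)).congr h.isOpen fun p hp => ?_
  refine ContinuousLinearMap.ext fun φ => ?_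
  simp [h₀.inv p hp |>.self_apply_inverse, h.inv p hp |>.inverse_apply_self]

set_option maxSynthPendingDepth 3 in
-- Only y-derivatives of the metric occur, so no order is lost. The proof telescopes the product of
-- the inverse metric with the symbols of the first kind.
theorem vanishesOn_sliceChristoffel_sub :
    VanishesOn Ω m fun p => sliceChristoffel γ p - sliceChristoffel γ₀ p := by
  have hK := vanishesOn_inverse_sub h h₀ hd
  have hC := (ContinuousLinearMap.compL ℝ E (E →L[ℝ] ℝ) E)
  have hD := (hd.dSlice h.isOpen).clm (christoffelFirstL E)
  have hK₀ : ContDiffOn ℝ ∞ (fun p => (γ₀ p).inverse) Ω := by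
    have : CompleteSpace E := FiniteDimensional.complete ℝ E
    exact contDiffOn_inverse h₀.smooth h₀.inv
  have hDγ : ContDiffOn ℝ ∞ (fun p => christoffelFirstL E (dSlice γ p)) Ω :=
    (christoffelFirstL E).contDiff.comp_contDiffOn (contDiffOn_dSlice h.isOpen h.smooth)
  let B : ((E →L[ℝ] ℝ) →L[ℝ] E) →L[ℝ] (E →L[ℝ] E →L[ℝ] E →L[ℝ] ℝ) →L[ℝ] (E →L[ℝ] E →L[ℝ] E) :=
    (ContinuousLinearMap.compL ℝ E (E →L[ℝ] E →L[ℝ] ℝ) (E →L[ℝ] E)).comp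
      (ContinuousLinearMap.compL ℝ E (E →L[ℝ] ℝ) E)
  have hΓ : ∀ {γ : E × ℝ → E →L[ℝ] E →L[ℝ] ℝ}, IsMetricFamily γ Ω → ∀ p ∈ Ω,
      sliceChristoffel γ p = B (γ p).inverse (christoffelFirstL E (dSlice γ p)) := by
    intro γ h p hp
    rw [sliceChristoffel, christoffel_eq_comp, fderiv_slice (f := γ) (h.differentiableAt hp)]
    rfl
  refine ((hK.bilin B h.isOpen hDγ).add (hD.bilin_right B h.isOpen hK₀)).congr h.isOpen
    fun p hp => ?_
  rw [hΓ h p hp, hΓ h₀ p hp, dSlice_sub (h.differentiableAt hp) (h₀.differentiableAt hp)]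
  simp only [map_sub, _root_.sub_apply]
  abel

/-- The ρ-derivative is the factor that may agree to lower order, hence the separate order `k ≤ m`.
-/
theorem vanishesOn_shape_sub {k : ℕ} (hk : k ≤ m)
    (hd' : VanishesOn Ω k fun p => dRho γ p - dRho γ₀ p) :
    VanishesOn Ω k fun p => shape γ p - shape γ₀ p := by
  have : CompleteSpace E := FiniteDimensional.complete ℝ E
  have hK := (vanishesOn_inverse_sub h h₀ hd).mono hk
  let B := (ContinuousLinearMap.compL ℝ E (E →L[ℝ] ℝ) E)
  refine ((hK.bilin B h.isOpen (contDiffOn_dRho h.isOpen h.smooth)).add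
    (hd'.bilin_right B h.isOpen (contDiffOn_inverse h₀.smooth h₀.inv))).congr h.isOpen
    fun p hp => ?_
  simp only [B, shape, ContinuousLinearMap.compL_apply, ContinuousLinearMap.sub_comp,
    ContinuousLinearMap.comp_sub]
  abel

/-- The Ricci curvature of the slices involves y-derivatives only, so it agrees to the same order as
the metrics. The terms `t3`, `t4` and `t5`, `t6` telescope the two quadratic expressions in Γ. -/
theorem vanishesOn_ricci_slice_sub (u v : E) :
    VanishesOn Ω m fun p => ricci (fun y => γ (y, p.2)) p.1 u v
      - ricci (fun y => γ₀ (y, p.2)) p.1 u v := by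
  have hΓ := vanishesOn_sliceChristoffel_sub h h₀ hd
  have hDΓ := hΓ.dSlice h.isOpen
  have s := h.contDiffOn_sliceChristoffel
  have s₀ := h₀.contDiffOn_sliceChristoffel
  have t1 := ((hDΓ.clm (evalSndL u)).clm (evalSndL v)).clm (traceL E)
  have t2 := ((hDΓ.clm (ContinuousLinearMap.apply ℝ (E →L[ℝ] E →L[ℝ] E) u)).clm (evalSndL v)).clm
    (traceL E)
  let apu : (E →L[ℝ] E →L[ℝ] E) →L[ℝ] E →L[ℝ] E := ContinuousLinearMap.apply ℝ (E →L[ℝ] E) u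
  let apuv : (E →L[ℝ] E →L[ℝ] E) →L[ℝ] E := (ContinuousLinearMap.apply ℝ E v).comp apu
  have t3 := (hΓ.bilin (evalSndBilin E E E) h.isOpen (apuv.contDiff.comp_contDiffOn s)).clm
    (traceL E)
  have t4 := ((hΓ.clm apuv).bilin_right (evalSndBilin E E E) h.isOpen s₀).clm (traceL E)
  have t5 := ((hΓ.clm apu).bilin (ContinuousLinearMap.compL ℝ E E E) h.isOpen
    ((evalSndL v).contDiff.comp_contDiffOn s)).clm (traceL E)
  have t6 := ((hΓ.clm (evalSndL v)).bilin_right (ContinuousLinearMap.compL ℝ E E E) h.isOpen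
    (apu.contDiff.comp_contDiffOn s₀)).clm (traceL E)
  refine ((((t1.sub t2).add t3).add t4).sub (t5.add t6)).congr h.isOpen fun p hp => ?_
  rw [ricci_slice h hp, ricci_slice h₀ hp]
  rw [dSlice_sub (differentiableAt_of_contDiffOn h.isOpen s hp)
    (differentiableAt_of_contDiffOn h.isOpen s₀ hp)]
  simp only [map_sub, evalSndL_apply, evalSndBilin_apply, ContinuousLinearMap.compL_apply,
    ContinuousLinearMap.apply_apply, _root_.sub_apply, ContinuousLinearMap.comp_apply,
    Function.comp_def, apu, apuv]
  have f1 : ∀ γ : E × ℝ → E →L[ℝ] E →L[ℝ] ℝ, fderiv ℝ (sliceChristoffel γ) p (u, 0) =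
    dSlice (sliceChristoffel γ) p u := fun _ => rfl
  have f2 : ∀ γ : E × ℝ → E →L[ℝ] E →L[ℝ] ℝ, (fderiv ℝ (sliceChristoffel γ) p).comp
    (.inl ℝ E ℝ) = dSlice (sliceChristoffel γ) p := fun _ => rfl
  simp only [f1, f2]
  ring

end Perturbation

end CoordGeom

/-! ### The recursion by which the Ricci curvature determines the family of metrics. -/

namespace CoordGeom

variable {E : Type*} [NormedAddCommGroup E] [NormedSpace ℝ E] [FiniteDimensional ℝ E]
  {γ γ₀ : E × ℝ → E →L[ℝ] E →L[ℝ] ℝ} {Ω : Set (E × ℝ)} {m : ℕ}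

theorem VanishesOn.euler {F : Type*} [NormedAddCommGroup F] [NormedSpace ℝ F] {f : E × ℝ → F}
    (hΩ : IsOpen Ω) (hf : VanishesOn Ω m f) :
    VanishesOn Ω (m + 1) fun p => p.2 • CoordGeom.dRho f p - (m : ℝ) • f p :=
  ⟨(contDiffOn_snd.smul (contDiffOn_dRho hΩ hf.1)).sub (contDiffOn_const.smul hf.1),
    fun y hy => (hf.2 y hy).euler.congr <| by
      filter_upwards [deriv_line_eventuallyEq hΩ hf.1 hy] with s hs
      rw [hs]⟩

section Perturbation

set_option maxSynthPendingDepth 3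

variable (h : IsMetricFamily γ Ω) (h₀ : IsMetricFamily γ₀ Ω)
include h h₀

theorem vanishesOn_dRho_sub (hd : VanishesOn Ω (m + 1) fun p => γ p - γ₀ p) :
    VanishesOn Ω m fun p => dRho γ p - dRho γ₀ p :=
  (hd.dRho h.isOpen).congr h.isOpen fun _ hp =>
    (dRho_sub (h.differentiableAt hp) (h₀.differentiableAt hp)).symm

theorem vanishesOn_traceL_shape_sub {k : ℕ} (hk : k ≤ m)
    (hd : VanishesOn Ω m fun p => γ p - γ₀ p)
    (hd' : VanishesOn Ω k fun p => dRho γ p - dRho γ₀ p) :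
    VanishesOn Ω k fun p => traceL E (shape γ p) - traceL E (shape γ₀ p) :=
  ((vanishesOn_shape_sub h h₀ hd hk hd').clm (traceL E)).congr h.isOpen fun p hp => by
    rw [map_sub]

/-- The difference of the ∂_ργ is O(ρ^m), so by the Euler identity ρ∂_ρ² of γ - γ₀ equals m times it
modulo ρ^{m+1}. Together with the coefficient 1 - n/2 of ∂_ργ, where n = dim E, this yields m + 1 -
n/2. The slice curvature and the products carrying a factor ρ agree to order m + 1; in the remaining
product τγ only the change of τ is visible. -/
theorem vanishesOn_ricciTangential_sub (hd : VanishesOn Ω (m + 1) fun p => γ p - γ₀ p) (u v : E) :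
    VanishesOn Ω (m + 1) fun p => (ricciTangential γ u v p - ricciTangential γ₀ u v p)
      - (((m + 1 : ℝ) - Module.finrank ℝ E / 2) * (dRho γ p u v - dRho γ₀ p u v)
        - 2⁻¹ * ((traceL E (shape γ p) - traceL E (shape γ₀ p)) * γ p u v)) := by
  have hΩ := h.isOpen
  have hd' := vanishesOn_dRho_sub h h₀ hd
  have hS := vanishesOn_shape_sub h h₀ hd (Nat.le_succ m) hd'
  have hτ := vanishesOn_traceL_shape_sub h h₀ (Nat.le_succ m) hd hd'
  let ev : (E →L[ℝ] E →L[ℝ] ℝ) →L[ℝ] ℝ :=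
    (ContinuousLinearMap.apply ℝ ℝ v).comp (ContinuousLinearMap.apply ℝ (E →L[ℝ] ℝ) u)
  have hev : ∀ B, ev B = B u v := fun _ => rfl
  let evu : (E →L[ℝ] E →L[ℝ] ℝ) →L[ℝ] (E →L[ℝ] ℝ) := ContinuousLinearMap.apply ℝ (E →L[ℝ] ℝ) u
  have hevu : ∀ B, evu B = B u := fun _ => rfl
  let ev1 : (E →L[ℝ] E) →L[ℝ] E := ContinuousLinearMap.apply ℝ E v
  have hev1 : ∀ A, ev1 A = A v := fun _ => rfl
  let mul := ContinuousLinearMap.mul ℝ ℝ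
  let app : (E →L[ℝ] ℝ) →L[ℝ] E →L[ℝ] ℝ := ContinuousLinearMap.id ℝ _
  have hγ' := contDiffOn_dRho hΩ h.smooth
  have hγ₀' := contDiffOn_dRho hΩ h₀.smooth
  have hτ₀ : ContDiffOn ℝ ∞ (fun p => traceL E (shape γ₀ p)) Ω :=
    (traceL E).contDiff.comp_contDiffOn h₀.contDiffOn_shape
  have t1 := vanishesOn_ricci_slice_sub h h₀ hd u v
  have t2 := (hd'.clm ev).euler hΩ
  have t3 := (((hd'.clm evu).bilin app hΩ (ev1.contDiff.comp_contDiffOn h.contDiffOn_shape)).add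
    ((hS.clm ev1).bilin_right app hΩ (evu.contDiff.comp_contDiffOn hγ₀'))).rho_smul
  have t4 := ((hτ.bilin mul hΩ (ev.contDiff.comp_contDiffOn hγ')).add
    ((hd'.clm ev).bilin_right mul hΩ hτ₀)).rho_smul
  have t5 := (hd.clm ev).bilin_right mul hΩ hτ₀
  refine ((((t1.add t2).sub t3).add (t4.clm ((2⁻¹ : ℝ) • ContinuousLinearMap.id ℝ ℝ))).sub
    (t5.clm ((2⁻¹ : ℝ) • ContinuousLinearMap.id ℝ ℝ))).congr hΩ fun p hp => ?_
  have e : dRho (fun p => ev (dRho γ p - dRho γ₀ p)) p =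
      dRho (dRho γ) p u v - dRho (dRho γ₀) p u v := by
    have d1 := differentiableAt_of_contDiffOn hΩ hγ' hp
    have d2 := differentiableAt_of_contDiffOn hΩ hγ₀' hp
    have := (ev.hasFDerivAt.comp p (d1.sub d2).hasFDerivAt).fderiv
    rw [dRho]
    refine (congrArg (fun L => L (0, 1)) this).trans ?_
    rw [fderiv_sub d1 d2]
    rfl
  rw [e]
  simp only [ricciTangential, Function.comp_apply, hev, hevu, hev1, mul, app, _root_.sub_apply,
    ContinuousLinearMap.mul_apply', ContinuousLinearMap.id_apply, _root_.smul_apply, smul_eq_mul,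
    map_sub]
  ring

/-- The normal component is -½∂_ρτ plus a quadratic expression in the shape operator, and the shape
operators agree to order m. -/
theorem vanishesOn_ricciNormal_sub (hd : VanishesOn Ω (m + 1) fun p => γ p - γ₀ p) :
    VanishesOn Ω m fun p => (ricciNormal γ p - ricciNormal γ₀ p)
      + 2⁻¹ * dRho (fun p => traceL E (shape γ p) - traceL E (shape γ₀ p)) p := by
  have hΩ := h.isOpen
  have hd' := vanishesOn_dRho_sub h h₀ hd
  have hS := vanishesOn_shape_sub h h₀ hd (Nat.le_succ m) hd'
  have s := h.contDiffOn_shape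
  have s₀ := h₀.contDiffOn_shape
  have t := ((hS.bilin (ContinuousLinearMap.compL ℝ E E E) hΩ s).add
    (hS.bilin_right (ContinuousLinearMap.compL ℝ E E E) hΩ s₀)).clm ((-4⁻¹ : ℝ) • traceL E)
  refine t.congr hΩ fun p hp => ?_
  have d1 := differentiableAt_of_contDiffOn hΩ s hp
  have d2 := differentiableAt_of_contDiffOn hΩ s₀ hp
  have e : dRho (fun p => traceL E (shape γ p) - traceL E (shape γ₀ p)) p =
      traceL E (dRho (shape γ) p) - traceL E (dRho (shape γ₀) p) := by
    have := (((traceL E).hasFDerivAt.comp p d1.hasFDerivAt).sub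
      ((traceL E).hasFDerivAt.comp p d2.hasFDerivAt)).fderiv
    rw [dRho]
    exact congrArg (fun L => L (0, 1)) this
  rw [e]
  simp only [ricciNormal, ContinuousLinearMap.compL_apply, map_sub, map_add, _root_.smul_apply,
    smul_eq_mul, _root_.sub_apply]
  ring

/-- The trace of `γ⁻¹ ∂_ρ γ` is determined to order `m + 2` by the normal Ricci curvature. -/
theorem vanishesTo_traceL_shape_sub (hd : VanishesOn Ω (m + 2) fun p => γ p - γ₀ p) {y : E}
    (hy : (y, (0 : ℝ)) ∈ Ω) (hN : VanishesTo (m + 1) fun r => ricciNormal γ (y, r))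
    (hN₀ : ∀ p ∈ Ω, ricciNormal γ₀ p = 0) :
    VanishesTo (m + 2) fun r => traceL E (shape γ (y, r)) - traceL E (shape γ₀ (y, r)) := by
  have hΩ := h.isOpen
  have h1 := (vanishesOn_ricciNormal_sub h h₀ hd).2 y hy
  have hτ := vanishesOn_traceL_shape_sub h h₀ (Nat.le_succ (m + 1)) hd
    (vanishesOn_dRho_sub h h₀ hd)
  -- Agreement of γ to order m + 2 gives only order m + 1 for τ. The normal equation bounds ∂_ρ of
  -- the difference of the τ to order m + 1, and integrating gains the missing order.
  have h2 : VanishesTo (m + 1) fun r =>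
      dRho (fun p => traceL E (shape γ p) - traceL E (shape γ₀ p)) (y, r) := by
    refine ((h1.sub hN).const_smul 2).congr ?_
    filter_upwards [line_eventually hΩ hy] with r hr
    rw [hN₀ _ hr]
    simp
  exact ⟨contDiffAt_line hΩ hτ.1 hy, (hτ.2 y hy).2.1,
    h2.congr (deriv_line_eventuallyEq hΩ hτ.1 hy).symm⟩

/-- Once τ is known to order m + 1, the tangential equation leaves (m + 1 - n/2) times the
difference of the ∂_ργ, with n = dim E. The factor is nonzero by `hm`, so one more order of γ is
determined. -/
theorem vanishesTo_sub_succ (hd : VanishesOn Ω (m + 1) fun p => γ p - γ₀ p) {y : E}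
    (hy : (y, (0 : ℝ)) ∈ Ω)
    (hT : ∀ u v, VanishesTo (m + 1) fun r => ricciTangential γ u v (y, r))
    (hT₀ : ∀ u v, ∀ r, (y, r) ∈ Ω → ricciTangential γ₀ u v (y, r) = 0)
    (hτ : VanishesTo (m + 1) fun r => traceL E (shape γ (y, r)) - traceL E (shape γ₀ (y, r)))
    (hm : (m + 1 : ℝ) ≠ Module.finrank ℝ E / 2) :
    VanishesTo (m + 2) fun r => γ (y, r) - γ₀ (y, r) := by
  have hΩ := h.isOpen
  have hd' := vanishesOn_dRho_sub h h₀ hd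
  have hev : ∀ u v : E, ContDiffOn ℝ ∞ (fun p => γ p u v) Ω := fun u v =>
    (h.smooth.clm_apply contDiffOn_const).clm_apply contDiffOn_const
  have h1 : VanishesTo (m + 1) fun r => dRho γ (y, r) - dRho γ₀ (y, r) := by
    have hs := (hd'.2 y hy).contDiffAt
    refine VanishesTo.of_forall_apply hs fun u =>
      VanishesTo.of_forall_apply (hs.clm_apply contDiffAt_const) fun v => ?_
    refine VanishesTo.of_const_smul (sub_ne_zero.mpr hm) ?_
    have a := (vanishesOn_ricciTangential_sub h h₀ hd u v).2 y hy
    have b := (hτ.mul (contDiffAt_line hΩ (hev u v) hy)).const_smul (2⁻¹ : ℝ)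
    refine (((hT u v).sub a).add b).congr ?_
    filter_upwards [line_eventually hΩ hy] with r hr
    rw [hT₀ u v r hr]
    simp
  refine ⟨(hd.2 y hy).contDiffAt, (hd.2 y hy).2.1, h1.congr ?_⟩
  refine ((deriv_line_eventuallyEq hΩ hd.1 hy).trans ?_).symm
  filter_upwards [line_eventually hΩ hy] with r hr
  exact dRho_sub (h.differentiableAt hr) (h₀.differentiableAt hr)

/-- The trace of `γ⁻¹ ∂_ρ γ` at `ρ = 0` is determined by the trace of the tangential Ricci
curvature. -/
theorem traceL_shape_eq (hn : 2 ≤ Module.finrank ℝ E) (hd : VanishesOn Ω 1 fun p => γ p - γ₀ p)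
    {y : E} (hy : (y, (0 : ℝ)) ∈ Ω) (σ : E →L[ℝ] E →L[ℝ] ℝ)
    (hσ : ∀ u v, ricciTangential γ u v (y, 0) = σ u v) (htr : metricTrace (γ (y, 0)) σ = 0)
    (hT₀ : ∀ u v, ricciTangential γ₀ u v (y, 0) = 0) :
    VanishesTo 1 fun r => traceL E (shape γ (y, r)) - traceL E (shape γ₀ (y, r)) := by
  have hΩ := h.isOpen
  have hτ : ContDiffOn ℝ ∞ (fun p => traceL E (shape γ p) - traceL E (shape γ₀ p)) Ω :=
    ((traceL E).contDiff.comp_contDiffOn h.contDiffOn_shape).sub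
      ((traceL E).contDiff.comp_contDiffOn h₀.contDiffOn_shape)
  have hc := contDiffAt_line hΩ hτ hy
  refine ⟨hc, ?_, contDiffAt_deriv hc⟩
  have hγ : γ (y, 0) = γ₀ (y, 0) := sub_eq_zero.mp (hd.2 y hy).2.1
  set τ := traceL E (shape γ (y, 0)) - traceL E (shape γ₀ (y, 0)) with hτdef
  -- This is the tangential formula at order m = 0, evaluated at ρ = 0, where its error term
  -- vanishes.
  have hσ' : σ = ((1 : ℝ) - Module.finrank ℝ E / 2) • (dRho γ (y, 0) + (-1 : ℝ) • dRho γ₀ (y, 0))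
      + (-(2⁻¹ * τ)) • γ (y, 0) := by
    ext u v
    have a := ((vanishesOn_ricciTangential_sub h h₀ (m := 0) hd u v).2 y hy).2.1
    simp only [hT₀, hσ] at a
    simp
    simp at a
    linarith
  rw [hσ', metricTrace_add, metricTrace_smul, metricTrace_smul, metricTrace_add, metricTrace_smul,
    metricTrace_self (h.inv _ hy), metricTrace_dRho, hγ, metricTrace_dRho] at htr
  have hn' : (2 : ℝ) ≤ Module.finrank ℝ E := by exact_mod_cast hn
  -- The trace of the identity above is (1 - n/2)τ - (n/2)τ, where n = dim E and τ is the difference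
  -- of the two traces. Since n ≥ 2, the factor 1 - n is not zero.
  have : (1 - (Module.finrank ℝ E : ℝ)) * τ = 0 := by
    rw [hτdef] at htr ⊢
    linarith
  rcases mul_eq_zero.mp this with h1 | h1
  · linarith
  · exact h1

end Perturbation

end CoordGeom

/-! ### The model family (1 + λρ)²G. -/

namespace CoordGeom

set_option maxSynthPendingDepth 3

variable {E : Type*} [NormedAddCommGroup E] [NormedSpace ℝ E] [FiniteDimensional ℝ E]

section Scaling

variable {G : E → E →L[ℝ] E →L[ℝ] ℝ} {c : ℝ}

/-- The factor does not depend on the point of E, so it cancels between the derivative of the metric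
and its inverse. It is applied on a slice, with the constant (1 + λρ)². -/
theorem christoffel_const_smul (hc : c ≠ 0) {y : E} (hG : DifferentiableAt ℝ G y)
    (hi : (G y).IsInvertible) : christoffel (fun z => c • G z) y = christoffel G y := by
  refine ContinuousLinearMap.ext fun u => ContinuousLinearMap.ext fun v => ?_
  have h1 : christoffelFirst (fun z => c • G z) y u v = c • christoffelFirst G y u v := by
    ext w
    have h : fderiv ℝ (fun z => c • G z) y = c • fderiv ℝ G y :=
      (hG.hasFDerivAt.const_smul c).fderiv
    rw [christoffelFirst_apply, _root_.smul_apply, christoffelFirst_apply, h]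
    simp only [_root_.smul_apply, smul_eq_mul]
    ring
  rw [christoffel_apply, christoffel_apply, inverse_smul hc hi, h1]
  simp [hc]

theorem ricci_const_smul (hc : c ≠ 0) {T : Set E} (hT : IsOpen T) (hG : ContDiffOn ℝ ∞ G T)
    (hi : ∀ y ∈ T, (G y).IsInvertible) {y : E} (hy : y ∈ T) (u v : E) :
    ricci (fun z => c • G z) y u v = ricci G y u v := by
  have h : christoffel (fun z => c • G z) =ᶠ[𝓝 y] christoffel G := by
    filter_upwards [hT.mem_nhds hy] with z hz
    exact christoffel_const_smul hc (differentiableAt_of_contDiffOn hT hG hz) (hi z hz)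
  rw [ricci_eq, ricci_eq, curvature, curvature, h.fderiv_eq, h.eq_of_nhds]

theorem laplacian_const_smul (hc : c ≠ 0) {y : E} (hG : DifferentiableAt ℝ G y)
    (hi : (G y).IsInvertible) (f : E → ℝ) :
    laplacian (fun z => c • G z) f y = c⁻¹ * laplacian G f y := by
  rw [laplacian, metricTrace_smul_left hc hi, laplacian, hessian, hessian,
    christoffel_const_smul hc hG hi]

end Scaling

/-- The family of metrics `(1 + λρ)² G`. -/
def einsteinCoord (G : E → E →L[ℝ] E →L[ℝ] ℝ) (lam : ℝ) (p : E × ℝ) : E →L[ℝ] E →L[ℝ] ℝ :=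
  (1 + lam * p.2) ^ 2 • G p.1

/-- The set on which the family `(1 + λρ)² G` is nondegenerate. -/
def einsteinDomain (T : Set E) (lam : ℝ) : Set (E × ℝ) := {p | p.1 ∈ T ∧ 1 + lam * p.2 ≠ 0}

theorem isOpen_einsteinDomain {T : Set E} (hT : IsOpen T) (lam : ℝ) :
    IsOpen (einsteinDomain T lam) :=
  (hT.preimage continuous_fst).inter
    ((isOpen_ne (x := (0 : ℝ))).preimage (by fun_prop : Continuous fun p : E × ℝ => 1 + lam * p.2))

structure IsMetricOn (G : E → E →L[ℝ] E →L[ℝ] ℝ) (T : Set E) : Prop where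
  isOpen : IsOpen T
  smooth : ContDiffOn ℝ ∞ G T
  symm : ∀ y ∈ T, ∀ u v, G y u v = G y v u
  inv : ∀ y ∈ T, (G y).IsInvertible

namespace IsMetricOn

variable {G : E → E →L[ℝ] E →L[ℝ] ℝ} {T : Set E} (h : IsMetricOn G T) (lam : ℝ)
include h

theorem differentiableAt {y : E} (hy : y ∈ T) : DifferentiableAt ℝ G y :=
  differentiableAt_of_contDiffOn h.isOpen h.smooth hy

theorem isMetricFamily : IsMetricFamily (einsteinCoord G lam) (einsteinDomain T lam) where
  isOpen := isOpen_einsteinDomain h.isOpen lam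
  smooth := by
    have h1 : ContDiffOn ℝ ∞ (fun p : E × ℝ => G p.1) (einsteinDomain T lam) :=
      h.smooth.comp contDiffOn_fst fun p hp => hp.1
    have h2 : ContDiff ℝ ∞ fun p : E × ℝ => (1 + lam * p.2) ^ 2 := by fun_prop
    exact h2.contDiffOn.smul h1
  symm p hp u v := by simp [einsteinCoord, h.symm p.1 hp.1 u v]
  inv p hp := isInvertible_smul (pow_ne_zero 2 hp.2) (h.inv p.1 hp.1)

theorem dRho_einsteinCoord {p : E × ℝ} (hp : p ∈ einsteinDomain T lam) :
    dRho (einsteinCoord G lam) p = (2 * lam * (1 + lam * p.2)) • G p.1 := by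
  rw [← deriv_line (y := p.1) (r := p.2) ((h.isMetricFamily lam).differentiableAt hp)]
  have h1 : HasDerivAt (fun s : ℝ => (1 + lam * s) ^ 2) (2 * lam * (1 + lam * p.2)) p.2 := by
    exact ((((hasDerivAt_id' p.2).const_mul lam).const_add 1).fun_pow 2).congr_deriv
      (by push_cast; ring)
  exact (h1.smul_const (G p.1)).deriv

theorem dRho_dRho_einsteinCoord {p : E × ℝ} (hp : p ∈ einsteinDomain T lam) :
    dRho (dRho (einsteinCoord G lam)) p = (2 * lam ^ 2) • G p.1 := by
  have hF := h.isMetricFamily lam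
  rw [← deriv_line (y := p.1) (r := p.2) (differentiableAt_of_contDiffOn hF.isOpen
    (contDiffOn_dRho hF.isOpen hF.smooth) hp)]
  have h1 : HasDerivAt (fun s : ℝ => 2 * lam * (1 + lam * s)) (2 * lam ^ 2) p.2 := by
    exact (((hasDerivAt_id' p.2).const_mul lam).const_add 1).const_mul (2 * lam)
      |>.congr_deriv (by ring)
  have h2 : (fun s => dRho (einsteinCoord G lam) (p.1, s)) =ᶠ[𝓝 p.2]
      fun s => (2 * lam * (1 + lam * s)) • G p.1 := by
    filter_upwards [line_eventually hF.isOpen (y := p.1) hp] with s hs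
    exact h.dRho_einsteinCoord lam hs
  rw [h2.deriv_eq]
  exact (h1.smul_const (G p.1)).deriv

theorem shape_einsteinCoord {p : E × ℝ} (hp : p ∈ einsteinDomain T lam) :
    shape (einsteinCoord G lam) p = (2 * lam / (1 + lam * p.2)) • ContinuousLinearMap.id ℝ E := by
  have hc := hp.2
  rw [shape, h.dRho_einsteinCoord lam hp, einsteinCoord,
    inverse_smul (pow_ne_zero 2 hp.2) (h.inv _ hp.1)]
  rw [ContinuousLinearMap.comp_smul, ContinuousLinearMap.smul_comp, (h.inv _ hp.1).inverse_comp_self,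
    smul_smul]
  congr 1
  field_simp

theorem traceL_shape_einsteinCoord {p : E × ℝ} (hp : p ∈ einsteinDomain T lam) :
    traceL E (shape (einsteinCoord G lam) p) = 2 * lam / (1 + lam * p.2) * Module.finrank ℝ E := by
  rw [h.shape_einsteinCoord lam hp, map_smul, traceL_id, smul_eq_mul]

theorem sliceChristoffel_einsteinCoord {p : E × ℝ} (hp : p ∈ einsteinDomain T lam) :
    sliceChristoffel (einsteinCoord G lam) p = christoffel G p.1 :=
  christoffel_const_smul (pow_ne_zero 2 hp.2) (h.differentiableAt hp.1) (h.inv _ hp.1)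

theorem fderiv_shape_einsteinCoord {p : E × ℝ} (hp : p ∈ einsteinDomain T lam) (x : E × ℝ) :
    fderiv ℝ (shape (einsteinCoord G lam)) p x =
      (-(2 * lam ^ 2 / (1 + lam * p.2) ^ 2) * x.2) • ContinuousLinearMap.id ℝ E := by
  have hF := h.isMetricFamily lam
  have h1 : HasDerivAt (fun s : ℝ => 2 * lam / (1 + lam * s))
      (-(2 * lam ^ 2 / (1 + lam * p.2) ^ 2)) p.2 := by
    exact ((((hasDerivAt_id' p.2).const_mul lam).const_add 1).fun_inv hp.2).const_mul (2 * lam)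
      |>.congr_deriv (by ring)
  have h2 : HasFDerivAt (fun q : E × ℝ => (2 * lam / (1 + lam * q.2)) • ContinuousLinearMap.id ℝ E)
      _ p := (h1.hasFDerivAt.comp p hasFDerivAt_snd).smul_const (ContinuousLinearMap.id ℝ E)
  have h3 : shape (einsteinCoord G lam) =ᶠ[𝓝 p]
      fun q : E × ℝ => (2 * lam / (1 + lam * q.2)) • ContinuousLinearMap.id ℝ E := by
    filter_upwards [hF.eventually_mem hp] with q hq using h.shape_einsteinCoord lam hq
  rw [h3.fderiv_eq, h2.fderiv]
  simp [mul_comm]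

theorem dRho_sliceChristoffel_einsteinCoord {p : E × ℝ} (hp : p ∈ einsteinDomain T lam) :
    dRho (sliceChristoffel (einsteinCoord G lam)) p = 0 := by
  have hF := h.isMetricFamily lam
  rw [← deriv_line (y := p.1) (r := p.2) (differentiableAt_of_contDiffOn hF.isOpen
    hF.contDiffOn_sliceChristoffel hp)]
  have h2 : (fun s => sliceChristoffel (einsteinCoord G lam) (p.1, s)) =ᶠ[𝓝 p.2]
      fun s => christoffel G p.1 := by
    filter_upwards [line_eventually hF.isOpen (y := p.1) hp] with s hs
    exact h.sliceChristoffel_einsteinCoord lam hs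
  rw [h2.deriv_eq, deriv_const]

/-- The shape operator is 2λ/(1 + λρ) times the identity, and this scalar s solves the Riccati
equation s' = -s²/2, which is the vanishing of the normal component. -/
theorem ricciNormal_einsteinCoord {p : E × ℝ} (hp : p ∈ einsteinDomain T lam) :
    ricciNormal (einsteinCoord G lam) p = 0 := by
  have hc := hp.2
  rw [ricciNormal, dRho, h.fderiv_shape_einsteinCoord lam hp, h.shape_einsteinCoord lam hp]
  simp only [ContinuousLinearMap.smul_comp, ContinuousLinearMap.id_comp, map_smul, traceL_id,
    smul_eq_mul]
  field_simp
  ring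

/-- All terms are multiples of G. Those coming from the ρ-dependence add up to -2(n - 1)λG, where n
= dim E, so the Einstein constant is exactly the one that makes the sum vanish. -/
theorem ricciTangential_einsteinCoord {p : E × ℝ} (hp : p ∈ einsteinDomain T lam) (u v : E)
    (hE : ricci G p.1 u v = 2 * ((Module.finrank ℝ E : ℝ) - 1) * lam * G p.1 u v) :
    ricciTangential (einsteinCoord G lam) u v p = 0 := by
  have hc := hp.2
  have h1 : ricci (fun y => einsteinCoord G lam (y, p.2)) p.1 u v = ricci G p.1 u v :=
    ricci_const_smul (pow_ne_zero 2 hp.2) h.isOpen h.smooth h.inv hp.1 u v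
  rw [ricciTangential, h1, hE, h.dRho_dRho_einsteinCoord lam hp, h.dRho_einsteinCoord lam hp,
    h.traceL_shape_einsteinCoord lam hp, h.shape_einsteinCoord lam hp, einsteinCoord]
  simp only [_root_.smul_apply, ContinuousLinearMap.id_apply, map_smul, smul_eq_mul]
  field_simp
  ring

/-- For the mixed components: the shape operator is a multiple of the identity that does not depend
on y, and the slice symbols do not depend on ρ. What remains is the difference of two equal traces
of Christoffel symbols. -/
theorem ricci_ambientCoord_einsteinCoord {z : ℝ × E × ℝ} (ht : 0 < z.1)
    (hz : z.2 ∈ einsteinDomain T lam)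
    (hE : ∀ u v, ricci G z.2.1 u v = 2 * ((Module.finrank ℝ E : ℝ) - 1) * lam * G z.2.1 u v)
    (u v : ℝ × E × ℝ) :
    ricci (ambientCoord (einsteinCoord G lam)) z u v = 0 := by
  have hF := h.isMetricFamily lam
  have h1 := h.ricciTangential_einsteinCoord lam hz u.2.1 v.2.1 (hE _ _)
  have h2 := h.ricciNormal_einsteinCoord lam hz
  have h3 : ∀ e, evalSnd ((fderiv ℝ (shape (einsteinCoord G lam)) z.2).comp (.inl ℝ E ℝ)) e = 0 := by
    intro e
    refine ContinuousLinearMap.ext fun x => ?_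
    rw [evalSnd_apply, ContinuousLinearMap.comp_apply, h.fderiv_shape_einsteinCoord lam hz]
    simp
  have h4 : fderiv ℝ (shape (einsteinCoord G lam)) z.2 (u.2.1, 0) = 0 := by
    rw [h.fderiv_shape_einsteinCoord lam hz]; simp
  rw [ricci_ambientCoord hF ht hz]
  rw [ricciTangential] at h1
  rw [ricciNormal] at h2
  rw [h1, h2, h3, h3, h4, h.dRho_sliceChristoffel_einsteinCoord lam hz, h.shape_einsteinCoord lam hz]
  have h5 : ∀ e : E, evalSnd (0 : E →L[ℝ] E →L[ℝ] E) e = 0 := fun e => rfl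
  simp only [h5, map_zero, _root_.smul_apply, ContinuousLinearMap.id_apply, evalSnd_smul,
    ContinuousLinearMap.smul_comp, ContinuousLinearMap.comp_smul, ContinuousLinearMap.id_comp,
    ContinuousLinearMap.comp_id, map_smul, smul_eq_mul]
  rw [show traceL E (evalSnd (sliceChristoffel (einsteinCoord G lam) z.2) u.2.1) =
    traceL E (sliceChristoffel (einsteinCoord G lam) z.2 u.2.1) from ?_]
  · ring
  · congr 1
    refine ContinuousLinearMap.ext fun x => ?_
    rw [evalSnd_apply]
    exact hF.sliceChristoffel_symm hz _ _

theorem weightedLaplacian_einsteinCoord {p : E × ℝ} (hp : p ∈ einsteinDomain T lam) (w : ℝ)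
    (f : E × ℝ → ℝ) :
    weightedLaplacian (einsteinCoord G lam) w f p = -2 * p.2 * dRho (dRho f) p
      + (2 * w + Module.finrank ℝ E - 2
        - p.2 * (2 * lam / (1 + lam * p.2) * Module.finrank ℝ E)) * dRho f p
      + ((1 + lam * p.2) ^ 2)⁻¹ * laplacian G (fun y => f (y, p.2)) p.1
      + w / 2 * (2 * lam / (1 + lam * p.2) * Module.finrank ℝ E) * f p := by
  rw [weightedLaplacian, h.traceL_shape_einsteinCoord lam hp]
  congr 2
  exact laplacian_const_smul (pow_ne_zero 2 hp.2) (h.differentiableAt hp.1) (h.inv _ hp.1) _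

end IsMetricOn

/-- This form displays the slice Laplacian through functions that are jointly smooth in (y, ρ), so
orders of vanishing in ρ can be followed through it. -/
theorem IsMetricFamily.laplacian_slice {γ : E × ℝ → E →L[ℝ] E →L[ℝ] ℝ} {Ω : Set (E × ℝ)}
    (h : IsMetricFamily γ Ω) {f : E × ℝ → ℝ} (hf : ContDiffOn ℝ ∞ f Ω) {p : E × ℝ} (hp : p ∈ Ω) :
    laplacian (fun y => γ (y, p.2)) (fun y => f (y, p.2)) p.1 =
      traceL E ((γ p).inverse.comp (dSlice (dSlice f) p -
        (ContinuousLinearMap.compL ℝ E E ℝ (dSlice f p)).comp (sliceChristoffel γ p))) := by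
  rw [laplacian, metricTrace_eq]
  congr 2
  refine ContinuousLinearMap.ext fun u => ContinuousLinearMap.ext fun v => ?_
  rw [hessian_slice h.isOpen hf hp]
  have h1 := fderiv_fderiv_apply_const (f := dSlice f) (y := p) (E := E)
    (differentiableAt_of_contDiffOn h.isOpen (contDiffOn_dSlice h.isOpen hf) hp) (u, 0) v
  have h2 := fderiv_fderiv_apply_const (f := fderiv ℝ f) (y := p)
    (differentiableAt_of_contDiffOn h.isOpen (contDiffOn_fderiv h.isOpen hf) hp) (u, 0) (v, 0)
  exact congrArg₂ _ (h2.symm.trans h1) rfl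

/-- Families of metrics that agree to order `k`, and whose volume forms agree to one order more,
define operators that agree to order `k`. -/
theorem vanishesTo_weightedLaplacian_sub {γ γ₀ : E × ℝ → E →L[ℝ] E →L[ℝ] ℝ} {Ω : Set (E × ℝ)}
    {k : ℕ} (h : IsMetricFamily γ Ω) (h₀ : IsMetricFamily γ₀ Ω)
    (hd : VanishesOn Ω k fun p => γ p - γ₀ p) {y : E} (hy : (y, (0 : ℝ)) ∈ Ω)
    (hτ : VanishesTo k fun r => traceL E (shape γ (y, r)) - traceL E (shape γ₀ (y, r)))
    (w : ℝ) {f : E × ℝ → ℝ} (hf : ContDiffOn ℝ ∞ f Ω) :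
    VanishesTo k fun r => weightedLaplacian γ w f (y, r) - weightedLaplacian γ₀ w f (y, r) := by
  have hf' := contDiffOn_dRho h.isOpen hf
  have hΩ := h.isOpen
  have hK := vanishesOn_inverse_sub h h₀ hd
  have hΓ := vanishesOn_sliceChristoffel_sub h h₀ hd
  have sK₀ : ContDiffOn ℝ ∞ (fun p => (γ₀ p).inverse) Ω := by
    have : CompleteSpace E := FiniteDimensional.complete ℝ E
    exact contDiffOn_inverse h₀.smooth h₀.inv
  have sd := contDiffOn_dSlice hΩ hf
  let B : (E →L[ℝ] ℝ) →L[ℝ] (E →L[ℝ] E →L[ℝ] E) →L[ℝ] (E →L[ℝ] E →L[ℝ] ℝ) :=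
    (ContinuousLinearMap.compL ℝ E (E →L[ℝ] E) (E →L[ℝ] ℝ)).comp
      (ContinuousLinearMap.compL ℝ E E ℝ)
  let H : (E × ℝ → E →L[ℝ] E →L[ℝ] ℝ) → E × ℝ → E →L[ℝ] E →L[ℝ] ℝ := fun γ p =>
    dSlice (dSlice f) p - B (dSlice f p) (sliceChristoffel γ p)
  have sH : ContDiffOn ℝ ∞ (H γ) Ω :=
    (contDiffOn_dSlice hΩ sd).sub ((B.contDiff.comp_contDiffOn sd).clm_apply
      h.contDiffOn_sliceChristoffel)
  have hH : VanishesOn Ω k fun p => H γ₀ p - H γ p := by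
    refine (hΓ.bilin_right B hΩ sd).congr hΩ fun p hp => ?_
    simp only [H, map_sub]
    abel
  let C := ContinuousLinearMap.compL ℝ E (E →L[ℝ] ℝ) E
  -- The slice Laplacian contains no ρ-derivative of the metric, so it inherits the order k.
  have hL : VanishesOn Ω k fun p => laplacian (fun y => γ (y, p.2)) (fun y => f (y, p.2)) p.1 -
      laplacian (fun y => γ₀ (y, p.2)) (fun y => f (y, p.2)) p.1 := by
    refine (((hK.bilin C hΩ sH).clm (traceL E)).sub
      ((hH.bilin_right C hΩ sK₀).clm (traceL E))).congr hΩ fun p hp => ?_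
    rw [h.laplacian_slice hf hp, h₀.laplacian_slice hf hp]
    change traceL E (C (γ p).inverse (H γ p)) - traceL E (C (γ₀ p).inverse (H γ₀ p)) = _
    simp only [map_sub, _root_.sub_apply]
    abel
  have hf1 := contDiffAt_line hΩ hf hy
  have hf2 := contDiffAt_line hΩ hf' hy
  -- The ∂_ρ² term is common to both operators, and the coefficients of ∂_ρf and of f depend on γ
  -- only through τ. Hence agreement of τ to order k prevents the loss of an order.
  have t1 := (hτ.mul (contDiffAt_id.mul hf2)).neg
  have t2 := (hτ.mul (contDiffAt_const (c := w / 2) |>.mul hf1))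
  refine ((t1.add (hL.vanishes y hy)).add t2).congr (Filter.Eventually.of_forall fun r => ?_)
  simp only [weightedLaplacian, id_eq]
  ring

end CoordGeom

/-! ### From manifolds to coordinates: transitions between preferred charts. -/

section ChartCoordinates

variable {V : Type*} [NormedAddCommGroup V] [NormedSpace ℝ V]
  {H : Type*} [TopologicalSpace H] (I : ModelWithCorners ℝ V H)
  {N : Type*} [TopologicalSpace N] [ChartedSpace H N]

/-- The change of coordinates from the preferred chart at `p` to the preferred chart at `q`. -/
def chartTransition (p q : N) (y : V) : V := extChartAt I q ((extChartAt I p).symm y)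

/-- The domain of `chartTransition I p q`. -/
def chartOverlap (p q : N) : Set V :=
  (extChartAt I p).target ∩ (extChartAt I p).symm ⁻¹' (extChartAt I q).source

variable {I}

theorem symm_chartTransition {p q : N} {y : V} (hy : y ∈ chartOverlap I p q) :
    (extChartAt I q).symm (chartTransition I p q y) = (extChartAt I p).symm y :=
  (extChartAt I q).left_inv hy.2

theorem chartTransition_comp {p q : N} (r : N) {y : V} (hy : y ∈ chartOverlap I p q) :
    chartTransition I q r (chartTransition I p q y) = chartTransition I p r y := by
  rw [chartTransition, symm_chartTransition hy, chartTransition]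

theorem chartTransition_mem {p q : N} {y : V} (hy : y ∈ chartOverlap I p q) :
    chartTransition I p q y ∈ chartOverlap I q p := by
  refine ⟨(extChartAt I q).map_source hy.2, ?_⟩
  rw [Set.mem_preimage, symm_chartTransition hy]
  exact (extChartAt I p).map_target hy.1

theorem mem_chartOverlap_self {p : N} {y : V} (hy : y ∈ (extChartAt I p).target) :
    y ∈ chartOverlap I p p := ⟨hy, (extChartAt I p).map_target hy⟩

theorem chartTransition_self {p : N} {y : V} (hy : y ∈ (extChartAt I p).target) :
    chartTransition I p p y = y := (extChartAt I p).right_inv hy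

theorem mem_chartOverlap_center {p : N} {y : V} (hy : y ∈ (extChartAt I p).target) :
    y ∈ chartOverlap I p ((extChartAt I p).symm y) := ⟨hy, mem_extChartAt_source _⟩

theorem extChartAt_mem_chartOverlap {p q : N} (hq : p ∈ (extChartAt I q).source) :
    extChartAt I p p ∈ chartOverlap I p q :=
  ⟨mem_extChartAt_target p, by rw [Set.mem_preimage, extChartAt_to_inv]; exact hq⟩

theorem chartTransition_extChartAt (p q : N) :
    chartTransition I p q (extChartAt I p p) = extChartAt I q p := by
  rw [chartTransition, extChartAt_to_inv]

variable [I.Boundaryless]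

theorem isOpen_target_inter {U : Set N} (hU : IsOpen U) (p : N) :
    IsOpen ((extChartAt I p).target ∩ (extChartAt I p).symm ⁻¹' U) :=
  (continuousOn_extChartAt_symm p).isOpen_inter_preimage (isOpen_extChartAt_target p) hU

theorem isOpen_chartOverlap (p q : N) : IsOpen (chartOverlap I p q) :=
  isOpen_target_inter (isOpen_extChartAt_source q) p

variable [IsManifold I ∞ N]

theorem contDiffOn_chartTransition (p q : N) :
    ContDiffOn ℝ ∞ (chartTransition I p q) (chartOverlap I p q) := by
  have := contDiffOn_ext_coord_change (I := I) (n := ∞) q p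
  rw [PartialEquiv.trans_source] at this
  exact this

theorem contDiffAt_chartTransition {p q : N} {y : V} (hy : y ∈ chartOverlap I p q) :
    ContDiffAt ℝ ∞ (chartTransition I p q) y :=
  (contDiffOn_chartTransition p q).contDiffAt ((isOpen_chartOverlap p q).mem_nhds hy)

/-- The chain rule for the cocycle of chart transitions; taking r = p yields that their derivatives
are invertible. -/
theorem fderiv_chartTransition_comp {p q r : N} {y : V} (hy : y ∈ chartOverlap I p q)
    (hr : (extChartAt I p).symm y ∈ (extChartAt I r).source) :
    (fderiv ℝ (chartTransition I q r) (chartTransition I p q y)).comp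
      (fderiv ℝ (chartTransition I p q) y) = fderiv ℝ (chartTransition I p r) y := by
  have h1 := (contDiffAt_chartTransition hy).differentiableAt (by simp)
  have h2 : chartTransition I p q y ∈ chartOverlap I q r :=
    ⟨(chartTransition_mem hy).1, by rw [Set.mem_preimage, symm_chartTransition hy]; exact hr⟩
  have h3 := (contDiffAt_chartTransition h2).differentiableAt (by simp)
  rw [← fderiv_comp y h3 h1]
  refine Filter.EventuallyEq.fderiv_eq ?_
  filter_upwards [(isOpen_chartOverlap p q).mem_nhds hy] with z hz
  exact chartTransition_comp r hz

theorem fderiv_chartTransition_self {p : N} {y : V} (hy : y ∈ (extChartAt I p).target) :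
    fderiv ℝ (chartTransition I p p) y = ContinuousLinearMap.id ℝ V := by
  have : chartTransition I p p =ᶠ[𝓝 y] id := by
    filter_upwards [extChartAt_target_mem_nhds' hy] with z hz using chartTransition_self hz
  rw [this.fderiv_eq, fderiv_id]

/-- The derivative of the change of coordinates as an isomorphism. -/
theorem exists_fderiv_chartTransition_eq {p q : N} {y : V} (hy : y ∈ chartOverlap I p q) :
    ∃ A : V ≃L[ℝ] V, (A : V →L[ℝ] V) = fderiv ℝ (chartTransition I p q) y := by
  have h1 := fderiv_chartTransition_comp hy ((extChartAt I p).map_target hy.1)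
  have hy' := chartTransition_mem hy
  have h2 := fderiv_chartTransition_comp hy' ((extChartAt I q).map_target hy'.1)
  rw [fderiv_chartTransition_self hy.1] at h1
  rw [fderiv_chartTransition_self hy'.1, chartTransition_comp p hy, chartTransition_self hy.1] at h2
  exact ⟨.equivOfInverse _ _ (fun v => congrArg (fun A => A v) h1) fun v => congrArg (fun A => A v) h2, rfl⟩

/-- The tangent space at a point is identified with V through the preferred chart there. So the
derivative of the inverse of the chart at p, taken at y, is that of the transition to the chart
preferred at the image of y. -/
theorem mfderiv_extChartAt_symm {p : N} {y : V} (hy : y ∈ (extChartAt I p).target) :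
    (mfderiv 𝓘(ℝ, V) I (extChartAt I p).symm y : V →L[ℝ] V) =
      fderiv ℝ (chartTransition I p ((extChartAt I p).symm y)) y := by
  have : IsManifold I 1 N := .of_le (n := ∞) (by simp)
  have h := mdifferentiableWithinAt_extChartAt_symm (I := I) hy
  rw [I.range_eq_univ, mdifferentiableWithinAt_univ] at h
  refine h.mfderiv.trans ?_
  change fderivWithin ℝ (chartTransition I p ((extChartAt I p).symm y)) (Set.range 𝓘(ℝ, V)) y = _
  rw [ModelWithCorners.range_eq_univ, fderivWithin_univ]

theorem mfderiv_extChartAt_self' (p : N) :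
    (mfderiv I 𝓘(ℝ, V) (extChartAt I p) p : V →L[ℝ] V) = ContinuousLinearMap.id ℝ V := by
  have : IsManifold I 1 N := .of_le (n := ∞) (by simp)
  exact mfderiv_extChartAt_self

variable (h : TwoTensor I N)

/-- The value of a two-tensor at a point, as a form on the model space. -/
def TwoTensor.form (h : TwoTensor I N) (x : N) : V →L[ℝ] V →L[ℝ] ℝ := h x

theorem coord_eq {p : N} {y : V} (hy : y ∈ (extChartAt I p).target) :
    h.coord I p y = (h.form ((extChartAt I p).symm y)).bilinearComp
      (fderiv ℝ (chartTransition I p ((extChartAt I p).symm y)) y)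
      (fderiv ℝ (chartTransition I p ((extChartAt I p).symm y)) y) := by
  rw [← mfderiv_extChartAt_symm hy]
  rfl

theorem coord_self (p : N) : h.coord I p (extChartAt I p p) = (h.form p) := by
  rw [coord_eq h (mem_extChartAt_target p)]
  -- Stated for a variable point, so that the substitution replaces the point in the form and in the
  -- chart transition simultaneously.
  have key : ∀ q : N, q = p → (h.form q).bilinearComp
      (fderiv ℝ (chartTransition I p q) (extChartAt I p p))
      (fderiv ℝ (chartTransition I p q) (extChartAt I p p)) = (h.form p) := by
    rintro q rfl
    rw [fderiv_chartTransition_self (mem_extChartAt_target q)]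
    rfl
  exact key _ (extChartAt_to_inv p)

theorem coord_chartTransition {p q : N} {y : V} (hy : y ∈ chartOverlap I p q) :
    h.coord I p y = (h.coord I q (chartTransition I p q y)).bilinearComp
      (fderiv ℝ (chartTransition I p q) y) (fderiv ℝ (chartTransition I p q) y) := by
  rw [coord_eq h hy.1, coord_eq h (chartTransition_mem hy).1]
  have key : ∀ x : N, x = (extChartAt I p).symm y →
      (h.form ((extChartAt I p).symm y)).bilinearComp
      (fderiv ℝ (chartTransition I p ((extChartAt I p).symm y)) y)
      (fderiv ℝ (chartTransition I p ((extChartAt I p).symm y)) y) =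
      ((h.form x).bilinearComp
      (fderiv ℝ (chartTransition I q x) (chartTransition I p q y))
      (fderiv ℝ (chartTransition I q x) (chartTransition I p q y))).bilinearComp
      (fderiv ℝ (chartTransition I p q) y) (fderiv ℝ (chartTransition I p q) y) := by
    rintro x rfl
    rw [← fderiv_chartTransition_comp hy (mem_extChartAt_source _)]
    rfl
  exact key _ (symm_chartTransition hy)

/-- `f` is smooth on `U` in the preferred charts. -/
def SmoothFnOn (I : ModelWithCorners ℝ V H) (U : Set N) (f : N → ℝ) : Prop :=
  ∀ p : N, ContDiffOn ℝ ∞ (f ∘ (extChartAt I p).symm)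
    ((extChartAt I p).target ∩ (extChartAt I p).symm ⁻¹' U)

theorem ContMDiffOn.smoothFnOn {U : Set N} {f : N → ℝ} (hf : ContMDiffOn I 𝓘(ℝ, ℝ) ∞ f U) :
    SmoothFnOn I U f := fun p => by
  rw [← contMDiffOn_iff_contDiffOn]
  exact hf.comp ((contMDiffOn_extChartAt_symm p).mono Set.inter_subset_left) fun y hy => hy.2

/-- A smooth, symmetric, nondegenerate tensor. -/
structure IsNondegenerateMetricOn (h : TwoTensor I N) (U : Set N) : Prop where
  isOpen : IsOpen U
  smooth : h.SmoothOn I U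
  symm : ∀ z ∈ U, ∀ u v : TangentSpace I z, h z u v = h z v u
  inv : ∀ z ∈ U, (h.form z).IsInvertible

namespace IsNondegenerateMetricOn

variable [FiniteDimensional ℝ V] {h} {U : Set N} (hh : IsNondegenerateMetricOn h U)
include hh

theorem isMetricOn_coord (p : N) : CoordGeom.IsMetricOn (h.coord I p)
    ((extChartAt I p).target ∩ (extChartAt I p).symm ⁻¹' U) where
  isOpen := isOpen_target_inter hh.isOpen p
  smooth := hh.smooth p
  symm y hy u v := by
    rw [coord_eq h hy.1]
    exact hh.symm _ hy.2 _ _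
  inv y hy := by
    obtain ⟨A, hA⟩ := exists_fderiv_chartTransition_eq (mem_chartOverlap_center hy.1)
    rw [coord_eq h hy.1, ← hA]
    exact (CoordGeom.isInvertible_bilinearComp (hh.inv _ hy.2) A).1

/-- The definition uses a different chart at each point. Invariance under changes of coordinates
lets a single chart serve a whole neighbourhood, which is needed to differentiate or iterate the
Laplacian. -/
theorem laplacian_eq {f : N → ℝ} (hf : SmoothFnOn I U f) {x p : N} (hx : x ∈ U)
    (hp : x ∈ (extChartAt I p).source) :
    laplacian I h f x =
      CoordGeom.laplacian (h.coord I p) (f ∘ (extChartAt I p).symm) (extChartAt I p x) := by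
  have hm := hh.isMetricOn_coord p
  have hy := extChartAt_mem_chartOverlap hp
  have hy' : extChartAt I p x ∈ (extChartAt I p).target ∩ (extChartAt I p).symm ⁻¹' U :=
    ⟨(extChartAt I p).map_source hp, by
      rw [Set.mem_preimage, (extChartAt I p).left_inv hp]; exact hx⟩
  obtain ⟨A, hA⟩ := exists_fderiv_chartTransition_eq hy
  rw [laplacian]
  have e : chartTransition I x p (extChartAt I x x) = extChartAt I p x :=
    chartTransition_extChartAt x p
  rw [← e] at hy' ⊢
  refine CoordGeom.laplacian_pullback (hm.differentiableAt hy') (hm.symm _ hy') (hm.inv _ hy')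
    ((contDiffAt_chartTransition hy).of_le ENat.LEInfty.out) A hA ?_ ?_ ?_
  · filter_upwards [(isOpen_chartOverlap x p).mem_nhds hy] with z hz
    exact coord_chartTransition h hz
  · exact ((hf p).contDiffAt (hm.isOpen.mem_nhds hy')).of_le ENat.LEInfty.out
  · filter_upwards [(isOpen_chartOverlap x p).mem_nhds hy] with z hz
    simp only [Function.comp_apply]
    rw [symm_chartTransition hz]

theorem laplacian_comp_symm {f : N → ℝ} (hf : SmoothFnOn I U f) {p : N} {y : V}
    (hy : y ∈ (extChartAt I p).target ∩ (extChartAt I p).symm ⁻¹' U) :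
    laplacian I h f ((extChartAt I p).symm y) =
      CoordGeom.laplacian (h.coord I p) (f ∘ (extChartAt I p).symm) y := by
  rw [hh.laplacian_eq hf hy.2 ((extChartAt I p).map_target hy.1), (extChartAt I p).right_inv hy.1]

theorem smoothFnOn_laplacian {f : N → ℝ} (hf : SmoothFnOn I U f) :
    SmoothFnOn I U (laplacian I h f) := fun p => by
  have hm := hh.isMetricOn_coord p
  exact (CoordGeom.contDiffOn_laplacian hm.isOpen hm.smooth hm.inv (hf p)).congr fun y hy =>
    hh.laplacian_comp_symm hf hy

end IsNondegenerateMetricOn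

theorem ricci_eq_coord (p : N) (u v : V) :
    ricci I h p u v = CoordGeom.ricci (h.coord I p) (extChartAt I p p) u v := by
  have := mfderiv_extChartAt_self' (I := I) p
  exact congrArg₂ (CoordGeom.ricci (h.coord I p) (extChartAt I p p))
    (congrArg (fun A => A u) this) (congrArg (fun A => A v) this)

end ChartCoordinates

/-! ### Nondegeneracy from the signature. -/

section Signature

variable {V : Type*} [NormedAddCommGroup V] [NormedSpace ℝ V] [FiniteDimensional ℝ V]

theorem HasSignature.isInvertible {B : V →L[ℝ] V →L[ℝ] ℝ} {p q : ℕ} (h : HasSignature B p q)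
    (hs : ∀ u v, B u v = B v u) : B.IsInvertible := by
  obtain ⟨P, Q, hPQ, -, -, hP, hQ⟩ := h
  refine CoordGeom.isInvertible_of_injective fun v hv => ?_
  obtain ⟨a, ha, b, hb, rfl⟩ : ∃ a ∈ P, ∃ b ∈ Q, a + b = v := by
    have := hPQ.sup_eq_top ▸ Submodule.mem_top (x := v) (R := ℝ)
    exact Submodule.mem_sup.mp this
  -- For v = a + b in the kernel, 0 = B(a + b, a - b) = B(a, a) - B(b, b), and both summands are
  -- positive unless a and b vanish.
  have h1 := hv (a - b)
  simp only [map_add, map_sub, _root_.add_apply] at h1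
  rw [hs b a] at h1
  have ha0 : a = 0 := by
    by_contra hne
    have := hP a ha hne
    rcases eq_or_ne b 0 with rfl | hb0
    · simp at h1; linarith
    · have := hQ b hb hb0; linarith
  subst ha0
  have hb0 : b = 0 := by
    by_contra hne
    have := hQ b hb hne
    simp at h1; linarith
  simp [hb0]

variable {H : Type*} [TopologicalSpace H] {I : ModelWithCorners ℝ V H}
  {N : Type*} [TopologicalSpace N] [ChartedSpace H N]

theorem IsPseudoRiemannianOn.isNondegenerateMetricOn [I.Boundaryless] [IsManifold I ∞ N]
    {h : TwoTensor I N} {U : Set N} {p q : ℕ} (hh : IsPseudoRiemannianOn I h U p q)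
    (hU : IsOpen U) : IsNondegenerateMetricOn h U where
  isOpen := hU
  smooth := hh.smooth
  symm := hh.symm
  inv z hz := (hh.signature z hz).isInvertible (hh.symm z hz)

end Signature

/-! ### Dependence on germs, and linearity of the Laplacian. -/

namespace CoordGeom

variable {V : Type*} [NormedAddCommGroup V] [NormedSpace ℝ V]
  {G G' : V → V →L[ℝ] V →L[ℝ] ℝ} {f f' : V → ℝ} {y : V}

theorem christoffel_congr (hG : G =ᶠ[𝓝 y] G') : christoffel G y = christoffel G' y := by
  rw [christoffel, christoffel, christoffelFirst, christoffelFirst, hG.fderiv_eq, hG.eq_of_nhds]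

theorem laplacian_congr (hG : G =ᶠ[𝓝 y] G') (hf : f =ᶠ[𝓝 y] f') :
    laplacian G f y = laplacian G' f' y := by
  rw [laplacian, laplacian, hessian, hessian, christoffel_congr hG, hf.fderiv.fderiv_eq,
    hf.fderiv_eq, hG.eq_of_nhds]

theorem ricci_congr (hG : G =ᶠ[𝓝 y] G') (u v : V) : ricci G y u v = ricci G' y u v := by
  have h : christoffel G =ᶠ[𝓝 y] christoffel G' :=
    hG.eventuallyEq_nhds.mono fun z hz => christoffel_congr hz
  rw [ricci, ricci, curvature, curvature, h.fderiv_eq, h.eq_of_nhds]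

theorem hessian_add (hf : ContDiffAt ℝ 2 f y) (hf' : ContDiffAt ℝ 2 f' y) :
    hessian G (f + f') y = hessian G f y + hessian G f' y := by
  have h1 : fderiv ℝ (f + f') =ᶠ[𝓝 y] fderiv ℝ f + fderiv ℝ f' := by
    filter_upwards [hf.eventually (by simp), hf'.eventually (by simp)] with z hz hz'
    exact fderiv_add (hz.differentiableAt (by simp)) (hz'.differentiableAt (by simp))
  rw [hessian, hessian, hessian, h1.fderiv_eq, h1.eq_of_nhds,
    fderiv_add ((hf.fderiv_right (m := 1) (by norm_num)).differentiableAt (by simp))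
      ((hf'.fderiv_right (m := 1) (by norm_num)).differentiableAt (by simp))]
  simp only [Pi.add_apply, map_add, ContinuousLinearMap.add_comp]
  abel

theorem laplacian_add (hf : ContDiffAt ℝ 2 f y) (hf' : ContDiffAt ℝ 2 f' y) :
    laplacian G (f + f') y = laplacian G f y + laplacian G f' y := by
  rw [laplacian, hessian_add hf hf', metricTrace_add, laplacian, laplacian]

theorem laplacian_const_mul (c : ℝ) (hf : ContDiffAt ℝ 2 f y) :
    laplacian G (fun z => c * f z) y = c * laplacian G f y := by
  have h1 : fderiv ℝ (fun z => c * f z) =ᶠ[𝓝 y] fun z => c • fderiv ℝ f z := by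
    filter_upwards [hf.eventually (by simp)] with z hz
    exact fderiv_const_mul (hz.differentiableAt (by simp)) c
  have h2 : fderiv ℝ (fun z => c • fderiv ℝ f z) y = c • fderiv ℝ (fderiv ℝ f) y :=
    (((hf.fderiv_right (m := 1) (by norm_num)).differentiableAt (by simp)).hasFDerivAt.const_smul
      c).fderiv
  have h3 : hessian G (fun z => c * f z) y = c • hessian G f y := by
    refine ContinuousLinearMap.ext fun u => ContinuousLinearMap.ext fun v => ?_
    rw [hessian_apply, h1.fderiv_eq, h1.eq_of_nhds, h2]
    simp only [_root_.smul_apply, hessian_apply, smul_eq_mul]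
    ring
  rw [laplacian, h3, metricTrace_smul, laplacian]

end CoordGeom

/-! ### The ambient metric in the charts of ℝ × M × ℝ, and reduction to t = 1. -/

section AmbientCharts

variable {n : ℕ} {M : Type*} [TopologicalSpace M] [ChartedSpace (EuclideanSpace ℝ (Fin n)) M]

theorem extChartAt_ambientModel (z : ℝ × M × ℝ) :
    extChartAt (ambientModel n) z = (PartialEquiv.refl ℝ).prod
      ((extChartAt (𝓡 n) z.2.1).prod (PartialEquiv.refl ℝ)) := by
  rw [extChartAt_prod, extChartAt_prod, extChartAt_model_space_eq_id, extChartAt_model_space_eq_id]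

theorem extChartAt_ambientModel_apply (z z' : ℝ × M × ℝ) :
    extChartAt (ambientModel n) z z' = (z'.1, extChartAt (𝓡 n) z.2.1 z'.2.1, z'.2.2) := by
  rw [extChartAt_ambientModel]; rfl

theorem extChartAt_ambientModel_symm_apply (z : ℝ × M × ℝ)
    (y : ℝ × EuclideanSpace ℝ (Fin n) × ℝ) :
    (extChartAt (ambientModel n) z).symm y =
      (y.1, (extChartAt (𝓡 n) z.2.1).symm y.2.1, y.2.2) := by
  rw [extChartAt_ambientModel]; rfl

theorem mem_extChartAt_ambientModel_target (z : ℝ × M × ℝ)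
    (y : ℝ × EuclideanSpace ℝ (Fin n) × ℝ) :
    y ∈ (extChartAt (ambientModel n) z).target ↔ y.2.1 ∈ (extChartAt (𝓡 n) z.2.1).target := by
  rw [extChartAt_ambientModel]; simp [PartialEquiv.prod_target]

theorem mem_extChartAt_ambientModel_source (z z' : ℝ × M × ℝ) :
    z' ∈ (extChartAt (ambientModel n) z).source ↔ z'.2.1 ∈ (extChartAt (𝓡 n) z.2.1).source := by
  rw [extChartAt_ambientModel]; simp [PartialEquiv.prod_source]

theorem chartTransition_ambientModel (z z' : ℝ × M × ℝ)
    (y : ℝ × EuclideanSpace ℝ (Fin n) × ℝ) :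
    chartTransition (ambientModel n) z z' y =
      (y.1, chartTransition (𝓡 n) z.2.1 z'.2.1 y.2.1, y.2.2) := by
  rw [chartTransition, extChartAt_ambientModel_symm_apply, extChartAt_ambientModel_apply]
  rfl

variable [IsManifold (𝓡 n) ∞ M]

theorem fderiv_chartTransition_ambientModel {z z' : ℝ × M × ℝ}
    {y : ℝ × EuclideanSpace ℝ (Fin n) × ℝ} (hy : y.2.1 ∈ chartOverlap (𝓡 n) z.2.1 z'.2.1)
    (v : ℝ × EuclideanSpace ℝ (Fin n) × ℝ) :
    fderiv ℝ (chartTransition (ambientModel n) z z') y v =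
      (v.1, fderiv ℝ (chartTransition (𝓡 n) z.2.1 z'.2.1) y.2.1 v.2.1, v.2.2) := by
  let pt : (ℝ × EuclideanSpace ℝ (Fin n) × ℝ) →L[ℝ] ℝ := .fst ℝ ℝ _
  let pE : (ℝ × EuclideanSpace ℝ (Fin n) × ℝ) →L[ℝ] EuclideanSpace ℝ (Fin n) :=
    (ContinuousLinearMap.fst ℝ _ ℝ).comp (.snd ℝ ℝ _)
  let pr : (ℝ × EuclideanSpace ℝ (Fin n) × ℝ) →L[ℝ] ℝ :=
    (ContinuousLinearMap.snd ℝ _ ℝ).comp (.snd ℝ ℝ _)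
  have h1 := ((contDiffAt_chartTransition hy).differentiableAt (by simp)).hasFDerivAt
  have h2 := (pt.hasFDerivAt (x := y)).prodMk ((HasFDerivAt.comp (f := pE) y h1
    pE.hasFDerivAt).prodMk (pr.hasFDerivAt (x := y)))
  have h3 : chartTransition (ambientModel n) z z' = fun y =>
    (pt y, (chartTransition (𝓡 n) z.2.1 z'.2.1 ∘ pE) y, pr y) :=
    funext (chartTransition_ambientModel z z')
  rw [h3, h2.fderiv]
  rfl

/-- The coefficients of the family `γ` in the preferred chart at `x`. -/
def familyCoord (γ : ℝ → TwoTensor (𝓡 n) M) (x : M) (p : EuclideanSpace ℝ (Fin n) × ℝ) :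
    EuclideanSpace ℝ (Fin n) →L[ℝ] EuclideanSpace ℝ (Fin n) →L[ℝ] ℝ :=
  (γ p.2).coord (𝓡 n) x p.1

theorem straightNormal_form_apply (γ : ℝ → TwoTensor (𝓡 n) M) (z : ℝ × M × ℝ)
    (u v : ℝ × EuclideanSpace ℝ (Fin n) × ℝ) :
    (straightNormal γ).form z u v = 2 * z.2.2 * (u.1 * v.1) + z.1 * (u.1 * v.2.2 + u.2.2 * v.1)
      + z.1 ^ 2 * (γ z.2.2).form z.2.1 u.2.1 v.2.1 :=
  CoordGeom.ambientCoord_apply (fun _ => (γ z.2.2).form z.2.1) (z.1, 0, z.2.2) u v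

/-- Chart transitions of ℝ × M × ℝ act on the factor M alone, so the coefficients keep the straight
and normal shape. -/
theorem coord_straightNormal (γ : ℝ → TwoTensor (𝓡 n) M) (z : ℝ × M × ℝ)
    {y : ℝ × EuclideanSpace ℝ (Fin n) × ℝ} (hy : y.2.1 ∈ (extChartAt (𝓡 n) z.2.1).target) :
    (straightNormal γ).coord (ambientModel n) z y =
      CoordGeom.ambientCoord (familyCoord γ z.2.1) y := by
  have hy' := (mem_extChartAt_ambientModel_target z y).2 hy
  refine ContinuousLinearMap.ext fun u => ContinuousLinearMap.ext fun v => ?_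
  have key : ∀ z' : ℝ × M × ℝ, z' = (y.1, (extChartAt (𝓡 n) z.2.1).symm y.2.1, y.2.2) →
      (straightNormal γ).form z' (fderiv ℝ (chartTransition (ambientModel n) z z') y u)
        (fderiv ℝ (chartTransition (ambientModel n) z z') y v) =
        CoordGeom.ambientCoord (familyCoord γ z.2.1) y u v := by
    rintro z' rfl
    have hd := fderiv_chartTransition_ambientModel (z := z)
      (z' := (y.1, (extChartAt (𝓡 n) z.2.1).symm y.2.1, y.2.2)) (y := y)
      (mem_chartOverlap_center hy)
    rw [hd, hd, straightNormal_form_apply,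
      CoordGeom.ambientCoord_apply, familyCoord, coord_eq _ hy,
      ContinuousLinearMap.bilinearComp_apply]
  rw [coord_eq _ hy', ContinuousLinearMap.bilinearComp_apply]
  exact key _ (extChartAt_ambientModel_symm_apply z y)

/-- Two-tensors on `ℝ × M × ℝ` in the chart at `x`, along `{(t, x, r)}`. -/
theorem coord_ambientModel_center (h : TwoTensor (ambientModel n) (ℝ × M × ℝ)) (t r : ℝ) (x : M)
    (t₀ r₀ : ℝ) :
    h.coord (ambientModel n) (t₀, x, r₀) (t, extChartAt (𝓡 n) x x, r) = h.form (t, x, r) := by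
  have hy := (mem_extChartAt_ambientModel_target (n := n) (t₀, x, r₀)
    (t, extChartAt (𝓡 n) x x, r)).2 (mem_extChartAt_target x)
  rw [coord_eq _ hy]
  have key : ∀ z : ℝ × M × ℝ, z = (t, x, r) → (h.form z).bilinearComp
      (fderiv ℝ (chartTransition (ambientModel n) (t₀, x, r₀) z) (t, extChartAt (𝓡 n) x x, r))
      (fderiv ℝ (chartTransition (ambientModel n) (t₀, x, r₀) z) (t, extChartAt (𝓡 n) x x, r)) =
      h.form (t, x, r) := by
    rintro z rfl
    have h1 : fderiv ℝ (chartTransition (ambientModel n) ((t₀, x, r₀) : ℝ × M × ℝ)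
        ((t, x, r) : ℝ × M × ℝ)) (t, extChartAt (𝓡 n) x x, r) = ContinuousLinearMap.id ℝ _ := by
      refine ContinuousLinearMap.ext fun v => ?_
      refine (fderiv_chartTransition_ambientModel (z := (t₀, x, r₀)) (z' := (t, x, r))
        (y := (t, extChartAt (𝓡 n) x x, r))
        (mem_chartOverlap_self (mem_extChartAt_target x)) v).trans ?_
      rw [fderiv_chartTransition_self (mem_extChartAt_target x)]
      rfl
    rw [h1]
    rfl
  refine key _ ?_
  rw [extChartAt_ambientModel_symm_apply]
  simp

/-- A conical open set containing `{ρ = 0}` on which `straightNormal γ` is a metric. -/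
structure IsStraightMetric (γ : ℝ → TwoTensor (𝓡 n) M) (W : Set (ℝ × M × ℝ)) : Prop where
  metric : IsNondegenerateMetricOn (straightNormal γ) W
  pos : ∀ z ∈ W, 0 < z.1
  cone_mem : ∀ (t : ℝ) (x : M), 0 < t → (t, x, (0 : ℝ)) ∈ W
  dilation_mem : ∀ s : ℝ, 0 < s → ∀ z ∈ W, dilation M s z ∈ W

/-- The set of the `(y, ρ)` that are represented by points of `W` in the chart at `x`. -/
def chartDomain (W : Set (ℝ × M × ℝ)) (x : M) : Set (EuclideanSpace ℝ (Fin n) × ℝ) :=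
  {p | p.1 ∈ (extChartAt (𝓡 n) x).target ∧ (1, (extChartAt (𝓡 n) x).symm p.1, p.2) ∈ W}

/-- The function `f(1, x, ρ)` in the chart at `x`. -/
def profile (f : ℝ × M × ℝ → ℝ) (x : M) (p : EuclideanSpace ℝ (Fin n) × ℝ) : ℝ :=
  f (1, (extChartAt (𝓡 n) x).symm p.1, p.2)

/-- `f` is smooth and homogeneous of degree `w` on `W`. -/
structure IsHomogeneousOn (W : Set (ℝ × M × ℝ)) (w : ℝ) (f : ℝ × M × ℝ → ℝ) : Prop where
  smooth : SmoothFnOn (ambientModel n) W f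
  homogeneous : ∀ z ∈ W, f z = z.1 ^ w * f (1, z.2)

theorem mem_target_inter_iff {W : Set (ℝ × M × ℝ)} (z : ℝ × M × ℝ)
    (p : EuclideanSpace ℝ (Fin n) × ℝ) :
    (1, p) ∈ (extChartAt (ambientModel n) z).target ∩
      (extChartAt (ambientModel n) z).symm ⁻¹' W ↔ p ∈ chartDomain W z.2.1 := by
  rw [Set.mem_inter_iff, mem_extChartAt_ambientModel_target, Set.mem_preimage,
    extChartAt_ambientModel_symm_apply]
  rfl

theorem contDiffOn_profile {W : Set (ℝ × M × ℝ)} {f : ℝ × M × ℝ → ℝ}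
    (hf : SmoothFnOn (ambientModel n) W f) (x : M) :
    ContDiffOn ℝ ∞ (profile (n := n) f x) (chartDomain W x) := by
  have h1 : ContDiffOn ℝ ∞ (fun p : EuclideanSpace ℝ (Fin n) × ℝ => ((1 : ℝ), p))
    (chartDomain W x) := by fun_prop
  refine ((hf ((1 : ℝ), x, (0 : ℝ))).comp h1 fun p hp => (mem_target_inter_iff ((1 : ℝ), x, (0 : ℝ)) p).2 hp).congr
    fun p _ => ?_
  simp only [Function.comp_apply]
  rw [extChartAt_ambientModel_symm_apply]
  rfl

namespace IsStraightMetric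

variable {γ : ℝ → TwoTensor (𝓡 n) M} {W : Set (ℝ × M × ℝ)} (h : IsStraightMetric γ W)
include h

theorem mem_iff {z : ℝ × M × ℝ} (hz : 0 < z.1) : z ∈ W ↔ (1, z.2) ∈ W := by
  constructor
  · intro hW
    have := h.dilation_mem z.1⁻¹ (inv_pos.2 hz) z hW
    rwa [dilation, inv_mul_cancel₀ hz.ne'] at this
  · intro hW
    have := h.dilation_mem z.1 hz _ hW
    rwa [dilation, mul_one] at this

theorem isOpen_chartDomain (x : M) : IsOpen (chartDomain (n := n) W x) := by
  have h1 := isOpen_target_inter (I := ambientModel n) h.metric.isOpen ((1 : ℝ), x, (0 : ℝ))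
  have h2 : Continuous fun p : EuclideanSpace ℝ (Fin n) × ℝ => ((1 : ℝ), p) := by fun_prop
  convert h1.preimage h2 using 1
  ext p
  exact (mem_target_inter_iff ((1 : ℝ), x, (0 : ℝ)) p).symm

theorem zero_mem_chartDomain {x : M} {y : EuclideanSpace ℝ (Fin n)}
    (hy : y ∈ (extChartAt (𝓡 n) x).target) : (y, (0 : ℝ)) ∈ chartDomain W x :=
  ⟨hy, h.cone_mem _ _ one_pos⟩

/-- The family γ is the E block of the ambient metric at t = 1 and inherits its smoothness and
symmetry. A vector in the kernel of γ, extended by zero, lies in the kernel of the ambient metric,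
so nondegeneracy passes down too. -/
theorem isMetricFamily (x : M) :
    CoordGeom.IsMetricFamily (familyCoord γ x) (chartDomain W x) := by
  have hm := h.metric.isMetricOn_coord ((1 : ℝ), x, (0 : ℝ))
  have hmem : ∀ p ∈ chartDomain W x, (1, p) ∈ (extChartAt (ambientModel n) ((1 : ℝ), x, (0 : ℝ))).target ∩
      (extChartAt (ambientModel n) ((1 : ℝ), x, (0 : ℝ))).symm ⁻¹' W :=
    fun p hp => (mem_target_inter_iff ((1 : ℝ), x, (0 : ℝ)) p).2 hp
  let i : EuclideanSpace ℝ (Fin n) →L[ℝ] ℝ × EuclideanSpace ℝ (Fin n) × ℝ :=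
    (ContinuousLinearMap.inr ℝ ℝ (EuclideanSpace ℝ (Fin n) × ℝ)).comp (.inl ℝ _ ℝ)
  have hfam : ∀ p ∈ chartDomain W x, ∀ u v, familyCoord γ x p u v =
      (straightNormal γ).coord (ambientModel n) ((1 : ℝ), x, (0 : ℝ)) (1, p) (i u) (i v) := by
    intro p hp u v
    rw [coord_straightNormal γ ((1 : ℝ), x, (0 : ℝ)) hp.1, CoordGeom.ambientCoord_apply]
    simp [i]
  refine ⟨h.isOpen_chartDomain x, ?_, fun p hp u v => ?_, fun p hp => ?_⟩
  · have h1 : ContDiffOn ℝ ∞ (fun p : EuclideanSpace ℝ (Fin n) × ℝ => ((1 : ℝ), p))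
      (chartDomain W x) := by fun_prop
    refine ((CoordGeom.contDiff_bilinearComp i).comp_contDiffOn
      (hm.smooth.comp h1 hmem)).congr fun p hp => ?_
    exact ContinuousLinearMap.ext fun u => ContinuousLinearMap.ext fun v => hfam p hp u v
  · rw [hfam p hp, hfam p hp, hm.symm _ (hmem p hp)]
  · refine CoordGeom.isInvertible_of_injective fun u hu => ?_
    have : i u = 0 := by
      refine (hm.inv _ (hmem p hp)).injective ?_
      rw [map_zero, coord_straightNormal γ ((1 : ℝ), x, (0 : ℝ)) hp.1]
      refine ContinuousLinearMap.ext fun v => ?_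
      rw [CoordGeom.ambientCoord_apply]
      simp [i, hu]
    exact congrArg (fun z => z.2.1) this

/-- In the chart, f is t^w times its profile, so the coordinate formula for homogeneous functions
applies. Any chart of M around the point may be used. -/
theorem laplacian_apply {f : ℝ × M × ℝ → ℝ} {w : ℝ} (hf : IsHomogeneousOn (n := n) W w f) {x : M}
    {z : ℝ × M × ℝ} (hz : z ∈ W) (hx : z.2.1 ∈ (extChartAt (𝓡 n) x).source) :
    laplacian (ambientModel n) (straightNormal γ) f z = z.1 ^ (w - 2) *
      CoordGeom.weightedLaplacian (familyCoord γ x) w (profile f x)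
        (extChartAt (𝓡 n) x z.2.1, z.2.2) := by
  have hpos := h.pos z hz
  have hx' := (extChartAt (𝓡 n) x).map_source hx
  have hp : (extChartAt (𝓡 n) x z.2.1, z.2.2) ∈ chartDomain W x := by
    refine ⟨hx', ?_⟩
    simp only
    rw [(extChartAt (𝓡 n) x).left_inv hx]
    exact (h.mem_iff hpos).1 hz
  rw [h.metric.laplacian_eq hf.smooth hz ((mem_extChartAt_ambientModel_source ((1 : ℝ), x, (0 : ℝ)) z).2 hx),
    extChartAt_ambientModel_apply]
  rw [← CoordGeom.laplacian_ambientCoord (h.isMetricFamily x) (contDiffOn_profile hf.smooth x) w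
    (F := f ∘ (extChartAt (ambientModel n) ((1 : ℝ), x, (0 : ℝ))).symm)
    (z := (z.1, extChartAt (𝓡 n) x z.2.1, z.2.2)) hpos hp]
  · refine CoordGeom.laplacian_congr ?_ Filter.EventuallyEq.rfl
    have := (isOpen_extChartAt_target (I := 𝓡 n) x).preimage
      (by fun_prop : Continuous fun z : ℝ × EuclideanSpace ℝ (Fin n) × ℝ => z.2.1)
    filter_upwards [this.mem_nhds hx'] with y hy
    exact coord_straightNormal γ ((1 : ℝ), x, (0 : ℝ)) hy
  · filter_upwards [CoordGeom.eventually_mem_ambientDomain (h.isOpen_chartDomain x)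
      (z := (z.1, extChartAt (𝓡 n) x z.2.1, z.2.2)) hpos hp] with y hy
    rw [Function.comp_apply, extChartAt_ambientModel_symm_apply, hf.homogeneous]
    · rfl
    · exact (h.mem_iff hy.1).2 hy.2.2

theorem laplacian_one {f : ℝ × M × ℝ → ℝ} {w : ℝ} (hf : IsHomogeneousOn (n := n) W w f) {x : M}
    {p : EuclideanSpace ℝ (Fin n) × ℝ} (hp : p ∈ chartDomain W x) :
    profile (laplacian (ambientModel n) (straightNormal γ) f) x p =
      CoordGeom.weightedLaplacian (familyCoord γ x) w (profile f x) p := by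
  rw [profile, h.laplacian_apply hf (x := x) hp.2 ((extChartAt (𝓡 n) x).map_target hp.1)]
  simp only [Real.one_rpow, one_mul]
  rw [(extChartAt (𝓡 n) x).right_inv hp.1]

/-- The weighted Laplacian acts on profiles and does not see t; all dependence on t is in the factor
t^{w-2}. -/
theorem isHomogeneousOn_laplacian {f : ℝ × M × ℝ → ℝ} {w : ℝ}
    (hf : IsHomogeneousOn (n := n) W w f) :
    IsHomogeneousOn (n := n) W (w - 2) (laplacian (ambientModel n) (straightNormal γ) f) where
  smooth := h.metric.smoothFnOn_laplacian hf.smooth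
  homogeneous z hz := by
    have hx := mem_extChartAt_source (I := 𝓡 n) z.2.1
    rw [h.laplacian_apply hf hz hx,
      h.laplacian_apply hf (z := (1, z.2)) ((h.mem_iff (h.pos z hz)).1 hz) hx]
    simp

end IsStraightMetric

theorem ricci_straightNormal (γ : ℝ → TwoTensor (𝓡 n) M) (z : ℝ × M × ℝ)
    (u v : ℝ × EuclideanSpace ℝ (Fin n) × ℝ) :
    ricci (ambientModel n) (straightNormal γ) z u v =
      CoordGeom.ricci (CoordGeom.ambientCoord (familyCoord γ z.2.1))
        (z.1, extChartAt (𝓡 n) z.2.1 z.2.1, z.2.2) u v := by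
  rw [ricci_eq_coord, extChartAt_ambientModel_apply]
  refine CoordGeom.ricci_congr ?_ u v
  have := (isOpen_extChartAt_target (I := 𝓡 n) z.2.1).preimage
    (by fun_prop : Continuous fun z : ℝ × EuclideanSpace ℝ (Fin n) × ℝ => z.2.1)
  filter_upwards [this.mem_nhds (mem_extChartAt_target z.2.1)] with y hy
  exact coord_straightNormal γ z hy

end AmbientCharts

namespace CoordGeom

set_option maxSynthPendingDepth 3 in
/-- The pullback of bilinear forms, as a linear map. -/
def bilinearCompL {E W : Type*} [NormedAddCommGroup E] [NormedSpace ℝ E] [NormedAddCommGroup W]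
    [NormedSpace ℝ W] (A : W →L[ℝ] E) : (E →L[ℝ] E →L[ℝ] ℝ) →L[ℝ] W →L[ℝ] W →L[ℝ] ℝ :=
  let f₁ : (E →L[ℝ] W →L[ℝ] ℝ) →L[ℝ] W →L[ℝ] W →L[ℝ] ℝ :=
    (ContinuousLinearMap.compL ℝ W E (W →L[ℝ] ℝ)).flip A
  let f₂ : (E →L[ℝ] ℝ) →L[ℝ] W →L[ℝ] ℝ := (ContinuousLinearMap.compL ℝ W E ℝ).flip A
  f₁.comp (ContinuousLinearMap.compL ℝ E (E →L[ℝ] ℝ) (W →L[ℝ] ℝ) f₂)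

end CoordGeom

/-! ### Ambient spaces of Einstein manifolds agree with the model. -/

section Determination

variable {n : ℕ} {M : Type*} [TopologicalSpace M] [ChartedSpace (EuclideanSpace ℝ (Fin n)) M]

open CoordGeom

theorem familyCoord_einsteinFamily (g : TwoTensor (𝓡 n) M) (lam : ℝ) (x : M) :
    familyCoord (einsteinFamily g lam) x = einsteinCoord (g.coord (𝓡 n) x) lam := rfl

variable [IsManifold (𝓡 n) ∞ M]

theorem IsNondegenerateMetricOn.isMetricOn_target {g : TwoTensor (𝓡 n) M}
    (hg : IsNondegenerateMetricOn g Set.univ) (x : M) :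
    IsMetricOn (g.coord (𝓡 n) x) (extChartAt (𝓡 n) x).target := by
  simpa using hg.isMetricOn_coord x

theorem IsNondegenerateMetricOn.isNondegenerateMetricOn_straightNormal {g : TwoTensor (𝓡 n) M}
    (hg : IsNondegenerateMetricOn g Set.univ) {lam : ℝ} {W : Set (ℝ × M × ℝ)} (hW : IsOpen W)
    (hpos : ∀ z ∈ W, 0 < z.1) (hlam : ∀ z ∈ W, 1 + lam * z.2.2 ≠ 0) :
    IsNondegenerateMetricOn (straightNormal (einsteinFamily g lam)) W where
  isOpen := hW
  smooth z := by
    have hm := (hg.isMetricOn_target z.2.1).isMetricFamily lam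
    refine ((contDiffOn_ambientCoord hm.smooth).mono fun y hy => ?_).congr fun y hy =>
      coord_straightNormal (einsteinFamily g lam) z
        ((mem_extChartAt_ambientModel_target z y).1 hy.1)
    refine ⟨(mem_extChartAt_ambientModel_target z y).1 hy.1, ?_⟩
    have := hlam _ hy.2
    rwa [extChartAt_ambientModel_symm_apply] at this
  symm z _ u v := by
    have h1 := straightNormal_form_apply (einsteinFamily g lam) z u v
    have h2 := straightNormal_form_apply (einsteinFamily g lam) z v u
    refine h1.trans (Eq.trans ?_ h2.symm)
    have := hg.symm z.2.1 trivial u.2.1 v.2.1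
    have : (einsteinFamily g lam z.2.2).form z.2.1 u.2.1 v.2.1 =
        (einsteinFamily g lam z.2.2).form z.2.1 v.2.1 u.2.1 :=
      congrArg ((1 + lam * z.2.2) ^ 2 * ·) this
    rw [this]
    ring
  inv z hz := isInvertible_ambientCoord
    (γ := fun _ => (einsteinFamily g lam z.2.2).form z.2.1) (z := (z.1, 0, z.2.2)) (hpos z hz).ne'
    (isInvertible_smul (pow_ne_zero 2 (hlam z hz)) (hg.inv z.2.1 trivial))

/-- The part of `W` on which `1 + λρ` is positive. -/
def einsteinPart (lam : ℝ) (W : Set (ℝ × M × ℝ)) : Set (ℝ × M × ℝ) :=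
  W ∩ {z | 0 < 1 + lam * z.2.2}

theorem IsNondegenerateMetricOn.mono {V : Type*} [NormedAddCommGroup V] [NormedSpace ℝ V]
    {H : Type*} [TopologicalSpace H] {I : ModelWithCorners ℝ V H}
    {N : Type*} [TopologicalSpace N] [ChartedSpace H N] [I.Boundaryless] [IsManifold I ∞ N]
    {h : TwoTensor I N} {U U' : Set N} (hh : IsNondegenerateMetricOn h U) (hU' : IsOpen U')
    (hs : U' ⊆ U) : IsNondegenerateMetricOn h U' where
  isOpen := hU'
  smooth p := (hh.smooth p).mono fun _ hy => ⟨hy.1, hs hy.2⟩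
  symm z hz := hh.symm z (hs hz)
  inv z hz := hh.inv z (hs hz)

theorem IsStraightMetric.restrictEinstein {γ : ℝ → TwoTensor (𝓡 n) M} {W : Set (ℝ × M × ℝ)}
    (h : IsStraightMetric γ W) (lam : ℝ) : IsStraightMetric γ (einsteinPart lam W) where
  metric := h.metric.mono (h.metric.isOpen.inter
    (isOpen_lt continuous_const (by fun_prop))) Set.inter_subset_left
  pos z hz := h.pos z hz.1
  cone_mem t x ht := ⟨h.cone_mem t x ht, by simp⟩
  dilation_mem s hs z hz := ⟨h.dilation_mem s hs z hz.1, hz.2⟩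

theorem IsStraightMetric.einstein {γ : ℝ → TwoTensor (𝓡 n) M} {W : Set (ℝ × M × ℝ)}
    (h : IsStraightMetric γ W) {g : TwoTensor (𝓡 n) M}
    (hg : IsNondegenerateMetricOn g Set.univ) {lam : ℝ} (hlam : ∀ z ∈ W, 0 < 1 + lam * z.2.2) :
    IsStraightMetric (einsteinFamily g lam) W where
  metric := hg.isNondegenerateMetricOn_straightNormal h.metric.isOpen h.pos
    fun z hz => (hlam z hz).ne'
  pos := h.pos
  cone_mem := h.cone_mem
  dilation_mem := h.dilation_mem

/-- `γ` agrees with `(1 + λρ)² g` to order `m` at `ρ = 0`. -/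
def FamiliesAgree (g : TwoTensor (𝓡 n) M) (lam : ℝ) (γ : ℝ → TwoTensor (𝓡 n) M)
    (W : Set (ℝ × M × ℝ)) (m : ℕ) : Prop :=
  ∀ x, VanishesOn (chartDomain W x) m
    fun p => familyCoord γ x p - einsteinCoord (g.coord (𝓡 n) x) lam p

/-- The logarithmic derivatives in `ρ` of the volume forms of `γ` and of `(1 + λρ)² g` agree to
order `m` at `ρ = 0`. -/
def TracesAgree (g : TwoTensor (𝓡 n) M) (lam : ℝ) (γ : ℝ → TwoTensor (𝓡 n) M) (m : ℕ) : Prop :=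
  ∀ x, VanishesTo m fun r =>
    traceL (EuclideanSpace ℝ (Fin n)) (shape (familyCoord γ x) (extChartAt (𝓡 n) x x, r)) -
      traceL (EuclideanSpace ℝ (Fin n))
        (shape (einsteinCoord (g.coord (𝓡 n) x) lam) (extChartAt (𝓡 n) x x, r))

/-- The Ricci curvature of `straightNormal γ` vanishes to order `m` at `ρ = 0`. -/
def RicciVanishes (γ : ℝ → TwoTensor (𝓡 n) M) (m : ℕ) : Prop :=
  ∀ x : M, (∀ u v, VanishesTo m fun r =>
      ricciTangential (familyCoord γ x) u v (extChartAt (𝓡 n) x x, r)) ∧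
    VanishesTo m fun r => ricciNormal (familyCoord γ x) (extChartAt (𝓡 n) x x, r)

namespace IsStraightMetric

variable {γ : ℝ → TwoTensor (𝓡 n) M} {W : Set (ℝ × M × ℝ)} (h : IsStraightMetric γ W)
  {g : TwoTensor (𝓡 n) M} (hg : IsNondegenerateMetricOn g Set.univ) {lam : ℝ}
  (hlam : ∀ z ∈ W, 0 < 1 + lam * z.2.2)

include h in
theorem line_eventually_mem (x : M) : ∀ᶠ r : ℝ in 𝓝 0, ((1 : ℝ), x, r) ∈ W := by
  have h1 : Continuous fun r : ℝ => ((1 : ℝ), x, r) := by fun_prop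
  exact (h.metric.isOpen.preimage h1).mem_nhds (h.cone_mem 1 x one_pos)

include h in
-- A factor ρ^m in the Ricci tensor becomes vanishing to order m of its components along the line
-- (1, x, ρ), where the chart at x gives the fixed identification of tangent spaces.
theorem ricciVanishes {m : ℕ} {T : TwoTensor (ambientModel n) (ℝ × M × ℝ)}
    (hT : T.SmoothOn (ambientModel n) W)
    (hR : ∀ z ∈ W, ∀ u v, ricci (ambientModel n) (straightNormal γ) z u v =
      z.2.2 ^ m * T z u v) : RicciVanishes γ m := by
  intro x
  have hs : ContDiffAt ℝ ∞ (fun r : ℝ => T.form ((1 : ℝ), x, r)) 0 := by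
    have h1 : ContDiff ℝ ∞ fun r : ℝ => ((1 : ℝ), extChartAt (𝓡 n) x x, r) := by fun_prop
    have h2 : ContDiffAt ℝ ∞ (T.coord (ambientModel n) ((1 : ℝ), x, (0 : ℝ)))
        ((1 : ℝ), extChartAt (𝓡 n) x x, (0 : ℝ)) :=
      (hT ((1 : ℝ), x, (0 : ℝ))).contDiffAt
        ((isOpen_target_inter h.metric.isOpen _).mem_nhds ((mem_target_inter_iff _ _).2
          (h.zero_mem_chartDomain (mem_extChartAt_target x))))
    have h3 := h2.comp (0 : ℝ) h1.contDiffAt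
    refine h3.congr_of_eventuallyEq (Filter.Eventually.of_forall fun r => ?_)
    exact (coord_ambientModel_center T 1 r x 1 0).symm
  have key : ∀ u v : ℝ × EuclideanSpace ℝ (Fin n) × ℝ, VanishesTo m fun r =>
      CoordGeom.ricci (ambientCoord (familyCoord γ x)) ((1 : ℝ), extChartAt (𝓡 n) x x, r) u v := by
    intro u v
    have h1 : ContDiffAt ℝ ∞ (fun r : ℝ => T.form ((1 : ℝ), x, r) u v) 0 :=
      (hs.clm_apply contDiffAt_const).clm_apply contDiffAt_const
    refine (VanishesTo.pow_smul h1 m).congr ?_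
    filter_upwards [h.line_eventually_mem x] with r hr
    exact (hR _ hr u v).symm.trans (ricci_straightNormal γ ((1 : ℝ), x, r) u v)
  have hmem := line_eventually (h.isOpen_chartDomain x)
    (h.zero_mem_chartDomain (mem_extChartAt_target x))
  refine ⟨fun u v => (key (0, u, 0) (0, v, 0)).congr ?_, (key (0, 0, 1) (0, 0, 1)).congr ?_⟩
  · filter_upwards [hmem] with r hr
    exact ricci_ambientCoord_tangential (h.isMetricFamily x)
      (z := ((1 : ℝ), extChartAt (𝓡 n) x x, r)) one_pos hr u v
  · filter_upwards [hmem] with r hr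
    exact ricci_ambientCoord_normal (h.isMetricFamily x)
      (z := ((1 : ℝ), extChartAt (𝓡 n) x x, r)) one_pos hr

include h hg hlam

theorem einstein_isMetricFamily (x : M) :
    IsMetricFamily (einsteinCoord (g.coord (𝓡 n) x) lam) (chartDomain W x) :=
  (h.einstein hg hlam).isMetricFamily x

theorem chartDomain_subset (x : M) :
    chartDomain W x ⊆ einsteinDomain (extChartAt (𝓡 n) x).target lam :=
  fun _ hp => ⟨hp.1, (hlam _ hp.2).ne'⟩

/-- In another chart, both tensors are pulled back by the derivative of the same transition, which
does not depend on ρ. The centres of the charts therefore suffice. -/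
theorem familiesAgree_of_center {m : ℕ} (hc : ∀ x, VanishesTo m fun r =>
      familyCoord γ x (extChartAt (𝓡 n) x x, r) -
        einsteinCoord (g.coord (𝓡 n) x) lam (extChartAt (𝓡 n) x x, r)) :
    FamiliesAgree g lam γ W m := by
  refine fun x₀ => ⟨(h.isMetricFamily x₀).smooth.sub (h.einstein_isMetricFamily hg hlam x₀).smooth,
    fun y hy => ?_⟩
  set x := (extChartAt (𝓡 n) x₀).symm y with hx
  have hy' := mem_chartOverlap_center hy.1
  have e : chartTransition (𝓡 n) x₀ x y = extChartAt (𝓡 n) x x := rfl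
  refine ((hc x).clm (bilinearCompL (fderiv ℝ (chartTransition (𝓡 n) x₀ x) y))).congr
    (Filter.Eventually.of_forall fun r => ?_)
  beta_reduce
  rw [← e]
  have k1 := coord_chartTransition (γ r) hy'
  have k2 := coord_chartTransition (einsteinFamily g lam r) hy'
  exact congrArg₂ (· - ·) k1.symm k2.symm

theorem familiesAgree_one (h0 : ∀ x, (γ 0).form x = g.form x) : FamiliesAgree g lam γ W 1 := by
  refine h.familiesAgree_of_center hg hlam fun x => ?_
  have hs := contDiffAt_line (h.isOpen_chartDomain x) ((h.isMetricFamily x).smooth.sub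
    (h.einstein_isMetricFamily hg hlam x).smooth) (h.zero_mem_chartDomain (mem_extChartAt_target x))
  refine ⟨hs, ?_, contDiffAt_deriv hs⟩
  have e1 : familyCoord γ x (extChartAt (𝓡 n) x x, 0) = g.form x := (coord_self (γ 0) x).trans (h0 x)
  have e2 : g.coord (𝓡 n) x (extChartAt (𝓡 n) x x) = g.form x := coord_self g x
  simp only
  rw [e1, einsteinCoord, e2]
  simp only [mul_zero, add_zero, one_pow, one_smul]
  exact sub_self (g.form x)

variable (hE : ∀ (x : M) (u v : TangentSpace (𝓡 n) x),
      ricci (𝓡 n) g x u v = 2 * ((n : ℝ) - 1) * lam * g x u v)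
include hE

theorem ricciTangential_einstein (x : M) (u v : EuclideanSpace ℝ (Fin n)) {r : ℝ}
    (hr : (extChartAt (𝓡 n) x x, r) ∈ chartDomain W x) :
    ricciTangential (einsteinCoord (g.coord (𝓡 n) x) lam) u v (extChartAt (𝓡 n) x x, r) = 0 := by
  refine (hg.isMetricOn_target x).ricciTangential_einsteinCoord lam
    (h.chartDomain_subset hg hlam x hr) u v ?_
  rw [finrank_euclideanSpace_fin]
  have h1 := (ricci_eq_coord g x u v).symm.trans (hE x u v)
  have h2 : g.coord (𝓡 n) x (extChartAt (𝓡 n) x x) = g.form x := coord_self g x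
  simp only
  rw [h1, h2]
  rfl

theorem tracesAgree_one (hn : 2 ≤ n) (hd : FamiliesAgree g lam γ W 1)
    (hσ : ∀ x, ∃ σ : EuclideanSpace ℝ (Fin n) →L[ℝ] EuclideanSpace ℝ (Fin n) →L[ℝ] ℝ,
      (∀ u v, ricciTangential (familyCoord γ x) u v (extChartAt (𝓡 n) x x, 0) = σ u v) ∧
      metricTrace (familyCoord γ x (extChartAt (𝓡 n) x x, 0)) σ = 0) :
    TracesAgree g lam γ 1 := by
  intro x
  obtain ⟨σ, h1, h2⟩ := hσ x
  have hy := h.zero_mem_chartDomain (mem_extChartAt_target x)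
  exact traceL_shape_eq (h.isMetricFamily x) (h.einstein_isMetricFamily hg hlam x)
    (by rwa [finrank_euclideanSpace_fin]) (hd x) hy σ h1 h2
    fun u v => h.ricciTangential_einstein hg hlam hE x u v hy

/-- The tangential equation first improves γ, and with this the normal equation improves τ. The
excluded case 2(m + 1) = n is the one where the leading coefficient of the tangential equation
vanishes. -/
theorem agree_succ {m : ℕ} (hd : FamiliesAgree g lam γ W (m + 1))
    (hτ : TracesAgree g lam γ (m + 1)) (hR : RicciVanishes γ (m + 1)) (hm : 2 * (m + 1) ≠ n) :
    FamiliesAgree g lam γ W (m + 2) ∧ TracesAgree g lam γ (m + 2) := by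
  have hm' : (m + 1 : ℝ) ≠ Module.finrank ℝ (EuclideanSpace ℝ (Fin n)) / 2 := by
    rw [finrank_euclideanSpace_fin]
    intro e
    have : (2 * (m + 1 : ℕ) : ℝ) = n := by push_cast; linarith
    exact hm (by exact_mod_cast this)
  have hy := fun x => h.zero_mem_chartDomain (mem_extChartAt_target (I := 𝓡 n) x)
  have h1 : FamiliesAgree g lam γ W (m + 2) := h.familiesAgree_of_center hg hlam fun x =>
    vanishesTo_sub_succ (h.isMetricFamily x) (h.einstein_isMetricFamily hg hlam x) (hd x) (hy x)
      (hR x).1 (fun u v r hr => h.ricciTangential_einstein hg hlam hE x u v hr) (hτ x) hm'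
  exact ⟨h1, fun x => vanishesTo_traceL_shape_sub (h.isMetricFamily x)
    (h.einstein_isMetricFamily hg hlam x) (h1 x) (hy x) (hR x).2 fun p hp =>
      (hg.isMetricOn_target x).ricciNormal_einsteinCoord lam (h.chartDomain_subset hg hlam x hp)⟩

end IsStraightMetric

theorem RicciVanishes.mono {γ : ℝ → TwoTensor (𝓡 n) M} {m k : ℕ} (h : RicciVanishes γ m)
    (hk : k ≤ m) : RicciVanishes γ k :=
  fun x => ⟨fun u v => ((h x).1 u v).mono hk, (h x).2.mono hk⟩

theorem IsPreAmbient.isStraightMetric {g : TwoTensor (𝓡 n) M} {p q : ℕ} {W : Set (ℝ × M × ℝ)}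
    {γ : ℝ → TwoTensor (𝓡 n) M} (h : IsPreAmbient g p q W (straightNormal γ)) :
    IsStraightMetric γ W where
  metric := h.metric.isNondegenerateMetricOn h.isOpen
  pos := h.pos
  cone_mem := h.cone_mem
  dilation_mem := h.dilation_mem

theorem IsPreAmbient.form_zero {g : TwoTensor (𝓡 n) M} {p q : ℕ} {W : Set (ℝ × M × ℝ)}
    {γ : ℝ → TwoTensor (𝓡 n) M} (h : IsPreAmbient g p q W (straightNormal γ)) (x : M) :
    (γ 0).form x = g.form x := by
  refine ContinuousLinearMap.ext fun u => ContinuousLinearMap.ext fun v => ?_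
  have h1 := h.restrict 1 x one_pos 0 0 u v
  have h2 := straightNormal_form_apply γ ((1 : ℝ), x, (0 : ℝ)) (0, u, 0) (0, v, 0)
  have h3 := h2.symm.trans h1
  simp only [mul_zero, add_zero, zero_add, one_pow, one_mul] at h3
  exact h3

/-- An ambient space in straight and normal form of an Einstein manifold agrees with the
explicit one, to all orders in odd dimensions and to order `n / 2` in even dimensions. -/
theorem IsAmbient.agree (hn : 2 ≤ n) {p q : ℕ} {g : TwoTensor (𝓡 n) M}
    (hg : IsNondegenerateMetricOn g Set.univ) {lam : ℝ}
    (hE : ∀ (x : M) (u v : TangentSpace (𝓡 n) x),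
      ricci (𝓡 n) g x u v = 2 * ((n : ℝ) - 1) * lam * g x u v)
    {W : Set (ℝ × M × ℝ)} {γ : ℝ → TwoTensor (𝓡 n) M}
    (h : IsAmbient g p q W (straightNormal γ)) {k : ℕ} (hk : 1 ≤ k) (hnk : Odd n ∨ 2 * k ≤ n) :
    FamiliesAgree g lam γ (einsteinPart lam W) k ∧ TracesAgree g lam γ k := by
  have hS := h.toIsPreAmbient.isStraightMetric
  have hS' := hS.restrictEinstein lam
  have hlam : ∀ z ∈ einsteinPart lam W, 0 < 1 + lam * z.2.2 := fun z hz => hz.2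
  -- For even n the order available is (n - 2)/2, that is, all m with 2(m + 1) ≤ n.
  have hR : ∀ m, Odd n ∨ 2 * (m + 1) ≤ n → RicciVanishes γ m := by
    intro m hm
    by_cases ho : Odd n
    · obtain ⟨T, hT, hTR⟩ := h.ricci_odd ho m
      exact hS.ricciVanishes hT hTR
    · obtain ⟨T, hT, hTR, -⟩ := h.ricci_even (Nat.not_odd_iff_even.1 ho)
      exact (hS.ricciVanishes hT hTR).mono (by have := hm.resolve_left ho; omega)
  have hd1 := hS'.familiesAgree_one hg hlam h.toIsPreAmbient.form_zero
  have hσ : ∀ x, ∃ σ : EuclideanSpace ℝ (Fin n) →L[ℝ] EuclideanSpace ℝ (Fin n) →L[ℝ] ℝ,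
      (∀ u v, ricciTangential (familyCoord γ x) u v (extChartAt (𝓡 n) x x, 0) = σ u v) ∧
      metricTrace (familyCoord γ x (extChartAt (𝓡 n) x x, 0)) σ = 0 := by
    intro x
    -- Unless n = 2 the Ricci curvature vanishes at ρ = 0 and σ = 0 will do. For n = 2 the
    -- hypothesis is O⁺(ρ⁰), and σ is the trace-free form that it provides.
    by_cases ho : Odd n ∨ 2 * (1 + 1) ≤ n
    · refine ⟨0, fun u v => ?_, by simp [metricTrace]⟩
      exact ((hR 1 ho x).1 u v).2.1
    · obtain rfl : n = 2 := by
        rcases Nat.even_or_odd n with h' | h'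
        · have : ¬ 2 * (1 + 1) ≤ n := fun h4 => ho (Or.inr h4)
          obtain ⟨r, hr⟩ := h'
          omega
        · exact absurd (Or.inl h') ho
      obtain ⟨T, hT, hTR, hσ⟩ := h.ricci_even even_two
      obtain ⟨σ, -, htr, hσ⟩ := hσ 1 x one_pos
      refine ⟨σ, fun u v => ?_, ?_⟩
      · have hy := hS.zero_mem_chartDomain (mem_extChartAt_target x)
        rw [← ricci_ambientCoord_tangential (hS.isMetricFamily x)
          (z := ((1 : ℝ), extChartAt (𝓡 2) x x, 0)) one_pos hy]
        have h1 := hTR ((1 : ℝ), x, (0 : ℝ)) (hS.cone_mem 1 x one_pos) (0, u, 0) (0, v, 0)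
        have h2 := ricci_straightNormal γ ((1 : ℝ), x, (0 : ℝ)) (0, u, 0) (0, v, 0)
        refine h2.symm.trans (h1.trans ?_)
        have h3 := hσ 0 0 u v
        refine Eq.trans ?_ h3
        exact one_mul _
      · have : familyCoord γ x (extChartAt (𝓡 2) x x, 0) = g.form x :=
          (coord_self (γ 0) x).trans (h.toIsPreAmbient.form_zero x)
        rw [this]
        exact htr
  have hτ1 := hS'.tracesAgree_one hg hlam hE hn hd1 hσ
  obtain ⟨j, rfl⟩ : ∃ j, k = j + 1 := ⟨k - 1, by omega⟩
  clear hk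
  induction j with
  | zero => exact ⟨hd1, hτ1⟩
  -- Passing from order j + 1 to j + 2 uses the Ricci curvature to order j + 1. For even n this
  -- requires 2(j + 2) ≤ n, the bound for k = j + 2; it also excludes the critical case 2(j + 1) =
  -- n.
  | succ j ih =>
    have hj : Odd n ∨ 2 * (j + 1) ≤ n := hnk.imp_right fun _ => by omega
    obtain ⟨h1, h2⟩ := ih hj
    refine hS'.agree_succ hg hlam hE h1 h2 (hR _ hnk) ?_
    rcases hnk with h' | h'
    · rintro rfl
      exact (Nat.not_odd_iff_even.2 (even_two_mul _)) h'
    · omega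

end Determination

/-! ### Loss of order under one ambient Laplacian. -/

namespace CoordGeom

set_option maxSynthPendingDepth 3

variable {E : Type*} [NormedAddCommGroup E] [NormedSpace ℝ E] [FiniteDimensional ℝ E]

/-- Although there are two ρ-derivatives, one order is lost and not two: ∂_ρ² has the coefficient
-2ρ, and by the Euler identity ρ∂_ρ keeps the order of ∂_ρf. -/
theorem VanishesOn.weightedLaplacian {γ : E × ℝ → E →L[ℝ] E →L[ℝ] ℝ} {Ω : Set (E × ℝ)} {m : ℕ}
    (h : IsMetricFamily γ Ω) {f : E × ℝ → ℝ} (hf : VanishesOn Ω (m + 1) f) (w : ℝ) :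
    VanishesOn Ω m (weightedLaplacian γ w f) := by
  have hΩ := h.isOpen
  have hfm := hf.of_succ
  have hf1 := hf.dRho hΩ
  have hf2 := ((hf1.euler hΩ).of_succ).add (hf1.clm ((m : ℝ) • ContinuousLinearMap.id ℝ ℝ))
  have sτ : ContDiffOn ℝ ∞ (fun p => traceL E (shape γ p)) Ω :=
    (traceL E).contDiff.comp_contDiffOn h.contDiffOn_shape
  have sc : ContDiffOn ℝ ∞ (fun p : E × ℝ => 2 * w + Module.finrank ℝ E - 2
      - p.2 * traceL E (shape γ p)) Ω := contDiffOn_const.sub (contDiffOn_snd.mul sτ)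
  have sK : ContDiffOn ℝ ∞ (fun p => (γ p).inverse) Ω := by
    have : CompleteSpace E := FiniteDimensional.complete ℝ E
    exact contDiffOn_inverse h.smooth h.inv
  let B : (E →L[ℝ] ℝ) →L[ℝ] (E →L[ℝ] E →L[ℝ] E) →L[ℝ] (E →L[ℝ] E →L[ℝ] ℝ) :=
    (ContinuousLinearMap.compL ℝ E (E →L[ℝ] E) (E →L[ℝ] ℝ)).comp
      (ContinuousLinearMap.compL ℝ E E ℝ)
  let C := ContinuousLinearMap.compL ℝ E (E →L[ℝ] ℝ) E
  have t1 := hf2.clm ((-2 : ℝ) • ContinuousLinearMap.id ℝ ℝ)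
  have t2 := hf1.bilin (ContinuousLinearMap.mul ℝ ℝ) hΩ sc
  have t3 := (((hfm.dSlice hΩ).dSlice hΩ).sub ((hfm.dSlice hΩ).bilin B hΩ
    h.contDiffOn_sliceChristoffel)).bilin_right C hΩ sK |>.clm (traceL E)
  have t4 := hfm.bilin (ContinuousLinearMap.mul ℝ ℝ) hΩ (contDiffOn_const (c := w / 2) |>.mul sτ)
  refine (((t1.add t2).add t3).add t4).congr hΩ fun p hp => ?_
  rw [CoordGeom.weightedLaplacian, h.laplacian_slice hf.smooth hp]
  simp only [_root_.smul_apply, ContinuousLinearMap.id_apply, smul_eq_mul,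
    ContinuousLinearMap.mul_apply', B, C, ContinuousLinearMap.comp_apply,
    ContinuousLinearMap.compL_apply]
  ring

end CoordGeom

/-! ### Iterated Laplacians of smooth functions on open sets. -/

section SmoothFunctions

variable {V : Type*} [NormedAddCommGroup V] [NormedSpace ℝ V]
  {H : Type*} [TopologicalSpace H] {I : ModelWithCorners ℝ V H}
  {N : Type*} [TopologicalSpace N] [ChartedSpace H N] {U : Set N} {f f' : N → ℝ}

namespace SmoothFnOn

theorem add (hf : SmoothFnOn I U f) (hf' : SmoothFnOn I U f') : SmoothFnOn I U (f + f') :=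
  fun p => (hf p).add (hf' p)

theorem sub (hf : SmoothFnOn I U f) (hf' : SmoothFnOn I U f') : SmoothFnOn I U (f - f') :=
  fun p => (hf p).sub (hf' p)

theorem mul (hf : SmoothFnOn I U f) (hf' : SmoothFnOn I U f') : SmoothFnOn I U (f * f') :=
  fun p => (hf p).mul (hf' p)

theorem const_mul (c : ℝ) (hf : SmoothFnOn I U f) : SmoothFnOn I U (fun z => c * f z) :=
  fun p => contDiffOn_const.mul (hf p)

theorem mono {U' : Set N} (hf : SmoothFnOn I U f) (hU : U' ⊆ U) : SmoothFnOn I U' f :=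
  fun p => (hf p).mono fun _ hy => ⟨hy.1, hU hy.2⟩

variable [I.Boundaryless]

theorem contDiffAt (hf : SmoothFnOn I U f) (hU : IsOpen U) {z : N} (hz : z ∈ U) :
    ContDiffAt ℝ ∞ (f ∘ (extChartAt I z).symm) (extChartAt I z z) :=
  (hf z).contDiffAt ((isOpen_target_inter hU z).mem_nhds ⟨mem_extChartAt_target z, by
    rw [Set.mem_preimage, extChartAt_to_inv]; exact hz⟩)

end SmoothFnOn

variable [I.Boundaryless] (h : TwoTensor I N)

theorem laplacian_eqOn (hU : IsOpen U) (hff' : Set.EqOn f f' U) :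
    Set.EqOn (laplacian I h f) (laplacian I h f') U := fun z hz => by
  refine CoordGeom.laplacian_congr Filter.EventuallyEq.rfl ?_
  filter_upwards [(isOpen_target_inter (I := I) hU z).mem_nhds ⟨mem_extChartAt_target z, by
    rw [Set.mem_preimage, extChartAt_to_inv]; exact hz⟩] with y hy
  exact hff' hy.2

theorem laplacian_add_eqOn (hU : IsOpen U) (hf : SmoothFnOn I U f) (hf' : SmoothFnOn I U f') :
    Set.EqOn (laplacian I h (f + f')) (laplacian I h f + laplacian I h f') U := fun _ hz =>
  CoordGeom.laplacian_add ((hf.contDiffAt hU hz).of_le ENat.LEInfty.out)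
    ((hf'.contDiffAt hU hz).of_le ENat.LEInfty.out)

theorem laplacian_const_mul_eqOn (hU : IsOpen U) (hf : SmoothFnOn I U f) (c : ℝ) :
    Set.EqOn (laplacian I h fun z => c * f z) (fun z => c * laplacian I h f z) U := fun _ hz =>
  CoordGeom.laplacian_const_mul c ((hf.contDiffAt hU hz).of_le ENat.LEInfty.out)

theorem laplacian_sub_eqOn (hU : IsOpen U) (hf : SmoothFnOn I U f) (hf' : SmoothFnOn I U f') :
    Set.EqOn (laplacian I h (f - f')) (laplacian I h f - laplacian I h f') U := by
  have e : f - f' = f + fun z => (-1 : ℝ) * f' z := by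
    funext z; simp [sub_eq_add_neg]
  intro z hz
  rw [e, laplacian_add_eqOn h hU hf (hf'.const_mul (-1)) hz, Pi.add_apply,
    laplacian_const_mul_eqOn h hU hf' (-1) hz, Pi.sub_apply]
  ring

theorem iterate_laplacian_eqOn (hU : IsOpen U) (hff' : Set.EqOn f f' U) (s : ℕ) :
    Set.EqOn ((laplacian I h)^[s] f) ((laplacian I h)^[s] f') U := by
  induction s with
  | zero => exact hff'
  | succ s ih =>
    rw [Function.iterate_succ_apply', Function.iterate_succ_apply']
    exact laplacian_eqOn h hU ih

variable [IsManifold I ∞ N] [FiniteDimensional ℝ V]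

namespace IsNondegenerateMetricOn

variable {h} (hh : IsNondegenerateMetricOn h U)
include hh

theorem smoothFnOn_iterate (hf : SmoothFnOn I U f) (s : ℕ) :
    SmoothFnOn I U ((laplacian I h)^[s] f) := by
  induction s with
  | zero => exact hf
  | succ s ih =>
    rw [Function.iterate_succ_apply']
    exact hh.smoothFnOn_laplacian ih

theorem iterate_add (hf : SmoothFnOn I U f) (hf' : SmoothFnOn I U f') (s : ℕ) :
    Set.EqOn ((laplacian I h)^[s] (f + f'))
      ((laplacian I h)^[s] f + (laplacian I h)^[s] f') U := by
  induction s with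
  | zero => exact fun _ _ => rfl
  | succ s ih =>
    simp only [Function.iterate_succ_apply']
    exact (laplacian_eqOn h hh.isOpen ih).trans (laplacian_add_eqOn h hh.isOpen
      (hh.smoothFnOn_iterate hf s) (hh.smoothFnOn_iterate hf' s))

theorem iterate_sub (hf : SmoothFnOn I U f) (hf' : SmoothFnOn I U f') (s : ℕ) :
    Set.EqOn ((laplacian I h)^[s] (f - f'))
      ((laplacian I h)^[s] f - (laplacian I h)^[s] f') U := by
  induction s with
  | zero => exact fun _ _ => rfl
  | succ s ih =>
    simp only [Function.iterate_succ_apply']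
    exact (laplacian_eqOn h hh.isOpen ih).trans (laplacian_sub_eqOn h hh.isOpen
      (hh.smoothFnOn_iterate hf s) (hh.smoothFnOn_iterate hf' s))

theorem iterate_const_mul (hf : SmoothFnOn I U f) (c : ℝ) (s : ℕ) :
    Set.EqOn ((laplacian I h)^[s] fun z => c * f z)
      (fun z => c * (laplacian I h)^[s] f z) U := by
  induction s with
  | zero => exact fun _ _ => rfl
  | succ s ih =>
    simp only [Function.iterate_succ_apply']
    exact (laplacian_eqOn h hh.isOpen ih).trans (laplacian_const_mul_eqOn h hh.isOpen
      (hh.smoothFnOn_iterate hf s) c)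

end IsNondegenerateMetricOn

end SmoothFunctions

/-! ### Comparison of the ambient operator with that of the model. -/

section Comparison

variable {n : ℕ} {M : Type*} [TopologicalSpace M] [ChartedSpace (EuclideanSpace ℝ (Fin n)) M]

open CoordGeom

/-- `F(1, x, ρ)` vanishes to order `m` at `ρ = 0`. -/
def VanishesAlong (m : ℕ) (F : ℝ × M × ℝ → ℝ) : Prop :=
  ∀ x : M, VanishesTo m fun r => F (1, x, r)

namespace IsHomogeneousOn

variable {W : Set (ℝ × M × ℝ)} {w w' : ℝ} {F G : ℝ × M × ℝ → ℝ}

theorem add (hF : IsHomogeneousOn (n := n) W w F) (hG : IsHomogeneousOn (n := n) W w G) :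
    IsHomogeneousOn (n := n) W w (F + G) where
  smooth := hF.smooth.add hG.smooth
  homogeneous z hz := by
    rw [Pi.add_apply, hF.homogeneous z hz, hG.homogeneous z hz, Pi.add_apply, mul_add]

theorem sub (hF : IsHomogeneousOn (n := n) W w F) (hG : IsHomogeneousOn (n := n) W w G) :
    IsHomogeneousOn (n := n) W w (F - G) where
  smooth := hF.smooth.sub hG.smooth
  homogeneous z hz := by
    rw [Pi.sub_apply, hF.homogeneous z hz, hG.homogeneous z hz, Pi.sub_apply, mul_sub]

theorem mul (hpos : ∀ z ∈ W, 0 < z.1) (hF : IsHomogeneousOn (n := n) W w F)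
    (hG : IsHomogeneousOn (n := n) W w' G) : IsHomogeneousOn (n := n) W (w + w') (F * G) where
  smooth := hF.smooth.mul hG.smooth
  homogeneous z hz := by
    rw [Pi.mul_apply, hF.homogeneous z hz, hG.homogeneous z hz, Pi.mul_apply,
      Real.rpow_add (hpos z hz)]
    ring

theorem mono {W' : Set (ℝ × M × ℝ)} (hF : IsHomogeneousOn (n := n) W w F) (hW : W' ⊆ W) :
    IsHomogeneousOn (n := n) W' w F where
  smooth := hF.smooth.mono hW
  homogeneous z hz := hF.homogeneous z (hW hz)

end IsHomogeneousOn

variable [IsManifold (𝓡 n) ∞ M]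

namespace IsStraightMetric

variable {γ : ℝ → TwoTensor (𝓡 n) M} {W : Set (ℝ × M × ℝ)} (h : IsStraightMetric γ W)
  {F G : ℝ × M × ℝ → ℝ} {w w' : ℝ} {m : ℕ}
include h

theorem contDiffAt_line (hF : SmoothFnOn (ambientModel n) W F) (x : M) :
    ContDiffAt ℝ ∞ (fun r => F (1, x, r)) 0 := by
  have := CoordGeom.contDiffAt_line (h.isOpen_chartDomain x) (contDiffOn_profile hF x)
    (h.zero_mem_chartDomain (mem_extChartAt_target x))
  simpa [profile] using this

theorem vanishesAlong_congr (hF : VanishesAlong m F) (hFG : Set.EqOn F G W) :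
    VanishesAlong m G := fun x => (hF x).congr
  ((h.line_eventually_mem x).mono fun _ hr => hFG hr)

theorem isHomogeneousOn_iterate (hF : IsHomogeneousOn (n := n) W w F) (s : ℕ) :
    IsHomogeneousOn (n := n) W (w - 2 * s)
      ((laplacian (ambientModel n) (straightNormal γ))^[s] F) := by
  induction s with
  | zero => simpa using hF
  | succ s ih =>
    rw [Function.iterate_succ_apply']
    convert h.isHomogeneousOn_laplacian ih using 1
    push_cast; ring

theorem laplacian_line_eventuallyEq (hF : IsHomogeneousOn (n := n) W w F) (x : M) :
    (fun r => laplacian (ambientModel n) (straightNormal γ) F (1, x, r)) =ᶠ[𝓝 0]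
      fun r => weightedLaplacian (familyCoord γ x) w (profile F x) (extChartAt (𝓡 n) x x, r) := by
  filter_upwards [line_eventually (h.isOpen_chartDomain x)
    (h.zero_mem_chartDomain (mem_extChartAt_target x))] with r hr
  rw [← h.laplacian_one hF hr]
  simp [profile]

theorem vanishesAlong_laplacian (hF : IsHomogeneousOn (n := n) W w F)
    (hv : VanishesAlong (m + 1) F) :
    VanishesAlong m (laplacian (ambientModel n) (straightNormal γ) F) := fun x => by
  have h1 : VanishesOn (chartDomain W x) (m + 1) (profile (n := n) F x) :=
    ⟨contDiffOn_profile hF.smooth x, fun y _ => hv ((extChartAt (𝓡 n) x).symm y)⟩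
  exact ((VanishesOn.weightedLaplacian (h.isMetricFamily x) h1 w).vanishes _
    (h.zero_mem_chartDomain (mem_extChartAt_target x))).congr
    (h.laplacian_line_eventuallyEq hF x).symm

/-- One order is spent per Laplacian. -/
theorem vanishesAlong_iterate (s : ℕ) (hF : IsHomogeneousOn (n := n) W w F)
    (hv : VanishesAlong (m + s) F) :
    VanishesAlong m ((laplacian (ambientModel n) (straightNormal γ))^[s] F) := by
  induction s generalizing m with
  | zero => exact hv
  | succ s ih =>
    rw [Function.iterate_succ_apply']
    exact h.vanishesAlong_laplacian (h.isHomogeneousOn_iterate hF s)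
      (ih (by convert hv using 1; ring))

theorem vanishesAlong_mul (hF : VanishesAlong m F) (hG : SmoothFnOn (ambientModel n) W G) :
    VanishesAlong m (F * G) := fun x => (hF x).mul (h.contDiffAt_line hG x)

variable {g : TwoTensor (𝓡 n) M} (hg : IsNondegenerateMetricOn g Set.univ) {lam : ℝ}
  (hlam : ∀ z ∈ W, 0 < 1 + lam * z.2.2) {k : ℕ} (hd : FamiliesAgree g lam γ W k)
  (hτ : TracesAgree g lam γ k)
include hg hlam hd hτ

theorem vanishesAlong_laplacian_sub (hF : IsHomogeneousOn (n := n) W w F) :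
    VanishesAlong k (laplacian (ambientModel n) (straightNormal γ) F -
      laplacian (ambientModel n) (straightNormal (einsteinFamily g lam)) F) := fun x => by
  have h₀ := h.einstein hg hlam
  refine (vanishesTo_weightedLaplacian_sub (h.isMetricFamily x) (h₀.isMetricFamily x) (hd x)
    (h.zero_mem_chartDomain (mem_extChartAt_target x)) (hτ x) w
    (contDiffOn_profile hF.smooth x)).congr ?_
  filter_upwards [h.laplacian_line_eventuallyEq hF x, h₀.laplacian_line_eventuallyEq hF x]
    with r h1 h2
  rw [Pi.sub_apply, h1, h2]

/-- With D and D₀ the two Laplacians, D^{s+1}F - D₀^{s+1}F = (D - D₀)D^sF + D₀(D^sF - D₀^sF). The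
first summand has order k, which costs nothing by the agreement of the traces; the second loses one
order against the previous step. For s = 0 the difference is zero, whence the bound m + s ≤ k + 1.
-/
theorem vanishesAlong_iterate_sub (s : ℕ) (hm : m + s ≤ k + 1)
    (hF : IsHomogeneousOn (n := n) W w F) :
    VanishesAlong m ((laplacian (ambientModel n) (straightNormal γ))^[s] F -
      (laplacian (ambientModel n) (straightNormal (einsteinFamily g lam)))^[s] F) := by
  have h₀ := h.einstein hg hlam
  induction s generalizing m with
  | zero =>
    intro x
    simpa using VanishesTo.zero
  | succ s ih =>
    simp only [Function.iterate_succ_apply']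
    have hFs := h.isHomogeneousOn_iterate hF s
    have hFs₀ := h₀.isHomogeneousOn_iterate hF s
    have h1 := h.vanishesAlong_laplacian_sub hg hlam hd hτ hFs
    have h2 := h₀.vanishesAlong_laplacian (hFs.sub hFs₀) (m := m) (ih (by omega))
    have h3 := laplacian_sub_eqOn (straightNormal (einsteinFamily g lam)) h.metric.isOpen
      hFs.smooth hFs₀.smooth
    have h4 := h.vanishesAlong_congr h2 h3
    intro x
    refine (((h1 x).mono (by omega)).add (h4 x)).congr (Filter.Eventually.of_forall fun r => ?_)
    simp

/-- The terms of the ambient operator do not change along `ρ = 0` when `γ` is replaced by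
`(1 + λρ)² g`. -/
theorem iterate_mul_iterate_eq {U V : ℝ × M × ℝ → ℝ} (hU : IsHomogeneousOn (n := n) W w U)
    (hV : IsHomogeneousOn (n := n) W w' V) {a s t : ℕ} (hast : a + s + t ≤ k) (x : M) :
    (laplacian (ambientModel n) (straightNormal γ))^[a]
      ((laplacian (ambientModel n) (straightNormal γ))^[s] U *
        (laplacian (ambientModel n) (straightNormal γ))^[t] V) (1, x, 0) =
    (laplacian (ambientModel n) (straightNormal (einsteinFamily g lam)))^[a]
      ((laplacian (ambientModel n) (straightNormal (einsteinFamily g lam)))^[s] U *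
        (laplacian (ambientModel n) (straightNormal (einsteinFamily g lam)))^[t] V) (1, x, 0) := by
  have h₀ := h.einstein hg hlam
  set D := laplacian (ambientModel n) (straightNormal γ)
  set D₀ := laplacian (ambientModel n) (straightNormal (einsteinFamily g lam))
  have hUs := h.isHomogeneousOn_iterate hU s
  have hUs₀ := h₀.isHomogeneousOn_iterate hU s
  have hVt := h.isHomogeneousOn_iterate hV t
  have hVt₀ := h₀.isHomogeneousOn_iterate hV t
  have hX := hUs.mul h.pos hVt
  have hX₀ := hUs₀.mul h.pos hVt₀
  -- Replace D by D₀ in the outer power first, then in the factors. Order 1 + a of the change in the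
  -- product survives the a outer Laplacians as order 1, that is, as a zero at ρ = 0; this is where
  -- a + s + t ≤ k is used.
  have e1 := h.vanishesAlong_iterate_sub hg hlam hd hτ a (m := 1) (by omega) hX
  have v1 := h.vanishesAlong_mul (h.vanishesAlong_iterate_sub hg hlam hd hτ s (m := 1 + a)
    (by omega) hU) hVt.smooth
  have v2 := h.vanishesAlong_mul (h.vanishesAlong_iterate_sub hg hlam hd hτ t (m := 1 + a)
    (by omega) hV) hUs₀.smooth
  have v3 : VanishesAlong (1 + a) (D^[s] U * D^[t] V - D₀^[s] U * D₀^[t] V) := fun x =>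
    ((v1 x).add (v2 x)).congr (Filter.Eventually.of_forall fun r => by
      simp only [Pi.sub_apply, Pi.mul_apply]; ring)
  have e2 := h₀.vanishesAlong_iterate a (hX.sub hX₀) v3
  have hmem := h.cone_mem 1 x one_pos
  have e3 := h₀.metric.iterate_sub hX.smooth hX₀.smooth a hmem
  have q1 := (e1 x).2.1
  have q2 := (e2 x).2.1
  beta_reduce at q2
  rw [e3] at q2
  simp only [Pi.sub_apply] at q1 q2
  linarith

end IsStraightMetric

end Comparison

/-! ### Taylor polynomials. -/

section Taylor

/-- The derivative of the Taylor polynomial of f is the Taylor polynomial of f' of one degree less,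
matching the recursive definition of `VanishesTo`. -/
theorem iteratedDeriv_sub_sum_aux (f : ℝ → ℝ) (m : ℕ) (r : ℝ) :
    HasDerivAt (fun r : ℝ => ∑ j ∈ Finset.range (m + 1), iteratedDeriv j f 0 / j.factorial * r ^ j)
      (∑ j ∈ Finset.range m, iteratedDeriv j (deriv f) 0 / j.factorial * r ^ j) r := by
  have h : ∀ j ∈ Finset.range (m + 1), HasDerivAt
      (fun r : ℝ => iteratedDeriv j f 0 / j.factorial * r ^ j)
      (iteratedDeriv j f 0 / j.factorial * (j * r ^ (j - 1))) r :=
    fun j _ => (hasDerivAt_pow j r).const_mul _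
  refine (HasDerivAt.fun_sum h).congr_deriv ?_
  rw [Finset.sum_range_succ']
  simp only [Nat.cast_zero, zero_mul, mul_zero, add_zero]
  refine Finset.sum_congr rfl fun j _ => ?_
  rw [iteratedDeriv_succ', Nat.factorial_succ]
  have : (j.factorial : ℝ) ≠ 0 := by positivity
  have : (j + 1 : ℝ) ≠ 0 := by positivity
  push_cast
  field_simp

/-- A smooth function agrees with its Taylor polynomial to the order of the latter. -/
theorem vanishesTo_sub_taylor (m : ℕ) {f : ℝ → ℝ} (hf : ContDiffAt ℝ ∞ f 0) :
    VanishesTo m fun r => f r - ∑ j ∈ Finset.range m, iteratedDeriv j f 0 / j.factorial * r ^ j := by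
  induction m generalizing f with
  | zero => simpa [VanishesTo] using hf
  | succ m ih =>
    have hs : ContDiffAt ℝ ∞ (fun r => f r -
        ∑ j ∈ Finset.range (m + 1), iteratedDeriv j f 0 / j.factorial * r ^ j) 0 := by
      refine hf.sub (ContDiff.contDiffAt ?_)
      fun_prop
    refine ⟨hs, ?_, (ih (contDiffAt_deriv hf)).congr ?_⟩
    · simp [Finset.sum_range_succ']
    · filter_upwards [eventually_differentiableAt hf] with r hr
      exact (hr.hasDerivAt.sub (iteratedDeriv_sub_sum_aux f m r)).deriv.symm

end Taylor

/-! ### Multiplication by 2ρ, and the powers of 1 + λρ, under the weighted Laplacian. -/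

namespace CoordGeom

variable {E : Type*} [NormedAddCommGroup E] [NormedSpace ℝ E]

theorem contDiffOn_iterate_dRho {f : E × ℝ → ℝ} {Ω : Set (E × ℝ)} (hΩ : IsOpen Ω)
    (hf : ContDiffOn ℝ ∞ f Ω) (j : ℕ) : ContDiffOn ℝ ∞ (dRho^[j] f) Ω := by
  induction j with
  | zero => exact hf
  | succ j ih => rw [Function.iterate_succ_apply']; exact contDiffOn_dRho hΩ ih

theorem iteratedDeriv_line {f : E × ℝ → ℝ} {Ω : Set (E × ℝ)} (hΩ : IsOpen Ω)
    (hf : ContDiffOn ℝ ∞ f Ω) (j : ℕ) {y : E} {r : ℝ} (hy : (y, r) ∈ Ω) :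
    iteratedDeriv j (fun s => f (y, s)) r = (dRho^[j] f) (y, r) := by
  induction j generalizing r with
  | zero => rfl
  | succ j ih =>
    rw [iteratedDeriv_succ, Function.iterate_succ_apply',
      ← deriv_line (differentiableAt_of_contDiffOn hΩ (contDiffOn_iterate_dRho hΩ hf j) hy)]
    refine Filter.EventuallyEq.deriv_eq ?_
    filter_upwards [line_eventually hΩ hy] with s hs using ih hs

variable [FiniteDimensional ℝ E]

/-- Passing from f to 2ρf raises the weight by two. The contributions of tr(γ⁻¹∂_ργ) from the
first-order and zeroth-order terms then cancel, so the commutator is the same constant for every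
family γ. -/
theorem weightedLaplacian_rho_mul {γ : E × ℝ → E →L[ℝ] E →L[ℝ] ℝ} {Ω : Set (E × ℝ)}
    (h : IsMetricFamily γ Ω) {f : E × ℝ → ℝ} (hf : ContDiffOn ℝ ∞ f Ω) (w : ℝ) {p : E × ℝ}
    (hp : p ∈ Ω) :
    weightedLaplacian γ (w + 2) (fun p => 2 * p.2 * f p) p = 2 * p.2 * weightedLaplacian γ w f p
      + (4 * w + 2 * Module.finrank ℝ E + 4) * f p := by
  have hΩ := h.isOpen
  have hf' := contDiffOn_dRho hΩ hf
  have hg : ContDiffOn ℝ ∞ (fun p : E × ℝ => 2 * p.2 * f p) Ω :=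
    (contDiffOn_const.mul contDiffOn_snd).mul hf
  have key : ∀ {φ : E × ℝ → ℝ}, ContDiffOn ℝ ∞ φ Ω → ∀ p ∈ Ω,
      dRho (fun p => 2 * p.2 * φ p) p = 2 * φ p + 2 * p.2 * dRho φ p := by
    intro φ hφ p hp
    have h1 := ((hasDerivAt_id' p.2).const_mul (2 : ℝ)).fun_mul
      (hasDerivAt_line (y := p.1) (r := p.2) (differentiableAt_of_contDiffOn hΩ hφ hp))
    rw [← deriv_line (y := p.1) (r := p.2) (differentiableAt_of_contDiffOn hΩ
      ((contDiffOn_const.mul contDiffOn_snd).mul hφ) hp)]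
    rw [h1.deriv]
    ring
  have h2 : dRho (dRho fun p => 2 * p.2 * f p) p = 4 * dRho f p + 2 * p.2 * dRho (dRho f) p := by
    have h3 : dRho (fun p => 2 * p.2 * f p) =ᶠ[𝓝 p]
        fun p => 2 * f p + 2 * p.2 * dRho f p := by
      filter_upwards [hΩ.mem_nhds hp] with q hq using key hf q hq
    have h4 : HasFDerivAt (fun p => 2 * f p) _ p :=
      (differentiableAt_of_contDiffOn hΩ hf hp).hasFDerivAt.const_mul (2 : ℝ)
    have h5 := (differentiableAt_of_contDiffOn hΩ
      ((contDiffOn_const (c := (2 : ℝ)).mul contDiffOn_snd).mul hf') hp).hasFDerivAt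
    have h6 := key hf' p hp
    rw [dRho, h3.fderiv_eq, (h4.fun_add h5).fderiv]
    rw [dRho] at h6
    rw [_root_.add_apply, h6]
    simp only [_root_.smul_apply, smul_eq_mul]
    rw [show fderiv ℝ f p (0, 1) = dRho f p from rfl]
    ring
  have h3 := laplacian_const_mul (G := fun y => γ (y, p.2)) (f := fun y => f (y, p.2)) (y := p.1)
    (2 * p.2) (((hf.comp (by fun_prop) (fun _ hy => hy) : ContDiffOn ℝ ∞ (fun y => f (y, p.2))
      {y | (y, p.2) ∈ Ω}).contDiffAt ((isOpen_slice hΩ p.2).mem_nhds hp)).of_le ENat.LEInfty.out)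
  rw [weightedLaplacian, h2, key hf p hp, h3, weightedLaplacian]
  ring

namespace IsMetricOn

/-- After the common factor (1 + λρ)^{w-2} is taken out, the terms without the slice Laplacian
combine to a multiple of (1 + λρ) - λρ = 1, which removes the remaining dependence on ρ. -/
theorem weightedLaplacian_einsteinCoord_rpow {G : E → E →L[ℝ] E →L[ℝ] ℝ} {T : Set E}
    (h : IsMetricOn G T) (lam : ℝ) {p : E × ℝ} (hp : p.1 ∈ T) (hp' : 0 < 1 + lam * p.2) (w : ℝ)
    {u : E → ℝ} (hu : ContDiffOn ℝ ∞ u T) :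
    weightedLaplacian (einsteinCoord G lam) w (fun q => (1 + lam * q.2) ^ w * u q.1) p =
      (1 + lam * p.2) ^ (w - 2) * (laplacian G u p.1
        + 2 * w * (Module.finrank ℝ E + w - 1) * lam * u p.1) := by
  let Ω : Set (E × ℝ) := {p | p.1 ∈ T ∧ 0 < 1 + lam * p.2}
  have hΩ : IsOpen Ω := (h.isOpen.preimage continuous_fst).inter
    (isOpen_lt continuous_const (by fun_prop : Continuous fun q : E × ℝ => 1 + lam * q.2))
  have hs : ∀ w : ℝ, ContDiffOn ℝ ∞ (fun q : E × ℝ => (1 + lam * q.2) ^ w * u q.1) Ω := by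
    intro w
    refine ContDiffOn.mul ?_ (hu.comp contDiffOn_fst fun q hq => hq.1)
    have h1 : ContDiff ℝ ∞ fun q : E × ℝ => 1 + lam * q.2 := by fun_prop
    exact h1.contDiffOn.rpow_const_of_ne fun q hq => hq.2.ne'
  have key : ∀ w : ℝ, ∀ q ∈ Ω, dRho (fun q : E × ℝ => (1 + lam * q.2) ^ w * u q.1) q =
      w * lam * ((1 + lam * q.2) ^ (w - 1) * u q.1) := by
    intro w q hq
    rw [← deriv_line (y := q.1) (r := q.2) (differentiableAt_of_contDiffOn hΩ (hs w) hq)]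
    have h1 := (((((hasDerivAt_id' q.2).const_mul lam).const_add 1).rpow_const (p := w)
      (Or.inl hq.2.ne')).mul_const (u q.1))
    rw [h1.deriv]
    ring
  have h2 : dRho (dRho fun q : E × ℝ => (1 + lam * q.2) ^ w * u q.1) p =
      w * lam * ((w - 1) * lam * ((1 + lam * p.2) ^ (w - 2) * u p.1)) := by
    have h3 : dRho (fun q : E × ℝ => (1 + lam * q.2) ^ w * u q.1) =ᶠ[𝓝 p]
        fun q => w * lam * ((1 + lam * q.2) ^ (w - 1) * u q.1) := by
      filter_upwards [hΩ.mem_nhds ⟨hp, hp'⟩] with q hq using key w q hq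
    have h4 := key (w - 1) p ⟨hp, hp'⟩
    rw [dRho] at h4 ⊢
    rw [h3.fderiv_eq, fderiv_const_mul (differentiableAt_of_contDiffOn hΩ (hs (w - 1)) ⟨hp, hp'⟩),
      _root_.smul_apply, h4, smul_eq_mul]
    ring_nf
  have h3 := laplacian_const_mul (G := G) (f := u) (y := p.1) ((1 + lam * p.2) ^ w)
    ((hu.contDiffAt (h.isOpen.mem_nhds hp)).of_le ENat.LEInfty.out)
  rw [h.weightedLaplacian_einsteinCoord lam ⟨hp, hp'.ne'⟩, h2, key w p ⟨hp, hp'⟩, h3]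
  have e1 : (1 + lam * p.2) ^ w = (1 + lam * p.2) ^ (w - 2) * (1 + lam * p.2) ^ 2 := by
    rw [← Real.rpow_natCast, ← Real.rpow_add hp']; norm_num
  have e2 : (1 + lam * p.2) ^ (w - 1) = (1 + lam * p.2) ^ (w - 2) * (1 + lam * p.2) := by
    conv_rhs => rw [← Real.rpow_one (1 + lam * p.2), ← Real.rpow_mul hp'.le, one_mul]
    rw [← Real.rpow_add hp']; congr 1; ring
  have hc : 1 + lam * p.2 ≠ 0 := hp'.ne'
  -- Denominators are cleared with the base c and the power P as independent letters; the relation c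
  -- = 1 + λρ is needed only in the polynomial identity left at the end.
  have aux : ∀ c P N L v : ℝ, c ≠ 0 → -2 * p.2 * (w * lam * ((w - 1) * lam * (P * v)))
      + (2 * w + N - 2 - p.2 * (2 * lam / c * N)) * (w * lam * (P * c * v))
      + (c ^ 2)⁻¹ * (P * c ^ 2 * L) + w / 2 * (2 * lam / c * N) * (P * c ^ 2 * v) =
      -2 * p.2 * (w * lam * ((w - 1) * lam * (P * v))) + (2 * w + N - 2) * (w * lam * (P * c * v))
      - 2 * p.2 * lam ^ 2 * N * w * P * v + P * L + w * lam * N * P * c * v := by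
    intro c P N L v hc
    field_simp
    ring
  rw [e1, e2, aux _ _ _ _ _ hc]
  ring

end IsMetricOn

end CoordGeom

/-! ### The recursion of the coefficients and the cancellation it causes. -/

section Coefficients

theorem gammaRatio_succ (z : ℝ) (m : ℕ) : gammaRatio z (m + 1) = gammaRatio z m * (z + m) :=
  ascPochhammer_succ_eval m z

/-- Raising s lengthens the first Pochhammer product by one factor and shortens the second by one;
these are the two factors in the identity. -/
theorem orCoeff_succ {n k : ℕ} (w₁ w₂ : ℝ) {s : ℕ} (t : ℕ) (hs : s < k) :
    orCoeff n k w₁ w₂ (s + 1) t * (w₁ + n / 2 - s - 1) =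
      orCoeff n k w₁ w₂ s t * (-w₁ - w₂ - ((n : ℝ) - 2 * k) / 2 + s + t) := by
  obtain ⟨b, rfl⟩ : ∃ b, k = s + 1 + b := ⟨k - (s + 1), by omega⟩
  have h1 : s + 1 + b - (s + 1) = b := by omega
  have h2 : s + 1 + b - s = b + 1 := by omega
  have h3 : s + 1 + t = s + t + 1 := by omega
  rw [orCoeff, orCoeff, h1, h2, h3, gammaRatio_succ, gammaRatio_succ]
  push_cast
  ring

theorem orCoeff_symm (n k : ℕ) (w₁ w₂ : ℝ) (s t : ℕ) :
    orCoeff n k w₁ w₂ s t = orCoeff n k w₂ w₁ t s := by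
  rw [orCoeff, orCoeff, add_comm s t,
    show -w₁ - w₂ - ((n : ℝ) - 2 * k) / 2 = -w₂ - w₁ - ((n : ℝ) - 2 * k) / 2 by ring]
  ring

theorem trinomial_symm (k s t : ℕ) : trinomial k s t = trinomial k t s := by
  rw [trinomial, trinomial, Nat.sub_right_comm]
  ring

/-- Summation by parts on a triangle: f is zero on the edge s + t = k and g on the edge s = 0, and
shifting s by one pairs off the rest. -/
theorem sum_triangle_eq_zero (k : ℕ) (f g : ℕ → ℕ → ℝ) (hf : ∀ s, f s (k - s) = 0)
    (hg : ∀ t, g 0 t = 0) (hfg : ∀ s t, s < k → t < k - s → f s t + g (s + 1) t = 0) :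
    ∑ s ∈ Finset.range (k + 1), ∑ t ∈ Finset.range (k - s + 1), (f s t + g s t) = 0 := by
  have h1 : ∀ s, ∑ t ∈ Finset.range (k - s + 1), f s t = ∑ t ∈ Finset.range (k - s), f s t :=
    fun s => by rw [Finset.sum_range_succ, hf, add_zero]
  simp only [Finset.sum_add_distrib, h1]
  rw [Finset.sum_range_succ, Finset.sum_range_succ' (n := k)]
  simp only [Nat.sub_self, Finset.range_zero, Finset.sum_empty, hg, Finset.sum_const_zero,
    add_zero, ← Finset.sum_add_distrib]
  refine Finset.sum_eq_zero fun s hs => ?_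
  have hs' := Finset.mem_range.1 hs
  rw [show k - (s + 1) + 1 = k - s by omega, ← Finset.sum_add_distrib]
  exact Finset.sum_eq_zero fun t ht => hfg s t hs' (Finset.mem_range.1 ht)

/-- The cancellation that makes the ambient operator tangential. -/
theorem sum_trinomial_orCoeff_eq_zero (n k : ℕ) (w₁ w₂ : ℝ) (Z : ℕ → ℕ → ℕ → ℝ) :
    ∑ s ∈ Finset.range (k + 1), ∑ t ∈ Finset.range (k - s + 1),
      trinomial k s t * orCoeff n k w₁ w₂ s t *
        (4 * (k - s - t : ℕ) * (w₁ + w₂ - 2 * s - 2 * t + n / 2 - (k - s - t : ℕ))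
            * Z (k - s - t - 1) s t
          + 4 * s * (w₁ + n / 2 - s) * Z (k - s - t) (s - 1) t) = 0 := by
  simp only [mul_add]
  -- On the two edges the factor k - s - t or s is zero, so the truncated indices in Z play no role
  -- there.
  refine sum_triangle_eq_zero k _ _ (fun s => by simp) (fun t => by simp) fun s t hs' ht' => ?_
  have hrec := orCoeff_succ (n := n) w₁ w₂ t hs'
  obtain ⟨b, rfl⟩ : ∃ b, k = s + t + b + 1 := ⟨k - s - t - 1, by omega⟩
  have e1 : s + t + b + 1 - s - t = b + 1 := by omega
  have e2 : s + t + b + 1 - (s + 1) - t = b := by omega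
  -- Both sides equal k!/(b! s! t!).
  have tri : trinomial (s + t + b + 1) (s + 1) t * (s + 1) =
      trinomial (s + t + b + 1) s t * (b + 1) := by
    rw [trinomial, trinomial, e1, e2, Nat.factorial_succ s, Nat.factorial_succ b]
    have h1 : (s.factorial : ℝ) ≠ 0 := by positivity
    have h2 : (b.factorial : ℝ) ≠ 0 := by positivity
    have h3 : (t.factorial : ℝ) ≠ 0 := by positivity
    have h4 : (s + 1 : ℝ) ≠ 0 := by positivity
    have h5 : (b + 1 : ℝ) ≠ 0 := by positivity
    push_cast
    field_simp
  rw [e1, e2, Nat.add_sub_cancel, Nat.add_sub_cancel]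
  push_cast at hrec ⊢
  linear_combination (4 * Z b s t * trinomial (s + t + b + 1) (s + 1) t * (s + 1)) * hrec
    + 4 * Z b s t * orCoeff n (s + t + b + 1) w₁ w₂ s t *
      (-w₁ - w₂ - ((n : ℝ) - 2 * (s + t + b + 1)) / 2 + s + t) * tri

end Coefficients

/-! ### Independence of the extensions along ρ = 0. -/

section Tangential

variable {n : ℕ} {M : Type*} [TopologicalSpace M] [ChartedSpace (EuclideanSpace ℝ (Fin n)) M]

open CoordGeom

theorem ambientOR_symm (h : TwoTensor (ambientModel n) (ℝ × M × ℝ)) (k : ℕ) (w₁ w₂ : ℝ)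
    (U V : ℝ × M × ℝ → ℝ) (z : ℝ × M × ℝ) :
    ambientOR h k w₁ w₂ U V z = ambientOR h k w₂ w₁ V U z := by
  rw [ambientOR, ambientOR, Finset.sum_comm' (t' := Finset.range (k + 1))
    (s' := fun t => Finset.range (k - t + 1))]
  · refine Finset.sum_congr rfl fun t _ => Finset.sum_congr rfl fun s _ => ?_
    rw [trinomial_symm, orCoeff_symm, Nat.sub_right_comm, mul_comm (_^[s] U)]
  · intro s t
    simp only [Finset.mem_range]
    omega

/-- The product of `F` with `2ρt²`. -/
def rhoMul (F : ℝ × M × ℝ → ℝ) (z : ℝ × M × ℝ) : ℝ := 2 * z.2.2 * z.1 ^ 2 * F z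

theorem IsHomogeneousOn.rhoMul {W : Set (ℝ × M × ℝ)} {w : ℝ} {F : ℝ × M × ℝ → ℝ}
    (hpos : ∀ z ∈ W, 0 < z.1) (hF : IsHomogeneousOn (n := n) W w F) :
    IsHomogeneousOn (n := n) W (w + 2) (rhoMul F) where
  smooth z := by
    have h1 : ContDiff ℝ ∞ fun y : ℝ × EuclideanSpace ℝ (Fin n) × ℝ => 2 * y.2.2 * y.1 ^ 2 := by
      fun_prop
    refine (h1.contDiffOn.mul (hF.smooth z)).congr fun y _ => ?_
    simp only [Function.comp_apply, _root_.rhoMul]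
    rw [extChartAt_ambientModel_symm_apply]
  homogeneous z hz := by
    rw [_root_.rhoMul, hF.homogeneous z hz, _root_.rhoMul, Real.rpow_add (hpos z hz),
      Real.rpow_two]
    ring

variable [IsManifold (𝓡 n) ∞ M]

namespace IsStraightMetric

variable {γ : ℝ → TwoTensor (𝓡 n) M} {W : Set (ℝ × M × ℝ)} (h : IsStraightMetric γ W)
  {F V : ℝ × M × ℝ → ℝ} {w w' : ℝ}
include h

theorem laplacian_rhoMul (hF : IsHomogeneousOn (n := n) W w F) :
    Set.EqOn (laplacian (ambientModel n) (straightNormal γ) (rhoMul F))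
      (rhoMul (laplacian (ambientModel n) (straightNormal γ) F) +
        fun z => (4 * w + 2 * n + 4) * F z) W := fun z hz => by
  have hx := mem_extChartAt_source (I := 𝓡 n) z.2.1
  have hpos := h.pos z hz
  have hp : (extChartAt (𝓡 n) z.2.1 z.2.1, z.2.2) ∈ chartDomain W z.2.1 := by
    refine ⟨mem_extChartAt_target z.2.1, ?_⟩
    simp only
    rw [extChartAt_to_inv]
    exact (h.mem_iff hpos).1 hz
  have hprof : profile (n := n) (rhoMul F) z.2.1 =
      fun p => 2 * p.2 * profile (n := n) F z.2.1 p := by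
    funext p; simp [profile, rhoMul]
  have hF1 : F z = z.1 ^ w * profile (n := n) F z.2.1 (extChartAt (𝓡 n) z.2.1 z.2.1, z.2.2) := by
    rw [profile, extChartAt_to_inv]; exact hF.homogeneous z hz
  rw [h.laplacian_apply (hF.rhoMul h.pos) hz hx, hprof,
    weightedLaplacian_rho_mul (h.isMetricFamily _) (contDiffOn_profile hF.smooth _) w hp,
    finrank_euclideanSpace_fin, Pi.add_apply, rhoMul, h.laplacian_apply hF hz hx, hF1,
    show w + 2 - 2 = (w - 2) + 2 by ring, Real.rpow_add hpos, Real.rpow_two,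
    show z.1 ^ w = z.1 ^ ((w - 2) + 2) by ring_nf, Real.rpow_add hpos, Real.rpow_two]
  ring

/-- The s commutators are taken at the weights w, w - 2, …, w - 2(s - 1), and the constants 4(w -
2i) + 2n + 4 add up to 4s(w + 2 + n/2 - s). -/
theorem iterate_rhoMul (hF : IsHomogeneousOn (n := n) W w F) (s : ℕ) :
    Set.EqOn ((laplacian (ambientModel n) (straightNormal γ))^[s] (rhoMul F))
      (rhoMul ((laplacian (ambientModel n) (straightNormal γ))^[s] F) +
        fun z => (4 * s * (w + 2 + n / 2 - s)) *
          (laplacian (ambientModel n) (straightNormal γ))^[s - 1] F z) W := by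
  induction s with
  | zero => intro z _; simp
  | succ s ih =>
    have hFs := h.isHomogeneousOn_iterate hF s
    have hFs' := h.isHomogeneousOn_iterate hF (s - 1)
    rw [Function.iterate_succ_apply', Function.iterate_succ_apply']
    intro z hz
    rw [laplacian_eqOn _ h.metric.isOpen ih hz,
      laplacian_add_eqOn _ h.metric.isOpen (hFs.rhoMul h.pos).smooth (hFs'.smooth.const_mul _) hz,
      Pi.add_apply, h.laplacian_rhoMul hFs hz,
      laplacian_const_mul_eqOn _ h.metric.isOpen hFs'.smooth _ hz, Pi.add_apply, Pi.add_apply,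
      Nat.add_sub_cancel]
    -- For s = 0 the truncated power s - 1 has coefficient zero and needs separate treatment.
    rcases s with _ | s
    · simp only [Nat.cast_zero, Function.iterate_zero, id_eq]
      push_cast
      ring
    · have e := Function.iterate_succ_apply' (laplacian (ambientModel n) (straightNormal γ)) s F
      beta_reduce
      rw [Nat.add_sub_cancel, ← e]
      push_cast
      ring

/-- Q is commuted through the inner power and then through the outer one, the latter at the weight
of the product; the term in which Q remains in front vanishes at ρ = 0. -/
theorem iterate_rhoMul_mul (hF : IsHomogeneousOn (n := n) W w F)
    (hV : IsHomogeneousOn (n := n) W w' V) (a s t : ℕ) (x : M) :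
    (laplacian (ambientModel n) (straightNormal γ))^[a]
      ((laplacian (ambientModel n) (straightNormal γ))^[s] (rhoMul F) *
        (laplacian (ambientModel n) (straightNormal γ))^[t] V) (1, x, 0) =
      4 * a * (w + 2 + w' - 2 * s - 2 * t + n / 2 - a) *
        (laplacian (ambientModel n) (straightNormal γ))^[a - 1]
          ((laplacian (ambientModel n) (straightNormal γ))^[s] F *
            (laplacian (ambientModel n) (straightNormal γ))^[t] V) (1, x, 0) +
      4 * s * (w + 2 + n / 2 - s) *
        (laplacian (ambientModel n) (straightNormal γ))^[a]
          ((laplacian (ambientModel n) (straightNormal γ))^[s - 1] F *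
            (laplacian (ambientModel n) (straightNormal γ))^[t] V) (1, x, 0) := by
  set D := laplacian (ambientModel n) (straightNormal γ)
  have hFs := h.isHomogeneousOn_iterate hF s
  have hFs' := h.isHomogeneousOn_iterate hF (s - 1)
  have hVt := h.isHomogeneousOn_iterate hV t
  have hX := hFs.mul h.pos hVt
  have hY := hFs'.mul h.pos hVt
  have e1 : Set.EqOn (D^[s] (rhoMul F) * D^[t] V) (rhoMul (D^[s] F * D^[t] V) +
      fun z => (4 * s * (w + 2 + n / 2 - s)) * (D^[s - 1] F * D^[t] V) z) W := by
    intro z hz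
    rw [Pi.mul_apply, h.iterate_rhoMul hF s hz]
    simp only [Pi.add_apply, Pi.mul_apply, rhoMul]
    ring
  have hmem := h.cone_mem 1 x one_pos
  rw [iterate_laplacian_eqOn _ h.metric.isOpen e1 a hmem,
    h.metric.iterate_add (hX.rhoMul h.pos).smooth (hY.smooth.const_mul _) a hmem, Pi.add_apply,
    h.iterate_rhoMul hX a hmem, h.metric.iterate_const_mul hY.smooth _ a hmem, Pi.add_apply,
    rhoMul]
  ring

theorem ambientOR_rhoMul (k : ℕ) (hF : IsHomogeneousOn (n := n) W w F)
    (hV : IsHomogeneousOn (n := n) W w' V) (x : M) :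
    ambientOR (straightNormal γ) k (w + 2) w' (rhoMul F) V (1, x, 0) = 0 := by
  simp only [ambientOR, h.iterate_rhoMul_mul hF hV]
  exact sum_trinomial_orCoeff_eq_zero n k (w + 2) w' fun a s t =>
    (laplacian (ambientModel n) (straightNormal γ))^[a]
      ((laplacian (ambientModel n) (straightNormal γ))^[s] F *
        (laplacian (ambientModel n) (straightNormal γ))^[t] V) (1, x, 0)

/-- The weights in the coefficients are independent of the weights of the functions, so that the
lemma also applies to the summands of a decomposition. -/
theorem ambientOR_add (k : ℕ) {w₁ w₂ : ℝ} {U U' : ℝ × M × ℝ → ℝ}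
    (hU : IsHomogeneousOn (n := n) W w U) (hU' : IsHomogeneousOn (n := n) W w U')
    (hV : IsHomogeneousOn (n := n) W w' V) (x : M) :
    ambientOR (straightNormal γ) k w₁ w₂ (U + U') V (1, x, 0) =
      ambientOR (straightNormal γ) k w₁ w₂ U V (1, x, 0) +
        ambientOR (straightNormal γ) k w₁ w₂ U' V (1, x, 0) := by
  simp only [ambientOR, ← Finset.sum_add_distrib]
  refine Finset.sum_congr rfl fun s _ => Finset.sum_congr rfl fun t _ => ?_
  set D := laplacian (ambientModel n) (straightNormal γ)
  have hVt := h.isHomogeneousOn_iterate hV t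
  have e1 : Set.EqOn (D^[s] (U + U') * D^[t] V) (D^[s] U * D^[t] V + D^[s] U' * D^[t] V) W := by
    intro z hz
    rw [Pi.mul_apply, h.metric.iterate_add hU.smooth hU'.smooth s hz]
    simp only [Pi.add_apply, Pi.mul_apply]
    ring
  have hmem := h.cone_mem 1 x one_pos
  rw [iterate_laplacian_eqOn _ h.metric.isOpen e1 _ hmem,
    h.metric.iterate_add ((h.isHomogeneousOn_iterate hU s).mul h.pos hVt).smooth
      ((h.isHomogeneousOn_iterate hU' s).mul h.pos hVt).smooth _ hmem, Pi.add_apply]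
  ring

theorem ambientOR_eq_zero {k : ℕ} {w₁ w₂ : ℝ} {U : ℝ × M × ℝ → ℝ}
    (hU : IsHomogeneousOn (n := n) W w U) (hv : VanishesAlong (k + 1) U)
    (hV : IsHomogeneousOn (n := n) W w' V) (x : M) :
    ambientOR (straightNormal γ) k w₁ w₂ U V (1, x, 0) = 0 := by
  refine Finset.sum_eq_zero fun s hs => Finset.sum_eq_zero fun t ht => ?_
  have hs' := Finset.mem_range.1 hs
  have ht' := Finset.mem_range.1 ht
  -- Of the order k + 1 at least 1 + (k - s - t) is left after s Laplacians, and the outer power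
  -- leaves order one.
  have h1 := h.vanishesAlong_iterate s (m := 1 + (k - s - t)) hU
    fun x => (hv x).mono (by omega)
  have hVt := h.isHomogeneousOn_iterate hV t
  have h2 := h.vanishesAlong_iterate (k - s - t) ((h.isHomogeneousOn_iterate hU s).mul h.pos hVt)
    (h.vanishesAlong_mul h1 hVt.smooth)
  have h3 := (h2 x).2.1
  beta_reduce at h3
  rw [h3, mul_zero]

end IsStraightMetric

end Tangential

/-! ### Special extensions of densities, and the operator of the model. -/

section EinsteinDensities

variable {n : ℕ} {M : Type*} [TopologicalSpace M] [ChartedSpace (EuclideanSpace ℝ (Fin n)) M]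

open CoordGeom

/-- The extension `t^w (1 + λρ)^w u` of the density `t^w u`. -/
def einsteinDensity (lam w : ℝ) (u : M → ℝ) (z : ℝ × M × ℝ) : ℝ :=
  z.1 ^ w * ((1 + lam * z.2.2) ^ w * u z.2.1)

variable {W : Set (ℝ × M × ℝ)} {lam : ℝ}

theorem isHomogeneousOn_einsteinDensity (hpos : ∀ z ∈ W, 0 < z.1)
    (hlam : ∀ z ∈ W, 0 < 1 + lam * z.2.2) (w : ℝ) {u : M → ℝ} (hu : SmoothFnOn (𝓡 n) Set.univ u) :
    IsHomogeneousOn (n := n) W w (einsteinDensity lam w u) where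
  smooth z := by
    have h1 : ContDiffOn ℝ ∞ (fun y : ℝ × EuclideanSpace ℝ (Fin n) × ℝ => y.1 ^ w)
        ((extChartAt (ambientModel n) z).target ∩ (extChartAt (ambientModel n) z).symm ⁻¹' W) := by
      refine contDiffOn_fst.rpow_const_of_ne fun y hy => ?_
      have := hpos _ hy.2
      rw [extChartAt_ambientModel_symm_apply] at this
      exact this.ne'
    have h2 : ContDiffOn ℝ ∞ (fun y : ℝ × EuclideanSpace ℝ (Fin n) × ℝ => (1 + lam * y.2.2) ^ w)
        ((extChartAt (ambientModel n) z).target ∩ (extChartAt (ambientModel n) z).symm ⁻¹' W) := by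
      have h0 : ContDiff ℝ ∞ fun y : ℝ × EuclideanSpace ℝ (Fin n) × ℝ => 1 + lam * y.2.2 := by
        fun_prop
      refine h0.contDiffOn.rpow_const_of_ne fun y hy => ?_
      have := hlam _ hy.2
      rw [extChartAt_ambientModel_symm_apply] at this
      exact this.ne'
    have h3 : ContDiffOn ℝ ∞ (fun y : ℝ × EuclideanSpace ℝ (Fin n) × ℝ =>
        (u ∘ (extChartAt (𝓡 n) z.2.1).symm) y.2.1)
        ((extChartAt (ambientModel n) z).target ∩ (extChartAt (ambientModel n) z).symm ⁻¹' W) := by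
      refine (hu z.2.1).comp (by fun_prop) fun y hy => ⟨?_, trivial⟩
      exact (mem_extChartAt_ambientModel_target z y).1 hy.1
    refine (h1.mul (h2.mul h3)).congr fun y _ => ?_
    rw [Function.comp_apply, extChartAt_ambientModel_symm_apply]
    rfl
  homogeneous z _ := by
    simp [einsteinDensity]

theorem einsteinDensity_mul (hpos : ∀ z ∈ W, 0 < z.1) (hlam : ∀ z ∈ W, 0 < 1 + lam * z.2.2)
    (w w' : ℝ) (u v : M → ℝ) :
    Set.EqOn (einsteinDensity lam w u * einsteinDensity lam w' v)
      (einsteinDensity lam (w + w') (u * v)) W := fun z hz => by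
  simp only [Pi.mul_apply, einsteinDensity, Real.rpow_add (hpos z hz), Real.rpow_add (hlam z hz)]
  ring

/-- The Taylor coefficients in `ρ` of `F(1, x, ρ)`. -/
def taylorCoeff (F : ℝ × M × ℝ → ℝ) (j : ℕ) (x : M) : ℝ :=
  iteratedDeriv j (fun r => F (1, x, r)) 0 / j.factorial

variable [IsManifold (𝓡 n) ∞ M]

theorem IsNondegenerateMetricOn.smoothFnOn_einsteinL {g : TwoTensor (𝓡 n) M}
    (hg : IsNondegenerateMetricOn g Set.univ) (lam w : ℝ) {u : M → ℝ}
    (hu : SmoothFnOn (𝓡 n) Set.univ u) (r : ℕ) :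
    SmoothFnOn (𝓡 n) Set.univ (einsteinL g lam r w u) := by
  induction r with
  | zero => exact hu
  | succ r ih => exact (hg.smoothFnOn_laplacian ih).add (ih.const_mul _)

namespace IsStraightMetric

/-- In a chart the coefficient is the restriction to ρ = 0 of an iterated ∂_ρ of the profile,
divided by a factorial, hence smooth in y. -/
theorem smoothFnOn_taylorCoeff {γ : ℝ → TwoTensor (𝓡 n) M} (h : IsStraightMetric γ W)
    {F : ℝ × M × ℝ → ℝ} (hF : SmoothFnOn (ambientModel n) W F) (j : ℕ) :
    SmoothFnOn (𝓡 n) Set.univ (taylorCoeff F j) := fun x => by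
  have hΩ := h.isOpen_chartDomain (n := n) x
  have hf := contDiffOn_profile hF x
  have h1 : ContDiffOn ℝ ∞ (fun y => (dRho^[j] (profile (n := n) F x)) (y, 0) / j.factorial)
      (extChartAt (𝓡 n) x).target :=
    ((contDiffOn_iterate_dRho hΩ hf j).comp (by fun_prop)
      fun y hy => h.zero_mem_chartDomain hy).div_const _
  rw [Set.preimage_univ, Set.inter_univ]
  refine h1.congr fun y hy => ?_
  rw [← iteratedDeriv_line hΩ hf j (h.zero_mem_chartDomain hy)]
  rfl

/-- An extension of `t^w u` differs from `t^w (1 + λρ)^w u` by a multiple of `2ρt²`, up to terms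
that vanish to any given order. -/
theorem exists_decomposition {γ : ℝ → TwoTensor (𝓡 n) M} (h : IsStraightMetric γ W)
    (hlam : ∀ z ∈ W, 0 < 1 + lam * z.2.2) {w : ℝ} {U : ℝ × M × ℝ → ℝ}
    (hU : IsHomogeneousOn (n := n) W w U) {u : M → ℝ} (hu : SmoothFnOn (𝓡 n) Set.univ u)
    (hUu : ∀ x, U (1, x, 0) = u x) (k : ℕ) :
    ∃ F R, IsHomogeneousOn (n := n) W (w - 2) F ∧ IsHomogeneousOn (n := n) W w R ∧
      VanishesAlong (k + 1) R ∧ U = einsteinDensity lam w u + (rhoMul F + R) := by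
  have hP := isHomogeneousOn_einsteinDensity (n := n) h.pos hlam w hu
  have hS := hU.sub hP
  set S := U - einsteinDensity lam w u with hSdef
  -- At t = 1, 2ρF is the Taylor polynomial of degree k of S, whose constant term is zero. The
  -- polynomial is divisible by ρ explicitly, so S itself need not be divided.
  let F : ℝ × M × ℝ → ℝ := fun z => z.1 ^ (w - 2) *
    ∑ j ∈ Finset.range k, taylorCoeff S (j + 1) z.2.1 / 2 * z.2.2 ^ j
  have hF : IsHomogeneousOn (n := n) W (w - 2) F := by
    refine ⟨fun z => ?_, fun z _ => by simp [F]⟩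
    have h1 : ContDiffOn ℝ ∞ (fun y : ℝ × EuclideanSpace ℝ (Fin n) × ℝ => y.1 ^ (w - 2))
        ((extChartAt (ambientModel n) z).target ∩ (extChartAt (ambientModel n) z).symm ⁻¹' W) := by
      refine contDiffOn_fst.rpow_const_of_ne fun y hy => ?_
      have := h.pos _ hy.2
      rw [extChartAt_ambientModel_symm_apply] at this
      exact this.ne'
    have h2 : ContDiffOn ℝ ∞ (fun y : ℝ × EuclideanSpace ℝ (Fin n) × ℝ =>
        ∑ j ∈ Finset.range k, (taylorCoeff S (j + 1) ∘ (extChartAt (𝓡 n) z.2.1).symm) y.2.1 / 2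
          * y.2.2 ^ j)
        ((extChartAt (ambientModel n) z).target ∩ (extChartAt (ambientModel n) z).symm ⁻¹' W) := by
      refine ContDiffOn.sum fun j _ => ContDiffOn.mul (ContDiffOn.div_const ?_ 2)
        (ContDiff.contDiffOn (by fun_prop))
      refine (h.smoothFnOn_taylorCoeff hS.smooth (j + 1) z.2.1).comp (by fun_prop)
        fun y hy => ⟨?_, trivial⟩
      exact (mem_extChartAt_ambientModel_target z y).1 hy.1
    refine (h1.mul h2).congr fun y _ => ?_
    rw [Function.comp_apply, extChartAt_ambientModel_symm_apply]
    rfl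
  have hQF := hF.rhoMul h.pos
  rw [sub_add_cancel] at hQF
  refine ⟨F, S - rhoMul F, hF, hS.sub hQF, fun x => ?_, by rw [hSdef]; ring⟩
  refine (vanishesTo_sub_taylor (k + 1) (h.contDiffAt_line hS.smooth x)).congr
    (Filter.Eventually.of_forall fun r => ?_)
  have h0 : S (1, x, 0) = 0 := by
    simp [hSdef, hUu, einsteinDensity]
  simp only [Pi.sub_apply, Finset.sum_range_succ', rhoMul, F, Real.one_rpow, one_mul, one_pow,
    mul_one, iteratedDeriv_zero, h0, zero_div, zero_mul, add_zero, Finset.mul_sum]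
  congr 1
  refine Finset.sum_congr rfl fun j _ => ?_
  rw [taylorCoeff]
  ring

end IsStraightMetric

section Model

variable {g : TwoTensor (𝓡 n) M} (hg : IsNondegenerateMetricOn g Set.univ)
  (h : IsStraightMetric (einsteinFamily g lam) W) (hlam : ∀ z ∈ W, 0 < 1 + lam * z.2.2)
include hg h hlam

theorem laplacian_einsteinDensity (w : ℝ) {u : M → ℝ} (hu : SmoothFnOn (𝓡 n) Set.univ u) :
    Set.EqOn (laplacian (ambientModel n) (straightNormal (einsteinFamily g lam))
      (einsteinDensity lam w u)) (einsteinDensity lam (w - 2) fun x =>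
        laplacian (𝓡 n) g u x + 2 * w * (n + w - 1) * lam * u x) W := fun z hz => by
  have hx := mem_extChartAt_source (I := 𝓡 n) z.2.1
  have hm := hg.isMetricOn_target z.2.1
  have hu' : ContDiffOn ℝ ∞ (u ∘ (extChartAt (𝓡 n) z.2.1).symm)
      (extChartAt (𝓡 n) z.2.1).target := by simpa using hu z.2.1
  have hprof : profile (n := n) (einsteinDensity lam w u) z.2.1 = fun p =>
      (1 + lam * p.2) ^ w * (u ∘ (extChartAt (𝓡 n) z.2.1).symm) p.1 := by
    funext p; simp [profile, einsteinDensity]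
  rw [h.laplacian_apply (isHomogeneousOn_einsteinDensity h.pos hlam w hu) hz hx, hprof,
    familyCoord_einsteinFamily, hm.weightedLaplacian_einsteinCoord_rpow lam
      (p := (extChartAt (𝓡 n) z.2.1 z.2.1, z.2.2)) (mem_extChartAt_target _) (hlam z hz) w hu',
    finrank_euclideanSpace_fin, einsteinDensity, Function.comp_apply, extChartAt_to_inv]
  rfl

/-- The j-th application acts at weight w - 2j and contributes the j-th factor of `einsteinL`. -/
theorem iterate_einsteinDensity (w : ℝ) {u : M → ℝ} (hu : SmoothFnOn (𝓡 n) Set.univ u) (s : ℕ) :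
    Set.EqOn ((laplacian (ambientModel n) (straightNormal (einsteinFamily g lam)))^[s]
      (einsteinDensity lam w u)) (einsteinDensity lam (w - 2 * s) (einsteinL g lam s w u)) W := by
  induction s with
  | zero => intro z _; simp [einsteinL]
  | succ s ih =>
    rw [Function.iterate_succ_apply']
    intro z hz
    rw [laplacian_eqOn _ h.metric.isOpen ih hz, laplacian_einsteinDensity hg h hlam _
      (hg.smoothFnOn_einsteinL lam w hu s) hz,
      show w - 2 * s - 2 = w - 2 * (s + 1 : ℕ) by push_cast; ring]
    congr 1
    funext x
    rw [einsteinL]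
    ring

/-- The product of the two inner densities is again a special density, of weight w₁ + w₂ - 2s - 2t,
so the outer power is computed by the same rule as the inner ones. -/
theorem ambientOR_einsteinDensity (k : ℕ) (w₁ w₂ : ℝ) {u v : M → ℝ}
    (hu : SmoothFnOn (𝓡 n) Set.univ u) (hv : SmoothFnOn (𝓡 n) Set.univ v) (x : M) :
    ambientOR (straightNormal (einsteinFamily g lam)) k w₁ w₂ (einsteinDensity lam w₁ u)
      (einsteinDensity lam w₂ v) (1, x, 0) = einsteinOR g lam k w₁ w₂ u v x := by
  refine Finset.sum_congr rfl fun s _ => Finset.sum_congr rfl fun t _ => ?_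
  set D := laplacian (ambientModel n) (straightNormal (einsteinFamily g lam))
  have e1 : Set.EqOn (D^[s] (einsteinDensity lam w₁ u) * D^[t] (einsteinDensity lam w₂ v))
      (einsteinDensity lam (w₁ + w₂ - 2 * s - 2 * t)
        (einsteinL g lam s w₁ u * einsteinL g lam t w₂ v)) W := by
    intro z hz
    rw [show w₁ + w₂ - 2 * s - 2 * t = (w₁ - 2 * s) + (w₂ - 2 * t) by ring,
      ← einsteinDensity_mul h.pos hlam _ _ _ _ hz, Pi.mul_apply, Pi.mul_apply,
      iterate_einsteinDensity hg h hlam w₁ hu s hz, iterate_einsteinDensity hg h hlam w₂ hv t hz]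
  have hmem := h.cone_mem 1 x one_pos
  have hLL := (hg.smoothFnOn_einsteinL lam w₁ hu s).mul (hg.smoothFnOn_einsteinL lam w₂ hv t)
  rw [iterate_laplacian_eqOn _ h.metric.isOpen e1 _ hmem,
    iterate_einsteinDensity hg h hlam _ hLL _ hmem]
  simp [einsteinDensity]

/-- The ambient operator of the explicit ambient space at arbitrary extensions of the densities
`t^{w₁} u` and `t^{w₂} v`. -/
theorem ambientOR_eq_einsteinOR (k : ℕ) {w₁ w₂ : ℝ} {u v : M → ℝ}
    (hu : SmoothFnOn (𝓡 n) Set.univ u) (hv : SmoothFnOn (𝓡 n) Set.univ v)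
    {U V : ℝ × M × ℝ → ℝ} (hU : IsHomogeneousOn (n := n) W w₁ U)
    (hV : IsHomogeneousOn (n := n) W w₂ V) (hUu : ∀ x, U (1, x, 0) = u x)
    (hVv : ∀ x, V (1, x, 0) = v x) (x : M) :
    ambientOR (straightNormal (einsteinFamily g lam)) k w₁ w₂ U V (1, x, 0) =
      einsteinOR g lam k w₁ w₂ u v x := by
  have key : ∀ {w w' : ℝ} {u : M → ℝ} (_ : SmoothFnOn (𝓡 n) Set.univ u) {U V : ℝ × M × ℝ → ℝ}
      (_ : IsHomogeneousOn (n := n) W w U) (_ : IsHomogeneousOn (n := n) W w' V)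
      (_ : ∀ x, U (1, x, 0) = u x),
      ambientOR (straightNormal (einsteinFamily g lam)) k w w' U V (1, x, 0) =
        ambientOR (straightNormal (einsteinFamily g lam)) k w w' (einsteinDensity lam w u) V
          (1, x, 0) := by
    intro w w' u hu U V hU hV hUu
    obtain ⟨F, R, hF, hR, hRv, rfl⟩ := h.exists_decomposition hlam hU hu hUu k
    have hP := isHomogeneousOn_einsteinDensity (n := n) h.pos hlam w hu
    have hQF := hF.rhoMul h.pos
    have e1 := h.ambientOR_rhoMul k hF hV x
    rw [sub_add_cancel] at hQF e1
    rw [h.ambientOR_add k hP (hQF.add hR) hV, h.ambientOR_add k hQF hR hV, e1,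
      h.ambientOR_eq_zero hR hRv hV, add_zero, add_zero]
  have hP := isHomogeneousOn_einsteinDensity (n := n) h.pos hlam w₁ hu
  -- The first argument is replaced by the special extension; exchanging the arguments together with
  -- the weights gives the same for the second.
  rw [key hu hU hV hUu, ambientOR_symm, key hv hV hP hVv, ambientOR_symm,
    ambientOR_einsteinDensity hg h hlam k w₁ w₂ hu hv]

end Model

/-- Solutions of `t ∂_t f = w f` are homogeneous of degree `w`. -/
theorem IsAmbientDensity.isHomogeneousOn {γ : ℝ → TwoTensor (𝓡 n) M} (h : IsStraightMetric γ W)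
    {w : ℝ} {f : ℝ × M × ℝ → ℝ} (hf : IsAmbientDensity (n := n) W w f) :
    IsHomogeneousOn (n := n) W w f where
  smooth := hf.smooth.smoothFnOn
  homogeneous z hz := by
    have hmem : ∀ s : ℝ, 0 < s → (s, z.2) ∈ W := fun s hs =>
      (h.mem_iff (z := (s, z.2)) hs).2 ((h.mem_iff (h.pos z hz)).1 hz)
    have hd : ∀ s : ℝ, 0 < s → DifferentiableAt ℝ (fun s => f (s, z.2)) s := by
      intro s hs
      have h1 := (hf.smooth.smoothFnOn.contDiffAt h.metric.isOpen (hmem s hs)).differentiableAt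
        (by simp)
      rw [extChartAt_ambientModel_apply] at h1
      have h2 : DifferentiableAt ℝ (fun s : ℝ => (s, extChartAt (𝓡 n) z.2.1 z.2.1, z.2.2)) s := by
        fun_prop
      have h3 := DifferentiableAt.comp (f := fun s : ℝ => (s, extChartAt (𝓡 n) z.2.1 z.2.1, z.2.2))
        s h1 h2
      refine h3.congr_of_eventuallyEq (Filter.Eventually.of_forall fun r => ?_)
      simp only [Function.comp_apply]
      rw [extChartAt_ambientModel_symm_apply]
      simp
    -- In the variable τ = log t the equation t∂_t f = w f says that e^{-wτ} f is constant; its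
    -- values at τ = log z.1 and τ = 0 are compared.
    let φ : ℝ → ℝ := fun τ => Real.exp (-w * τ) * f (Real.exp τ, z.2)
    have hφ : ∀ τ, HasDerivAt φ 0 τ := by
      intro τ
      have h1 := (hd _ (Real.exp_pos τ)).hasDerivAt.comp τ (Real.hasDerivAt_exp τ)
      have h2 := (((hasDerivAt_id' τ).const_mul (-w)).exp).mul h1
      refine h2.congr_deriv ?_
      have h3 := hf.homogeneous _ (hmem _ (Real.exp_pos τ))
      simp only [Function.comp_apply] at h3 ⊢
      linear_combination Real.exp (-w * τ) * h3
    have hc := is_const_of_deriv_eq_zero (fun τ => (hφ τ).differentiableAt)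
      (fun τ => (hφ τ).deriv) (Real.log z.1) 0
    simp only [φ, Real.exp_log (h.pos z hz), mul_zero, Real.exp_zero, one_mul] at hc
    rw [← hc, Real.rpow_def_of_pos (h.pos z hz), ← mul_assoc, ← Real.exp_add]
    simp [mul_comm]

end EinsteinDensities

/-! ### The determined operator, for families that agree with the model. -/

section Final

variable {n : ℕ} {M : Type*} [TopologicalSpace M] [ChartedSpace (EuclideanSpace ℝ (Fin n)) M]
  [IsManifold (𝓡 n) ∞ M]

theorem IsStraightMetric.ambientOR_homogeneous {γ : ℝ → TwoTensor (𝓡 n) M}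
    {W : Set (ℝ × M × ℝ)} (h : IsStraightMetric γ W) {w₁ w₂ : ℝ} {U V : ℝ × M × ℝ → ℝ}
    (hU : IsHomogeneousOn (n := n) W w₁ U) (hV : IsHomogeneousOn (n := n) W w₂ V) (k : ℕ) {t : ℝ}
    (ht : 0 < t) (x : M) :
    ambientOR (straightNormal γ) k w₁ w₂ U V (t, x, 0) =
      t ^ (w₁ + w₂ - 2 * k) * ambientOR (straightNormal γ) k w₁ w₂ U V (1, x, 0) := by
  simp only [ambientOR, Finset.mul_sum]
  refine Finset.sum_congr rfl fun s hs => Finset.sum_congr rfl fun r hr => ?_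
  have h1 := h.isHomogeneousOn_iterate ((h.isHomogeneousOn_iterate hU s).mul h.pos
    (h.isHomogeneousOn_iterate hV r)) (k - s - r)
  have hs' := Finset.mem_range.1 hs
  have hr' := Finset.mem_range.1 hr
  have e : w₁ - 2 * s + (w₂ - 2 * r) - 2 * (k - s - r : ℕ) = w₁ + w₂ - 2 * k := by
    rw [Nat.cast_sub (by omega), Nat.cast_sub (by omega)]
    ring
  rw [h1.homogeneous _ (h.cone_mem t x ht), e]
  ring

/-- Families that agree with `(1 + λρ)² g` to order `k` determine the same operator. -/
theorem IsStraightMetric.isORoperator {γ : ℝ → TwoTensor (𝓡 n) M} {W : Set (ℝ × M × ℝ)}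
    (h : IsStraightMetric γ W) {g : TwoTensor (𝓡 n) M}
    (hg : IsNondegenerateMetricOn g Set.univ) {lam : ℝ} {k : ℕ}
    (hd : FamiliesAgree g lam γ (einsteinPart lam W) k) (hτ : TracesAgree g lam γ k)
    (w₁ w₂ : ℝ) :
    IsORoperator W (straightNormal γ) k w₁ w₂ (einsteinOR g lam k w₁ w₂) := by
  intro u v hu hv U V hU hV hUu hVv t x ht
  -- On all of W the model metric may degenerate and (1 + λρ)^w may fail to be smooth. The part
  -- where 1 + λρ > 0 is open, conical and contains ρ = 0, and only values at ρ = 0 matter.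
  have h' := h.restrictEinstein lam
  have hlam : ∀ z ∈ einsteinPart lam W, 0 < 1 + lam * z.2.2 := fun z hz => hz.2
  have hU' := (hU.isHomogeneousOn h).mono (W' := einsteinPart lam W) Set.inter_subset_left
  have hV' := (hV.isHomogeneousOn h).mono (W' := einsteinPart lam W) Set.inter_subset_left
  rw [h'.ambientOR_homogeneous hU' hV' k ht x]
  congr 1
  rw [← ambientOR_eq_einsteinOR hg (h'.einstein hg hlam) hlam k hu.contMDiffOn.smoothFnOn
    hv.contMDiffOn.smoothFnOn hU' hV' (fun x => by simpa using hUu 1 x one_pos)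
    (fun x => by simpa using hVv 1 x one_pos)]
  refine Finset.sum_congr rfl fun s hs => Finset.sum_congr rfl fun r hr => ?_
  have hs' := Finset.mem_range.1 hs
  have hr' := Finset.mem_range.1 hr
  rw [h'.iterate_mul_iterate_eq hg hlam hd hτ hU' hV' (by omega)]

end Final

/-! ### The signature of the ambient metric. -/

section AmbientSignature

variable {E : Type*} [NormedAddCommGroup E] [NormedSpace ℝ E]

/-- The map `(a, v) ↦ (a, v, a b)`. -/
def graphMap (b : ℝ) (P : Submodule ℝ E) : ℝ × P →ₗ[ℝ] ℝ × E × ℝ :=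
  (LinearMap.fst ℝ ℝ P).prod
    ((P.subtype ∘ₗ LinearMap.snd ℝ ℝ P).prod (b • LinearMap.fst ℝ ℝ P))

theorem graphMap_apply (b : ℝ) (P : Submodule ℝ E) (x : ℝ × P) :
    graphMap b P x = (x.1, (x.2 : E), b * x.1) := rfl

theorem graphMap_injective (b : ℝ) (P : Submodule ℝ E) : Function.Injective (graphMap b P) := by
  intro x y h
  rw [graphMap_apply, graphMap_apply] at h
  simp only [Prod.mk.injEq] at h
  exact Prod.ext h.1 (Subtype.ext h.2.1)

/-- The form `2ρ dt² + 2t dt dρ + c B` has signature `(p + 1, q + 1)` if `B` has signature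
`(p, q)` and `c` is positive. -/
theorem HasSignature.ambient [FiniteDimensional ℝ E] {B : E →L[ℝ] E →L[ℝ] ℝ} {p q : ℕ}
    (hB : HasSignature B p q) {t r c : ℝ} (ht : t ≠ 0) (hc : 0 < c)
    {A : (ℝ × E × ℝ) →L[ℝ] (ℝ × E × ℝ) →L[ℝ] ℝ}
    (hA : ∀ u v, A u v = 2 * r * (u.1 * v.1) + t * (u.1 * v.2.2 + u.2.2 * v.1)
      + c * B u.2.1 v.2.1) : HasSignature A (p + 1) (q + 1) := by
  obtain ⟨P, Q, hPQ, hp, hq, hP, hQ⟩ := hB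
  have hval : ∀ (b : ℝ) (S : Submodule ℝ E) (x : ℝ × S), A (graphMap b S x) (graphMap b S x) =
      (2 * r + 2 * t * b) * x.1 ^ 2 + c * B x.2 x.2 := by
    intro b S x
    rw [hA, graphMap_apply]
    ring
  -- On (a, v, ab) the form is (2r + 2tb)a² + cB(v, v). The slopes b are chosen to make the
  -- coefficient of a² equal to 1 over P and to -1 over Q.
  have e₁ : 2 * r + 2 * t * ((1 - 2 * r) / (2 * t)) = 1 := by field_simp; ring
  have e₂ : 2 * r + 2 * t * ((-1 - 2 * r) / (2 * t)) = -1 := by field_simp; ring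
  have hpos : ∀ v ∈ (graphMap ((1 - 2 * r) / (2 * t)) P).range, v ≠ 0 → 0 < A v v := by
    rintro _ ⟨x, rfl⟩ hx
    rw [hval, e₁, one_mul]
    by_cases h2 : (x.2 : E) = 0
    · have h1 : x.1 ≠ 0 := fun h1 => hx (by rw [graphMap_apply, h1, h2]; simp)
      rw [h2, map_zero, mul_zero, add_zero]
      positivity
    · have := hP _ x.2.2 h2
      positivity
  have hneg : ∀ v ∈ (graphMap ((-1 - 2 * r) / (2 * t)) Q).range, v ≠ 0 → A v v < 0 := by
    rintro _ ⟨x, rfl⟩ hx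
    rw [hval, e₂]
    by_cases h2 : (x.2 : E) = 0
    · have h1 : x.1 ≠ 0 := fun h1 => hx (by rw [graphMap_apply, h1, h2]; simp)
      have : 0 < x.1 ^ 2 := by positivity
      rw [h2, map_zero, mul_zero]
      linarith
    · have h1 := mul_pos hc (neg_pos.2 (hQ _ x.2.2 h2))
      nlinarith [sq_nonneg x.1]
  refine ⟨_, _, ⟨?_, ?_⟩, ?_, ?_, hpos, hneg⟩
  · rw [Submodule.disjoint_def]
    intro v h1 h2
    by_contra hv
    exact lt_asymm (hpos v h1 hv) (hneg v h2 hv)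
  · rw [codisjoint_iff, eq_top_iff]
    rintro ⟨a, v, b⟩ -
    obtain ⟨x, hx, y, hy, rfl⟩ := Submodule.mem_sup.1
      (hPQ.sup_eq_top ▸ Submodule.mem_top : v ∈ P ⊔ Q)
    -- With slopes b₁ and b₂ one solves a₁ + a₂ = a and b₁a₁ + b₂a₂ = b; as b₁ - b₂ = 1/t, this
    -- gives a₁ = tb + (1 + 2r)a/2.
    refine Submodule.mem_sup.2 ⟨_, ⟨(t * b + (1 + 2 * r) / 2 * a, ⟨x, hx⟩), rfl⟩, _,
      ⟨(a - (t * b + (1 + 2 * r) / 2 * a), ⟨y, hy⟩), rfl⟩, ?_⟩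
    rw [graphMap_apply, graphMap_apply]
    refine Prod.ext (by simp) (Prod.ext rfl ?_)
    simp only [Prod.snd_add]
    field_simp
    ring
  · rw [LinearMap.finrank_range_of_inj (graphMap_injective _ _), Module.finrank_prod, hp,
      Module.finrank_self, add_comm]
  · rw [LinearMap.finrank_range_of_inj (graphMap_injective _ _), Module.finrank_prod, hq,
      Module.finrank_self, add_comm]

end AmbientSignature

/-! ### The explicit ambient space and the theorem. -/

section Model

variable {n : ℕ} {M : Type*} [TopologicalSpace M] [ChartedSpace (EuclideanSpace ℝ (Fin n)) M]

theorem isOpen_ambientStrip (ε : ℝ) : IsOpen (ambientStrip M ε) :=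
  (isOpen_lt continuous_const continuous_fst).inter
    (isOpen_lt (continuous_abs.comp (continuous_snd.comp continuous_snd)) continuous_const)

theorem one_add_mul_pos_of_mem_ambientStrip {lam ε : ℝ} (hε : |lam| * ε ≤ 1) {z : ℝ × M × ℝ}
    (hz : z ∈ ambientStrip M ε) : 0 < 1 + lam * z.2.2 := by
  rcases eq_or_ne lam 0 with rfl | h0
  · simp
  · have h1 : |lam * z.2.2| < 1 := by
      rw [abs_mul]
      exact (mul_lt_mul_of_pos_left hz.2 (abs_pos.2 h0)).trans_le hε
    linarith [(abs_lt.1 h1).1]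

variable [IsManifold (𝓡 n) ∞ M]

theorem mfderiv_dilation_apply (s : ℝ) (z : ℝ × M × ℝ) (v : ℝ × EuclideanSpace ℝ (Fin n) × ℝ) :
    (mfderiv (ambientModel n) (ambientModel n) (dilation M s) z v :
      ℝ × EuclideanSpace ℝ (Fin n) × ℝ) = (s * v.1, v.2.1, v.2.2) := by
  have h1 : HasMFDerivAt 𝓘(ℝ, ℝ) 𝓘(ℝ, ℝ) (fun t : ℝ => s * t) z.1
      (s • ContinuousLinearMap.id ℝ ℝ) :=
    ((hasFDerivAt_id (𝕜 := ℝ) z.1).const_mul s).hasMFDerivAt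
  have h2 := h1.prodMap (hasMFDerivAt_id (I := (𝓡 n).prod 𝓘(ℝ, ℝ)) z.2)
  have h3 : dilation M s = Prod.map (fun t : ℝ => s * t) id := rfl
  rw [h3, h2.mfderiv, h1.mfderiv, mfderiv_id]
  rfl

variable {g : TwoTensor (𝓡 n) M} {lam : ℝ}

theorem IsNondegenerateMetricOn.isStraightMetric_ambientStrip
    (hg : IsNondegenerateMetricOn g Set.univ) {ε : ℝ} (hε : 0 < ε) (hlam : |lam| * ε ≤ 1) :
    IsStraightMetric (einsteinFamily g lam) (ambientStrip M ε) where
  metric := hg.isNondegenerateMetricOn_straightNormal (isOpen_ambientStrip ε) (fun _ hz => hz.1)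
    fun _ hz => (one_add_mul_pos_of_mem_ambientStrip hlam hz).ne'
  pos _ hz := hz.1
  cone_mem _ _ ht := ⟨ht, by simpa using hε⟩
  dilation_mem _ hs _ hz := ⟨mul_pos hs hz.1, hz.2⟩

theorem IsPseudoRiemannianOn.isPreAmbient_einsteinFamily {p q : ℕ}
    (hg : IsPseudoRiemannianOn (𝓡 n) g Set.univ p q) {ε : ℝ} (hε : 0 < ε)
    (hlam : |lam| * ε ≤ 1) :
    IsPreAmbient g p q (ambientStrip M ε) (straightNormal (einsteinFamily g lam)) := by
  have h := (hg.isNondegenerateMetricOn isOpen_univ).isStraightMetric_ambientStrip hε hlam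
  refine ⟨h.metric.isOpen, h.pos, h.cone_mem, h.dilation_mem, ⟨h.metric.smooth, h.metric.symm,
    fun z hz => ?_⟩, fun s hs z hz u v => ?_, fun t x ht a b u v => ?_⟩
  · have h1 := pow_pos (one_add_mul_pos_of_mem_ambientStrip hlam hz) 2
    refine (hg.signature z.2.1 trivial).ambient (t := z.1) (r := z.2.2)
      (c := z.1 ^ 2 * (1 + lam * z.2.2) ^ 2) hz.1.ne' (mul_pos (pow_pos hz.1 2) h1) fun u v => ?_
    refine (straightNormal_form_apply (einsteinFamily g lam) z u v).trans ?_
    have e : (einsteinFamily g lam z.2.2).form z.2.1 u.2.1 v.2.1 =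
        (1 + lam * z.2.2) ^ 2 * g z.2.1 u.2.1 v.2.1 := rfl
    rw [e, mul_assoc (z.1 ^ 2)]
    rfl
  · have e1 := straightNormal_form_apply (einsteinFamily g lam) z u v
    have e2 := straightNormal_form_apply (einsteinFamily g lam) (dilation M s z)
      (s * u.1, u.2.1, u.2.2) (s * v.1, v.2.1, v.2.2)
    have e3 := congrArg₂ (fun a b => (straightNormal (einsteinFamily g lam)).form
      (dilation M s z) a b) (mfderiv_dilation_apply s z u) (mfderiv_dilation_apply s z v)
    refine e3.trans (e2.trans (Eq.trans ?_ (congrArg (s ^ 2 * ·) e1).symm))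
    simp only [dilation]
    ring
  · have e1 := straightNormal_form_apply (einsteinFamily g lam) (t, x, 0) (a, u, 0) (b, v, 0)
    refine e1.trans ?_
    have e2 : (einsteinFamily g lam 0).form x u v = (1 + lam * 0) ^ 2 * g x u v := rfl
    simp only [e2]
    ring

theorem IsNondegenerateMetricOn.ricci_einsteinFamily (hg : IsNondegenerateMetricOn g Set.univ)
    (hE : ∀ (x : M) (u v : TangentSpace (𝓡 n) x),
      ricci (𝓡 n) g x u v = 2 * ((n : ℝ) - 1) * lam * g x u v) {z : ℝ × M × ℝ} (hz : 0 < z.1)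
    (hlam : 1 + lam * z.2.2 ≠ 0) (u v : TangentSpace (ambientModel n) z) :
    ricci (ambientModel n) (straightNormal (einsteinFamily g lam)) z u v = 0 := by
  have h1 := ricci_straightNormal (einsteinFamily g lam) z u v
  refine h1.trans ?_
  refine (hg.isMetricOn_target z.2.1).ricci_ambientCoord_einsteinCoord lam
    (z := (z.1, extChartAt (𝓡 n) z.2.1 z.2.1, z.2.2)) hz
    ⟨mem_extChartAt_target z.2.1, hlam⟩ (fun u v => ?_) u v
  rw [finrank_euclideanSpace_fin]
  have h1 := (ricci_eq_coord g z.2.1 u v).symm.trans (hE z.2.1 u v)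
  have h2 : g.coord (𝓡 n) z.2.1 (extChartAt (𝓡 n) z.2.1 z.2.1) = g.form z.2.1 := coord_self g z.2.1
  simp only
  rw [h1, h2]
  rfl

theorem TwoTensor.smoothOn_zero {V : Type*} [NormedAddCommGroup V] [NormedSpace ℝ V]
    {H : Type*} [TopologicalSpace H] {I : ModelWithCorners ℝ V H}
    {N : Type*} [TopologicalSpace N] [ChartedSpace H N] (U : Set N) :
    TwoTensor.SmoothOn I (0 : TwoTensor I N) U := fun p => by
  have h : (0 : TwoTensor I N).coord I p = fun _ => 0 := rfl
  rw [h]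
  exact contDiffOn_const

/-- The explicit ambient space of an Einstein manifold. -/
theorem IsPseudoRiemannianOn.isAmbient_einsteinFamily {p q : ℕ}
    (hg : IsPseudoRiemannianOn (𝓡 n) g Set.univ p q)
    (hE : ∀ (x : M) (u v : TangentSpace (𝓡 n) x),
      ricci (𝓡 n) g x u v = 2 * ((n : ℝ) - 1) * lam * g x u v) {ε : ℝ} (hε : 0 < ε)
    (hlam : |lam| * ε ≤ 1) :
    IsAmbient g p q (ambientStrip M ε) (straightNormal (einsteinFamily g lam)) := by
  have hR : ∀ m : ℕ, ∀ z ∈ ambientStrip M ε, ∀ u v,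
      ricci (ambientModel n) (straightNormal (einsteinFamily g lam)) z u v =
        z.2.2 ^ m * (0 : TwoTensor (ambientModel n) (ℝ × M × ℝ)) z u v := by
    intro m z hz u v
    refine ((hg.isNondegenerateMetricOn isOpen_univ).ricci_einsteinFamily hE
      hz.1 (one_add_mul_pos_of_mem_ambientStrip hlam hz).ne' u v).trans ?_
    exact (mul_zero _).symm
  -- By Ricci flatness the quotient of the Ricci tensor by any power of ρ may be taken to be zero,
  -- so the odd and the even condition both hold with T = 0 and σ = 0.
  refine ⟨hg.isPreAmbient_einsteinFamily hε hlam,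
    fun _ m => ⟨0, TwoTensor.smoothOn_zero _, hR m⟩,
    fun _ => ⟨0, TwoTensor.smoothOn_zero _, hR _, fun t x _ => ⟨0, fun u v => rfl, ?_,
      fun a b u v => rfl⟩⟩⟩
  have h0 : ((CoordGeom.metricTrace (V := EuclideanSpace ℝ (Fin n)) (g x) 0) : ℝ) = 0 := by
    simp [CoordGeom.metricTrace]
  exact h0

theorem familiesAgree_einsteinFamily (W : Set (ℝ × M × ℝ)) (k : ℕ) :
    FamiliesAgree g lam (einsteinFamily g lam) W k := by
  intro x
  have h : (fun p => familyCoord (einsteinFamily g lam) x p -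
      CoordGeom.einsteinCoord (g.coord (𝓡 n) x) lam p) = fun _ => 0 :=
    funext fun p => sub_self (familyCoord (einsteinFamily g lam) x p)
  rw [h]
  exact ⟨contDiffOn_const, fun _ _ => VanishesTo.zero⟩

theorem tracesAgree_einsteinFamily (k : ℕ) : TracesAgree g lam (einsteinFamily g lam) k := by
  intro x
  simp only [familyCoord_einsteinFamily, sub_self]
  exact VanishesTo.zero

end Model

end

theorem mainTheorem7 {n : ℕ} (hn : 2 ≤ n) {M : Type*} [TopologicalSpace M]
    [ChartedSpace (EuclideanSpace ℝ (Fin n)) M] [IsManifold (𝓡 n) ∞ M]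
    (p q : ℕ) (g : TwoTensor (𝓡 n) M) (hg : IsPseudoRiemannianOn (𝓡 n) g Set.univ p q)
    (lam : ℝ)
    (hE : ∀ (x : M) (u v : TangentSpace (𝓡 n) x),
      ricci (𝓡 n) g x u v = 2 * ((n : ℝ) - 1) * lam * g x u v)
    (k : ℕ) (hk : 1 ≤ k) (w₁ w₂ : ℝ) (hw : AdmissibleWeights n k w₁ w₂) :
    -- the explicit ambient space of the Einstein manifold, and all orders
    (∀ ε : ℝ, 0 < ε → |lam| * ε ≤ 1 →
      IsAmbient g p q (ambientStrip M ε) (straightNormal (einsteinFamily g lam)) ∧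
      (∀ z ∈ ambientStrip M ε, ∀ u v : TangentSpace (ambientModel n) z,
        ricci (ambientModel n) (straightNormal (einsteinFamily g lam)) z u v = 0) ∧
      IsORoperator (ambientStrip M ε) (straightNormal (einsteinFamily g lam)) k w₁ w₂
        (einsteinOR g lam k w₁ w₂)) ∧
    -- every ambient space in straight and normal form, in the range of orders in which the
    -- operator does not depend on the choice of the ambient space
    (∀ (W : Set (ℝ × M × ℝ)) (γ : ℝ → TwoTensor (𝓡 n) M),
      IsAmbient g p q W (straightNormal γ) → (Odd n ∨ 2 * k ≤ n) →
      IsORoperator W (straightNormal γ) k w₁ w₂ (einsteinOR g lam k w₁ w₂)) := by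
  have hg' := hg.isNondegenerateMetricOn isOpen_univ
  refine ⟨fun ε hε hlam => ⟨hg.isAmbient_einsteinFamily hE hε hlam, fun z hz u v => ?_, ?_⟩,
    fun W γ h hnk => ?_⟩
  · exact hg'.ricci_einsteinFamily hE hz.1 (one_add_mul_pos_of_mem_ambientStrip hlam hz).ne' u v
  -- The model agrees with itself to every order, so no relation between k and n is needed here.
  · exact (hg'.isStraightMetric_ambientStrip hε hlam).isORoperator hg'
      (familiesAgree_einsteinFamily _ k) (tracesAgree_einsteinFamily k) w₁ w₂
  · obtain ⟨h1, h2⟩ := h.agree hn hg' hE hk hnk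
    exact h.toIsPreAmbient.isStraightMetric.isORoperator hg' h1 h2 w₁ w₂
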